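/- **Definitions.** A compact polyhedron is a subset of some $\mathbb R^m$ that is the underlying space of a finite (geometric) simplicial complex, called a triangulation of it; a map between compact polyhedra is piecewise linear if it is affine on each simplex of some triangulation of its domain. A (piecewise linear) pseudomanifold of dimension $n$ is a compact polyhedron with a finite triangulation in which every simplex is a face of an $n$-simplex and every $(n-1)$-simplex is a face of precisely two $n$-simplices. (It need not be connected.) A covering map is finite if all its fibres are finite (the number of points may vary and may be $0$); it is $k$-fold if all its fibres have exactly $k$ points. A branched covering map of pseudomanifolds with branched part $B$ consists of a piecewise linear map $f:Y\to X$ of pseudomanifolds and a closed subpolyhedron $B\subset Y$ of codimension at least $2$ such that (1) every fibre $f^{-1}(x)$, $x\in X$, is finite, and (2) $f$ maps $Y-B$ into $X-f(B)$ and restricts to a covering map $Y-B\to X-f(B)$. It is $k$-fold if this covering map is $k$-fold. Let $X$ be a pseudomanifold of dimension $n$, let $V\subset X$ be a closed subpolyhedron of codimension at least $2$, and let $f_1:Y_1\to X-V$ be a finite covering map. An extension of $f_1$ is a branched covering map $f':Y'\to X$ (with any branched part) together with a homeomorphism $i'$ from $Y_1$ onto $f'^{-1}(X-V)=Y'-f'^{-1}(V)$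 such that $f'\circ i'=f_1$. **Proposition.** There is a pseudomanifold $Y$ of dimension $n$ and a branched covering map $f:Y\to X$ with branched part $f^{-1}(V)$ which, together with a homeomorphism $i:Y_1\to Y-f^{-1}(V)$, is an extension of $f_1$; if $f_1$ is $k$-fold, then so is $f$. Moreover $(f,i)$ can be chosen to be initial: for every extension $(f':Y'\to X,\ i')$ of $f_1$ there is a unique map $g:Y\to Y'$ that is a $1$-fold branched covering map (for some branched part) and satisfies $f=f'\circ g$ and $g\circ i=i'$. -/

import Mathlib

open Set

/-- `K` is a (finite, straight) triangulation of the compact polyhedron `X`. -/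
structure IsTriangulation {E : Type*} [AddCommGroup E] [Module ℝ E]
    (K : Geometry.SimplicialComplex ℝ E) (X : Set E) : Prop where
  finite : K.faces.Finite
  space_eq : K.space = X

/-- `X` is a piecewise linear pseudomanifold of dimension `n`: a compact polyhedron with a finite
triangulation in which every simplex is a face of an `n`-simplex and every `(n-1)`-simplex is a
face of precisely two `n`-simplices. A simplex is given by its vertex set, so a `d`-simplex is a
face with `d + 1` elements (and faces are nonempty). -/
def IsPseudomanifold {E : Type*} [AddCommGroup E] [Module ℝ E] (n : ℕ) (X : Set E) : Prop :=
  ∃ K : Geometry.SimplicialComplex ℝ E, IsTriangulation K X ∧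
    (∀ s ∈ K.faces, ∃ t ∈ K.faces, s ⊆ t ∧ t.card = n + 1) ∧
    (∀ s ∈ K.faces, s.card = n → {t | t ∈ K.faces ∧ s ⊆ t ∧ t.card = n + 1}.ncard = 2)

/-- `B ⊆ X` is a closed subpolyhedron of dimension at most `n - c` (an inequality between
integers), that is, of codimension at least `c` when `X` has dimension `n`. -/
def IsSubpolyhedronOfCodimGE {E : Type*} [AddCommGroup E] [Module ℝ E] {X : Set E}
    (n c : ℕ) (B : Set X) : Prop :=
  ∃ L : Geometry.SimplicialComplex ℝ E, IsTriangulation L ((↑) '' B) ∧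
    ∀ s ∈ L.faces, s.card + c ≤ n + 1

/-- A map of compact polyhedra is piecewise linear if it is affine on each simplex of some finite
triangulation of its domain. -/
def IsPiecewiseLinear {E F : Type*} [AddCommGroup E] [Module ℝ E] [AddCommGroup F] [Module ℝ F]
    {Y : Set E} {X : Set F} (f : Y → X) : Prop :=
  ∃ K : Geometry.SimplicialComplex ℝ E, IsTriangulation K Y ∧
    ∀ s ∈ K.faces, ∃ A : E →ᵃ[ℝ] F, ∀ y : Y, (y : E) ∈ convexHull ℝ (s : Set E) → (f y : F) = A y

/-- `f : Y → X` is a branched covering map of pseudomanifolds with branched part `B ⊆ Y`.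
The number of points of an unbranched fibre may vary, see `IsFoldBranchedCovering`. -/
structure IsBranchedCovering {E F : Type*}
    [AddCommGroup E] [Module ℝ E] [TopologicalSpace E]
    [AddCommGroup F] [Module ℝ F] [TopologicalSpace F]
    {Y : Set E} {X : Set F} (f : Y → X) (B : Set Y) : Prop where
  target : ∃ n, IsPseudomanifold n X
  source : ∃ n, IsPseudomanifold n Y ∧ IsSubpolyhedronOfCodimGE n 2 B
  piecewiseLinear : IsPiecewiseLinear f
  finite_fiber : ∀ x, (f ⁻¹' {x}).Finite
  mapsTo : MapsTo f Bᶜ (f '' B)ᶜ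
  covering : IsCoveringMap (mapsTo.restrict f Bᶜ (f '' B)ᶜ)

/-- A `k`-fold branched covering map: the covering map `Y - B → X - f(B)` is `k`-fold. -/
structure IsFoldBranchedCovering {E F : Type*}
    [AddCommGroup E] [Module ℝ E] [TopologicalSpace E]
    [AddCommGroup F] [Module ℝ F] [TopologicalSpace F]
    {Y : Set E} {X : Set F} (k : ℕ) (f : Y → X) (B : Set Y) : Prop
    extends IsBranchedCovering f B where
  card_fiber : ∀ x, ((mapsTo.restrict f Bᶜ (f '' B)ᶜ) ⁻¹' {x}).ncard = k

/-- `f : Y → X`, together with `i : Y₁ → Y`, extends the map `f₁ : Y₁ → X - V`: the map `i`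
identifies `Y₁` with the part `Y - f⁻¹(V)` of `Y` over `X - V`, and `f` with `f₁` there. -/
structure IsExtension {Y₁ Y X : Type*} [TopologicalSpace Y₁] [TopologicalSpace Y] {V : Set X}
    (f₁ : Y₁ → ↥(Vᶜ)) (f : Y → X) (i : Y₁ → Y) : Prop where
  isEmbedding : Topology.IsEmbedding i
  range_eq : range i = (f ⁻¹' V)ᶜ
  comm : ∀ y, f (i y) = f₁ y

/-! Triangulate `X` by a complex `K` in which `V` is a union of simplices, recorded by a set `D` of
vertex sets (`exists_subdivides_subcomplex`). Over the open star of a simplex σ, the connected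
components of the part of `Y₁` lying there are called sheets. If σ is not in `V`, the star contracts
along straight segments to the barycenter of σ without meeting `V`. Lifting this homotopy shows that
each sheet maps bijectively onto the star (`sheet_injOn`, `exists_mem_sheet`). Hence sheets over all
stars are open and finite in number (`isOpen_sheet`, `finite_sheets`).

The pairs (σ, sheet) are the simplices of the completion. They form a simplicial poset, ordered by
inclusion of simplices and reverse inclusion of sheets, and `Y` is the order complex of this poset,
realized in a Euclidean space; the projection to `X` is the restriction of a linear map that sends
the vertex of a pair to the barycenter of its simplex. A point of `Y₁` is placed in `Y` by giving
its barycentric layers in `K` to the sheets containing it (`coverWeights`). Since `V` has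
codimension at least 2, codimension-one simplices are not in `V`, so their sheets see exactly the
two top simplices seen downstairs; this makes `Y` a pseudomanifold (`ncard_le_card`,
`IsSimplicialPoset.ncard_chains`).

For initiality, the points of `Y₁` near a point of `Y` form connected sets: contracting towards the
point below, but stopping short of it, avoids `V` (`isPreconnected_sheet_inter`). As `Y'` is compact
and the fibres of `f'` are finite and hence separable, `i'` has a unique limit at each point of `Y`
and extends to a continuous `g` (`exists_continuous_extension`). A continuous lift of a linear map
through a piecewise linear map with finite fibres is piecewise linear (`isPiecewiseLinear_of_lift`).
Away from the preimage of `V` it is a homeomorphism, hence one-fold; density of `Y₁` in `Y` gives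
uniqueness. -/

/-! ### Barycentric weights -/

section Weights

/-- The total mass of a finitely supported weight function. -/
noncomputable def totalWeight (E : Type*) : (E →₀ ℝ) →ₗ[ℝ] ℝ :=
  Finsupp.linearCombination ℝ (fun _ : E => (1 : ℝ))

@[simp] lemma totalWeight_single {E : Type*} (v : E) (r : ℝ) : totalWeight E (Finsupp.single v r) = r := by
  simp [totalWeight]

lemma totalWeight_eq_sum {E : Type*} {w : E →₀ ℝ} {s : Finset E} (h : w.support ⊆ s) :
    totalWeight E w = ∑ v ∈ s, w v := by
  rw [totalWeight, Finsupp.linearCombination_apply, Finsupp.sum_of_support_subset _ h _ (by simp)]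
  simp

variable {E : Type*} [AddCommGroup E] [Module ℝ E]

/-- The weighted sum of points. -/
noncomputable def weightedPoint : (E →₀ ℝ) →ₗ[ℝ] E := Finsupp.linearCombination ℝ id

@[simp] lemma weightedPoint_single (v : E) (r : ℝ) :
    weightedPoint (Finsupp.single v r) = r • v := by
  simp [weightedPoint]

lemma weightedPoint_eq_sum {w : E →₀ ℝ} {s : Finset E} (h : w.support ⊆ s) :
    weightedPoint w = ∑ v ∈ s, w v • v := by
  rw [weightedPoint, Finsupp.linearCombination_apply, Finsupp.sum_of_support_subset _ h _ (by simp)]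
  simp

/-- `w` is a family of barycentric weights for the point `x`. -/
structure IsBary (w : E →₀ ℝ) (x : E) : Prop where
  nonneg : ∀ v, 0 ≤ w v
  total : totalWeight E w = 1
  point : weightedPoint w = x

lemma IsBary.support_nonempty {w : E →₀ ℝ} {x : E} (h : IsBary w x) : w.support.Nonempty := by
  rw [Finset.nonempty_iff_ne_empty]
  intro h0
  have := h.total
  rw [totalWeight_eq_sum h0.le] at this
  simp at this

lemma IsBary.mem_convexHull {w : E →₀ ℝ} {x : E} (h : IsBary w x) {s : Finset E}
    (hs : w.support ⊆ s) : x ∈ convexHull ℝ (s : Set E) := by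
  rw [Finset.mem_convexHull']
  exact ⟨w, fun v _ => h.nonneg v, by rw [← totalWeight_eq_sum hs, h.total],
    by rw [← weightedPoint_eq_sum hs, h.point]⟩

lemma exists_isBary_of_mem_convexHull {s : Finset E} {x : E}
    (h : x ∈ convexHull ℝ (s : Set E)) : ∃ w : E →₀ ℝ, IsBary w x ∧ w.support ⊆ s := by
  classical
  rw [Finset.mem_convexHull'] at h
  obtain ⟨w, h0, h1, h2⟩ := h
  have hs : (Finsupp.onFinset s (fun v => if v ∈ s then w v else 0) (by intro v; simp; tauto)).support
      ⊆ s := Finsupp.support_onFinset_subset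
  refine ⟨_, ⟨fun v => ?_, ?_, ?_⟩, hs⟩
  · simp only [Finsupp.onFinset_apply]
    split_ifs with hv
    exacts [h0 v hv, le_rfl]
  · rw [totalWeight_eq_sum hs, ← h1]
    exact Finset.sum_congr rfl fun v hv => by simp [hv]
  · rw [weightedPoint_eq_sum hs, ← h2]
    exact Finset.sum_congr rfl fun v hv => by simp [hv]

lemma IsBary.combo {w w' : E →₀ ℝ} {x x' : E} (h : IsBary w x) (h' : IsBary w' x') {r s : ℝ}
    (hr : 0 ≤ r) (hs : 0 ≤ s) (hrs : r + s = 1) :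
    IsBary (r • w + s • w') (r • x + s • x') where
  nonneg v := by
    have := h.nonneg v
    have := h'.nonneg v
    simp only [Finsupp.add_apply, Finsupp.smul_apply, smul_eq_mul]
    positivity
  total := by rw [map_add, map_smul, map_smul, h.total, h'.total]; simpa using hrs
  point := by rw [map_add, map_smul, map_smul, h.point, h'.point]

/-- Affine dependences are expressed as finitely supported functions on all of `E`, so that weights
supported on different simplices can be subtracted. -/
lemma affineIndependent_iff_weights {s : Finset E} :
    AffineIndependent ℝ ((↑) : s → E) ↔ ∀ d : E →₀ ℝ, d.support ⊆ s → totalWeight E d = 0 →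
      weightedPoint d = 0 → d = 0 := by
  classical
  rw [affineIndependent_iff]
  constructor
  · intro h d hd h0 h1
    rw [totalWeight_eq_sum hd, ← Finset.sum_coe_sort] at h0
    rw [weightedPoint_eq_sum hd, ← Finset.sum_coe_sort s (fun v => d v • v)] at h1
    have := h Finset.univ (fun v => d v) h0 h1
    ext v
    by_cases hv : v ∈ s
    · exact this ⟨v, hv⟩ (Finset.mem_univ _)
    · exact Finsupp.notMem_support_iff.1 fun h => hv (hd h)
  · intro h t w h0 h1 e he
    let d : E →₀ ℝ := ∑ e ∈ t, Finsupp.single (e : E) (w e)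
    have hd : d = 0 := by
      refine h d ?_ ?_ ?_
      · refine (Finsupp.support_finsetSum).trans ?_
        intro v hv
        simp only [Finset.mem_biUnion] at hv
        obtain ⟨e, -, hv⟩ := hv
        have := Finsupp.support_single_subset hv
        simp only [Finset.mem_singleton] at this
        rw [this]; exact e.2
      · simpa [d, map_sum] using h0
      · simpa [d, map_sum] using h1
    have : d e = w e := by
      simp only [d, Finsupp.finsetSum_apply, Finsupp.single_apply]
      rw [Finset.sum_eq_single_of_mem e he]
      · simp
      · intro b _ hb
        rw [if_neg]
        exact fun h => hb (Subtype.ext h)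
    rw [← this, hd]; rfl

lemma IsBary.unique_of_affineIndependent {s : Finset E}
    (hs : AffineIndependent ℝ ((↑) : s → E)) {w w' : E →₀ ℝ} {x : E} (h : IsBary w x)
    (h' : IsBary w' x) (hw : w.support ⊆ s) (hw' : w'.support ⊆ s) : w = w' := by
  classical
  rw [← sub_eq_zero]
  refine affineIndependent_iff_weights.1 hs _ (Finsupp.support_sub.trans (Finset.union_subset hw hw'))
    ?_ ?_
  · rw [map_sub, h.total, h'.total, sub_self]
  · rw [map_sub, h.point, h'.point, sub_self]

/-- A finite set is affinely independent as soon as barycentric weights on it are unique. -/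
lemma affineIndependent_of_isBary_unique {s : Finset E}
    (hs : ∀ (w w' : E →₀ ℝ) (x : E), IsBary w x → IsBary w' x → w.support ⊆ s → w'.support ⊆ s →
      w = w') : AffineIndependent ℝ ((↑) : s → E) := by
  classical
  rw [affineIndependent_iff_weights]
  intro d hd h0 h1
  -- A dependence is split into its positive and negative parts, which have the same mass and the
  -- same weighted sum. If the mass is positive, rescaling yields two barycentric families for one
  -- point.
  let dp : E →₀ ℝ := d.mapRange (fun r => max r 0) (by simp)
  let dm : E →₀ ℝ := d.mapRange (fun r => max (-r) 0) (by simp)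
  have hsub : d = dp - dm := by
    ext v
    simp only [dp, dm, Finsupp.sub_apply, Finsupp.mapRange_apply]
    rcases le_total (d v) 0 with h | h
    · rw [max_eq_right h, max_eq_left (by linarith)]; ring
    · rw [max_eq_left h, max_eq_right (by linarith)]; ring
  have hp : dp.support ⊆ s := (Finsupp.support_mapRange).trans hd
  have hm : dm.support ⊆ s := (Finsupp.support_mapRange).trans hd
  have hp0 : ∀ v, 0 ≤ dp v := fun v => by simp [dp]
  have hm0 : ∀ v, 0 ≤ dm v := fun v => by simp [dm]
  have ht : totalWeight E dp = totalWeight E dm := by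
    rw [hsub, map_sub] at h0; linarith
  have hq : weightedPoint dp = weightedPoint dm := by
    rw [hsub, map_sub] at h1; exact sub_eq_zero.1 h1
  have hc0 : 0 ≤ totalWeight E dp := by
    rw [totalWeight_eq_sum hp]; exact Finset.sum_nonneg fun v _ => hp0 v
  rcases hc0.eq_or_lt with hc | hc
  · have hz : ∀ f : E →₀ ℝ, f.support ⊆ s → (∀ v, 0 ≤ f v) → totalWeight E f = 0 → f = 0 := by
      intro f hf hf0 hft
      rw [totalWeight_eq_sum hf, Finset.sum_eq_zero_iff_of_nonneg fun v _ => hf0 v] at hft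
      ext v
      by_cases hv : v ∈ s
      · exact hft v hv
      · exact Finsupp.notMem_support_iff.1 fun h => hv (hf h)
    rw [hsub, hz dp hp hp0 hc.symm, hz dm hm hm0 (ht ▸ hc.symm), sub_self]
  · have := hs ((totalWeight E dp)⁻¹ • dp) ((totalWeight E dp)⁻¹ • dm)
      ((totalWeight E dp)⁻¹ • weightedPoint dp)
      ⟨fun v => ?_, ?_, ?_⟩ ⟨fun v => ?_, ?_, ?_⟩
      (Finsupp.support_smul.trans hp) (Finsupp.support_smul.trans hm)
    · rw [hsub, smul_right_injective _ (inv_ne_zero hc.ne') this, sub_self]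
    · simpa using mul_nonneg (inv_nonneg.2 hc.le) (hp0 v)
    · rw [map_smul, smul_eq_mul, inv_mul_cancel₀ hc.ne']
    · rw [map_smul]
    · simpa using mul_nonneg (inv_nonneg.2 hc.le) (hm0 v)
    · rw [map_smul, smul_eq_mul, ← ht, inv_mul_cancel₀ hc.ne']
    · rw [map_smul, hq]

end Weights

/-! ### Simplicial complexes through unique barycentric weights; carriers of points. -/

namespace Geometry.SimplicialComplex

variable {E : Type*} [AddCommGroup E] [Module ℝ E]

/-- A family of finite sets is a geometric simplicial complex if the barycentric weights
supported on its members are unique. -/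
def ofUniqueWeights (F : Set (Finset E)) (hne : ∀ s ∈ F, s.Nonempty)
    (hdown : ∀ s ∈ F, ∀ t ⊆ s, t.Nonempty → t ∈ F)
    (huniq : ∀ (w w' : E →₀ ℝ) (x : E), IsBary w x → IsBary w' x → w.support ∈ F →
      w'.support ∈ F → w = w') : SimplicialComplex ℝ E where
  faces := F
  isRelLowerSet_faces := fun s hs => ⟨hne s hs, fun t hts ht => hdown s hs t hts ht⟩
  indep := fun {s} hs => affineIndependent_of_isBary_unique fun w w' x hw hw' hs1 hs2 =>
    huniq w w' x hw hw' (hdown s hs _ hs1 hw.support_nonempty)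
      (hdown s hs _ hs2 hw'.support_nonempty)
  inter_subset_convexHull := by
    classical
    rintro s t hs ht x ⟨hxs, hxt⟩
    obtain ⟨w, hw, hws⟩ := exists_isBary_of_mem_convexHull hxs
    obtain ⟨w', hw', hwt⟩ := exists_isBary_of_mem_convexHull hxt
    have := huniq w w' x hw hw' (hdown s hs _ hws hw.support_nonempty)
      (hdown t ht _ hwt hw'.support_nonempty)
    subst this
    rw [← Finset.coe_inter]
    exact hw.mem_convexHull (Finset.subset_inter hws hwt)

variable (K : SimplicialComplex ℝ E)

/-- The point lies in both simplices, hence in the hull of their common vertices. Weights for it on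
this intersection agree with each of the two families by affine independence. -/
lemma isBary_unique {w w' : E →₀ ℝ} {x : E} (hw : IsBary w x) (hw' : IsBary w' x)
    (h : w.support ∈ K.faces) (h' : w'.support ∈ K.faces) : w = w' := by
  classical
  have hx := K.inter_subset_convexHull h h'
    ⟨hw.mem_convexHull subset_rfl, hw'.mem_convexHull subset_rfl⟩
  rw [← Finset.coe_inter] at hx
  obtain ⟨u, hu, hus⟩ := exists_isBary_of_mem_convexHull hx
  rw [hw.unique_of_affineIndependent (K.indep h) hu subset_rfl
      (hus.trans Finset.inter_subset_left),
    hw'.unique_of_affineIndependent (K.indep h') hu subset_rfl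
      (hus.trans Finset.inter_subset_right)]

lemma exists_isBary {x : E} (hx : x ∈ K.space) : ∃ w, IsBary w x ∧ w.support ∈ K.faces := by
  obtain ⟨s, hs, hx⟩ := mem_space_iff.1 hx
  obtain ⟨w, hw, hws⟩ := exists_isBary_of_mem_convexHull hx
  exact ⟨w, hw, K.down_closed hs hws hw.support_nonempty⟩

open Classical in
/-- The barycentric weights of a point of the underlying space. -/
noncomputable def bary (x : E) : E →₀ ℝ :=
  if hx : x ∈ K.space then (K.exists_isBary hx).choose else 0

/-- The vertex set of the simplex containing a given point in its relative interior. -/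
noncomputable def carrier (x : E) : Finset E := (K.bary x).support

lemma isBary_bary {x : E} (hx : x ∈ K.space) : IsBary (K.bary x) x := by
  rw [bary, dif_pos hx]; exact (K.exists_isBary hx).choose_spec.1

lemma carrier_mem {x : E} (hx : x ∈ K.space) : K.carrier x ∈ K.faces := by
  rw [carrier, bary, dif_pos hx]; exact (K.exists_isBary hx).choose_spec.2

variable {K}

lemma mem_space_of_isBary {w : E →₀ ℝ} {x : E} (hw : IsBary w x) (h : w.support ∈ K.faces) :
    x ∈ K.space :=
  convexHull_subset_space h (hw.mem_convexHull subset_rfl)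

lemma bary_eq {w : E →₀ ℝ} {x : E} (hw : IsBary w x) (h : w.support ∈ K.faces) :
    K.bary x = w :=
  K.isBary_unique (K.isBary_bary (mem_space_of_isBary hw h)) hw
    (K.carrier_mem (mem_space_of_isBary hw h)) h

lemma carrier_eq {w : E →₀ ℝ} {x : E} (hw : IsBary w x) (h : w.support ∈ K.faces) :
    K.carrier x = w.support := by
  rw [carrier, bary_eq hw h]

lemma mem_convexHull_carrier {x : E} (hx : x ∈ K.space) :
    x ∈ convexHull ℝ (K.carrier x : Set E) :=
  (K.isBary_bary hx).mem_convexHull subset_rfl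

lemma mem_convexHull_iff_carrier_subset {x : E} (hx : x ∈ K.space) {s : Finset E}
    (hs : s ∈ K.faces) : x ∈ convexHull ℝ (s : Set E) ↔ K.carrier x ⊆ s := by
  refine ⟨fun h => ?_, fun h => (K.isBary_bary hx).mem_convexHull h⟩
  obtain ⟨w, hw, hws⟩ := exists_isBary_of_mem_convexHull h
  rwa [carrier_eq hw (K.down_closed hs hws hw.support_nonempty)]

/-- The coefficient of `z` is positive, so no vertex of the carrier of `z` loses its weight. Thus a
point moving straight towards a point of its closed carrier simplex stays in its open simplex until
it arrives; all radial contractions rest on this. -/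
lemma carrier_combo {p z : E} (hp : p ∈ K.space) (hz : z ∈ K.space)
    (h : K.carrier p ⊆ K.carrier z) {r s : ℝ} (hr : 0 ≤ r) (hs : 0 < s) (hrs : r + s = 1) :
    r • p + s • z ∈ K.space ∧ K.carrier (r • p + s • z) = K.carrier z := by
  classical
  have hb := (K.isBary_bary hp).combo (K.isBary_bary hz) hr hs.le hrs
  have hsupp : (r • K.bary p + s • K.bary z).support = K.carrier z := by
    ext v
    have h1 := (K.isBary_bary hp).nonneg v
    have h2 := (K.isBary_bary hz).nonneg v
    have h3 : K.bary z v = 0 → K.bary p v = 0 := by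
      intro h0
      by_contra h4
      exact Finsupp.mem_support_iff.1 (h (Finsupp.mem_support_iff.2 h4)) h0
    simp only [Finsupp.mem_support_iff, Finsupp.add_apply, Finsupp.smul_apply, smul_eq_mul, carrier,
      ne_eq, not_iff_not]
    constructor
    · intro h0
      have : s * K.bary z v = 0 := by nlinarith [mul_nonneg hr h1, mul_nonneg hs.le h2]
      simpa [hs.ne'] using this
    · intro h0; rw [h0, h3 h0]; simp
  have hmem : (r • K.bary p + s • K.bary z).support ∈ K.faces := hsupp ▸ K.carrier_mem hz
  exact ⟨mem_space_of_isBary hb hmem, (carrier_eq hb hmem).trans hsupp⟩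

/-- The barycenter of a finite set of points. -/
noncomputable def _root_.Finset.barycenter (s : Finset E) : E := (s.card : ℝ)⁻¹ • ∑ v ∈ s, v

lemma barycenter_mem {s : Finset E} (hs : s ∈ K.faces) :
    s.barycenter ∈ K.space ∧ K.carrier s.barycenter = s := by
  classical
  have hpos : (0 : ℝ) < s.card := by
    exact_mod_cast (K.nonempty_of_mem_faces hs).card_pos
  let w : E →₀ ℝ := ∑ v ∈ s, Finsupp.single v (s.card : ℝ)⁻¹
  have hwv : ∀ v, w v = if v ∈ s then (s.card : ℝ)⁻¹ else 0 := fun v => by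
    simp [w, Finsupp.finsetSum_apply, Finsupp.single_apply]
  have hw : IsBary w s.barycenter := by
    refine ⟨fun v => ?_, ?_, ?_⟩
    · rw [hwv]; split_ifs <;> positivity
    · simp [w, map_sum, hpos.ne']
    · simp [w, map_sum, Finset.barycenter, Finset.smul_sum]
  have hsupp : w.support = s := by
    ext v
    rw [Finsupp.mem_support_iff, hwv]
    by_cases hv : v ∈ s
    · simpa [hv] using hpos.ne'
    · simp [hv]
  exact ⟨mem_space_of_isBary hw (hsupp ▸ hs), (carrier_eq hw (hsupp ▸ hs)).trans hsupp⟩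

end Geometry.SimplicialComplex

/-! ### Bisection of an edge. -/

namespace Geometry.SimplicialComplex

lemma support_edge {E : Type*} [DecidableEq E] {a b : E} (hab : a ≠ b) {l : ℝ} (h0 : 0 < l) (h1 : l < 1) :
    (Finsupp.single a (1 - l) + Finsupp.single b l).support = {a, b} := by
  ext v
  simp only [Finsupp.mem_support_iff, Finsupp.add_apply, Finsupp.single_apply, Finset.mem_insert,
    Finset.mem_singleton]
  by_cases ha : a = v
  · subst ha
    simp only [if_true, if_neg hab.symm]
    simp; linarith
  · by_cases hb : b = v
    · subst hb; simp [ha]; linarith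
    · simp [ha, hb, Ne.symm ha, Ne.symm hb]

/-- Distributing the weight of `p` onto the end points of the edge containing it. -/
noncomputable def spread {E : Type*} (a b : E) (l : ℝ) (p : E) (w : E →₀ ℝ) : E →₀ ℝ :=
  w + w p • (Finsupp.single a (1 - l) + Finsupp.single b l - Finsupp.single p 1)

lemma spread_apply {E : Type*} [DecidableEq E] (a b : E) (l : ℝ) (p : E) (w : E →₀ ℝ) (v : E) :
    spread a b l p w v = w v + w p * ((if a = v then 1 - l else 0) + (if b = v then l else 0)
      - (if p = v then 1 else 0)) := by
  simp [spread, Finsupp.single_apply, -Finsupp.single_sub]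

variable {E : Type*} [AddCommGroup E] [Module ℝ E] [DecidableEq E]

lemma isBary_edge (a b : E) {l : ℝ} (h0 : 0 ≤ l) (h1 : l ≤ 1) :
    IsBary (Finsupp.single a (1 - l) + Finsupp.single b l) ((1 - l) • a + l • b) where
  nonneg v := by
    simp only [Finsupp.add_apply, Finsupp.single_apply]
    split_ifs <;> linarith
  total := by simp [-Finsupp.single_sub]
  point := by simp [-Finsupp.single_sub]

variable {K : SimplicialComplex ℝ E}

/-- As a vertex, the point would have weights supported on one vertex as well as on two, against
uniqueness. -/
lemma edge_point_notMem {a b : E} (hab : a ≠ b) (he : {a, b} ∈ K.faces) {l : ℝ} (h0 : 0 < l)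
    (h1 : l < 1) {s : Finset E} (hs : s ∈ K.faces) : (1 - l) • a + l • b ∉ s := by
  intro hp
  have hp' : {(1 - l) • a + l • b} ∈ K.faces :=
    K.down_closed hs (Finset.singleton_subset_iff.2 hp) (Finset.singleton_nonempty _)
  have hw : IsBary (Finsupp.single ((1 - l) • a + l • b) 1) ((1 - l) • a + l • b) :=
    ⟨fun v => by rw [Finsupp.single_apply]; split_ifs <;> norm_num, by simp, by simp⟩
  have := K.isBary_unique (isBary_edge a b h0.le h1.le) hw (by rwa [support_edge hab h0 h1])
    (by rwa [Finsupp.support_single _ one_ne_zero])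
  have h2 := congrArg Finsupp.support this
  rw [support_edge hab h0 h1, Finsupp.support_single _ one_ne_zero] at h2
  have := congrArg Finset.card h2
  rw [Finset.card_pair hab, Finset.card_singleton] at this
  omega

/-- The faces of the complex obtained by introducing a new vertex `p` on the edge `{a, b}`. -/
def bisectFaces (K : SimplicialComplex ℝ E) (a b p : E) : Set (Finset E) :=
  {s | s.Nonempty ∧ ¬ {a, b} ⊆ s ∧
    ((p ∉ s ∧ s ∈ K.faces) ∨ (p ∈ s ∧ s.erase p ∪ {a, b} ∈ K.faces))}

lemma bisectFaces_down {a b p : E} {s : Finset E} (hs : s ∈ K.bisectFaces a b p) {t : Finset E}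
    (hts : t ⊆ s) (ht : t.Nonempty) : t ∈ K.bisectFaces a b p := by
  obtain ⟨h1, h2, h3⟩ := hs
  refine ⟨ht, fun h => h2 (h.trans hts), ?_⟩
  by_cases hp : p ∈ t
  · right
    rcases h3 with h3 | h3
    · exact absurd (hts hp) h3.1
    · exact ⟨hp, K.down_closed h3.2
        (Finset.union_subset_union (Finset.erase_subset_erase _ hts) subset_rfl) (by simp)⟩
  · left
    refine ⟨hp, ?_⟩
    rcases h3 with h3 | h3
    · exact K.down_closed h3.2 hts ht
    · refine K.down_closed h3.2 (fun v hv => ?_) ht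
      exact Finset.mem_union_left _ (Finset.mem_erase.2 ⟨fun h => hp (h ▸ hv), hts hv⟩)

lemma isBary_spread {a b : E} {l : ℝ} (h0 : 0 < l) (h1 : l < 1)
    (ha : (1 - l) • a + l • b ≠ a) (hb : (1 - l) • a + l • b ≠ b)
    {w : E →₀ ℝ} {x : E} (hw : IsBary w x) :
    IsBary (spread a b l ((1 - l) • a + l • b) w) x where
  nonneg v := by
    rw [spread_apply]
    have h2 := hw.nonneg v
    have h3 := hw.nonneg ((1 - l) • a + l • b)
    by_cases hv : (1 - l) • a + l • b = v
    · subst hv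
      rw [if_neg ha.symm, if_neg hb.symm, if_pos rfl]
      linarith
    · rw [if_neg hv]
      have : 0 ≤ (if a = v then 1 - l else 0) + (if b = v then l else 0) - 0 := by
        split_ifs <;> linarith
      positivity
  total := by simp [spread, hw.total, -Finsupp.single_sub]
  point := by simp [spread, hw.point, -Finsupp.single_sub]

lemma support_spread_mem {a b : E} {l : ℝ} {p : E}
    {w : E →₀ ℝ} {x : E} (hw : IsBary (spread a b l p w) x)
    (h : w.support ∈ K.bisectFaces a b p) : (spread a b l p w).support ∈ K.faces := by
  obtain ⟨-, -, h | h⟩ := h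
  · have : w p = 0 := Finsupp.notMem_support_iff.1 h.1
    have : spread a b l p w = w := by simp [spread, this]
    rw [this]; exact h.2
  · refine K.down_closed h.2 (fun v hv => ?_) hw.support_nonempty
    by_contra hv'
    simp only [Finset.mem_union, Finset.mem_erase, Finsupp.mem_support_iff, Finset.mem_insert,
      Finset.mem_singleton, not_or, not_and] at hv'
    apply Finsupp.mem_support_iff.1 hv
    rw [spread_apply, if_neg (Ne.symm hv'.2.1), if_neg (Ne.symm hv'.2.2)]
    by_cases hp : p = v
    · rw [if_pos hp, hp]; ring
    · rw [if_neg hp]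
      have := not_not.1 (hv'.1 (Ne.symm hp))
      rw [this]; ring

/-- Introducing a new vertex on an edge. -/
lemma exists_bisect {a b : E} (hab : a ≠ b) (he : {a, b} ∈ K.faces) {l : ℝ} (h0 : 0 < l)
    (h1 : l < 1) : ∃ K' : SimplicialComplex ℝ E,
      K'.faces = K.bisectFaces a b ((1 - l) • a + l • b) ∧ K'.space = K.space := by
  obtain ⟨p, hpdef⟩ : ∃ p, p = (1 - l) • a + l • b := ⟨_, rfl⟩
  have hpa : p ≠ a := fun h => edge_point_notMem hab he h0 h1 he (by rw [← hpdef, h]; simp)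
  have hpb : p ≠ b := fun h => edge_point_notMem hab he h0 h1 he (by rw [← hpdef, h]; simp)
  have hsb : ∀ {w x}, IsBary w x → IsBary (spread a b l p w) x := fun hw => by
    rw [hpdef]; exact isBary_spread h0 h1 (hpdef ▸ hpa) (hpdef ▸ hpb) hw
  -- New faces never contain both `a` and `b`, so one of them has no weight of its own. The weight
  -- of `p` is therefore the smaller of the two normalized weights after spreading, and spreading
  -- can be undone.
  have key : ∀ {w : E →₀ ℝ} {x}, IsBary w x → w.support ∈ K.bisectFaces a b p →
      w p = min (spread a b l p w a / (1 - l)) (spread a b l p w b / l) := by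
    intro w x hw hs
    have hl1 : 0 < 1 - l := by linarith
    have e1 : spread a b l p w a = w a + w p * (1 - l) := by
      rw [spread_apply, if_pos rfl, if_neg hab.symm, if_neg hpa]; ring
    have e2 : spread a b l p w b = w b + w p * l := by
      rw [spread_apply, if_pos rfl, if_neg hab, if_neg hpb]; ring
    have e3 : spread a b l p w a / (1 - l) = w p + w a / (1 - l) := by
      rw [e1]; field_simp; ring
    have e4 : spread a b l p w b / l = w p + w b / l := by
      rw [e2]; field_simp; ring
    rw [e3, e4, min_add_add_left]
    have : w a = 0 ∨ w b = 0 := by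
      by_contra h
      push Not at h
      apply hs.2.1
      intro v hv
      simp only [Finset.mem_insert, Finset.mem_singleton] at hv
      rcases hv with rfl | rfl
      exacts [Finsupp.mem_support_iff.2 h.1, Finsupp.mem_support_iff.2 h.2]
    have hwa : 0 ≤ w a / (1 - l) := div_nonneg (hw.nonneg a) hl1.le
    have hwb : 0 ≤ w b / l := div_nonneg (hw.nonneg b) h0.le
    rcases this with h | h
    · rw [h, zero_div, min_eq_left hwb, add_zero]
    · rw [h, zero_div, min_eq_right hwa, add_zero]
  rw [← hpdef]
  refine ⟨ofUniqueWeights (K.bisectFaces a b p) (fun s hs => hs.1)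
    (fun s hs t hts ht => bisectFaces_down hs hts ht) ?_, rfl, ?_⟩
  · intro w w' x hw hw' hs hs'
    have heq := K.isBary_unique (hsb hw) (hsb hw') (support_spread_mem (hsb hw) hs)
      (support_spread_mem (hsb hw') hs')
    have hp : w p = w' p := by rw [key hw hs, key hw' hs', heq]
    have := heq
    simp only [spread, hp] at this
    exact add_right_cancel this
  · ext x
    constructor
    · intro hx
      obtain ⟨w, hw, hs⟩ := exists_isBary _ hx
      exact mem_space_of_isBary (hsb hw) (support_spread_mem (hsb hw) hs)
    · intro hx
      obtain ⟨v, hv, hs⟩ := K.exists_isBary hx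
      have hl1 : 0 < 1 - l := by linarith
      -- `m` is the largest multiple of the edge weights of `p` that can be taken off `a` and `b`.
      -- Moving it to `p` exhausts one of the two ends.
      obtain ⟨m, hm⟩ : ∃ m, m = min (v a / (1 - l)) (v b / l) := ⟨_, rfl⟩
      have hma : m * (1 - l) ≤ v a := by
        rw [← le_div_iff₀ hl1, hm]; exact min_le_left _ _
      have hmb : m * l ≤ v b := by
        rw [← le_div_iff₀ h0, hm]; exact min_le_right _ _
      have hm0 : 0 ≤ m := by
        rw [hm]; exact le_min (div_nonneg (hv.nonneg a) hl1.le) (div_nonneg (hv.nonneg b) h0.le)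
      have hvp : v p = 0 := by
        by_contra h
        exact edge_point_notMem hab he h0 h1 hs (hpdef ▸ Finsupp.mem_support_iff.2 h)
      let w : E →₀ ℝ :=
        v + m • (Finsupp.single p 1 - (Finsupp.single a (1 - l) + Finsupp.single b l))
      have hwv : ∀ u, w u = v u + m * ((if p = u then 1 else 0) - ((if a = u then 1 - l else 0) +
          (if b = u then l else 0))) := fun u => by simp [w, Finsupp.single_apply, -Finsupp.single_sub]
      have hwp : w p = m := by
        rw [hwv, if_pos rfl, if_neg hpa.symm, if_neg hpb.symm, hvp]; ring
      have hwa : w a = v a - m * (1 - l) := by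
        rw [hwv, if_pos rfl, if_neg hpa, if_neg hab.symm]; ring
      have hwb : w b = v b - m * l := by
        rw [hwv, if_pos rfl, if_neg hpb, if_neg hab]; ring
      have hwo : ∀ u, u ≠ p → u ≠ a → u ≠ b → w u = v u := fun u h1 h2 h3 => by
        rw [hwv, if_neg h1.symm, if_neg h2.symm, if_neg h3.symm]; ring
      have hwb' : IsBary w x := by
        refine ⟨fun u => ?_, ?_, ?_⟩
        · by_cases hup : u = p
          · rw [hup, hwp]; exact hm0
          by_cases hua : u = a
          · rw [hua, hwa]; linarith
          by_cases hub : u = b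
          · rw [hub, hwb]; linarith
          rw [hwo u hup hua hub]; exact hv.nonneg u
        · simp [w, hv.total, -Finsupp.single_sub]
        · simp [w, hv.point, hpdef, -Finsupp.single_sub]
      refine mem_space_of_isBary hwb' ⟨hwb'.support_nonempty, ?_, ?_⟩
      · intro hsub
        have ha : w a ≠ 0 := Finsupp.mem_support_iff.1 (hsub (by simp))
        have hb : w b ≠ 0 := Finsupp.mem_support_iff.1 (hsub (by simp))
        rcases min_choice (v a / (1 - l)) (v b / l) with h | h
        · apply ha; rw [hwa, hm, h]; field_simp; ring
        · apply hb; rw [hwb, hm, h]; field_simp; ring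
      · by_cases hm' : m = 0
        · left
          have : w = v := by ext u; rw [hwv, hm']; ring
          rw [this]
          exact ⟨fun h => Finsupp.mem_support_iff.1 h hvp, hs⟩
        · right
          refine ⟨Finsupp.mem_support_iff.2 (hwp ▸ hm'), ?_⟩
          have hmpos : 0 < m := lt_of_le_of_ne hm0 (Ne.symm hm')
          refine K.down_closed hs (fun u hu => ?_) (by simp)
          rw [Finsupp.mem_support_iff]
          simp only [Finset.mem_union, Finset.mem_erase, Finsupp.mem_support_iff,
            Finset.mem_insert, Finset.mem_singleton] at hu
          by_cases hua : u = a
          · rw [hua]; have := mul_pos hmpos hl1; linarith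
          by_cases hub : u = b
          · rw [hub]; have := mul_pos hmpos h0; linarith
          rcases hu with hu | hu | hu
          · rw [← hwo u hu.1 hua hub]; exact hu.2
          · exact absurd hu hua
          · exact absurd hu hub

end Geometry.SimplicialComplex

/-! ### Purity and nonbranching under bisection. -/

namespace Geometry.SimplicialComplex

variable {E : Type*} [AddCommGroup E] [Module ℝ E]

/-- Every face is contained in a face with `n + 1` vertices. -/
def IsPure (K : SimplicialComplex ℝ E) (n : ℕ) : Prop :=
  ∀ s ∈ K.faces, ∃ t ∈ K.faces, s ⊆ t ∧ t.card = n + 1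

/-- Every face with `n` vertices is in precisely two faces with `n + 1` vertices. -/
def IsNonbranching (K : SimplicialComplex ℝ E) (n : ℕ) : Prop :=
  ∀ s ∈ K.faces, s.card = n → {t | t ∈ K.faces ∧ s ⊆ t ∧ t.card = n + 1}.ncard = 2

lemma IsPure.card_le {K : SimplicialComplex ℝ E} {n : ℕ} (h : K.IsPure n) {s : Finset E}
    (hs : s ∈ K.faces) : s.card ≤ n + 1 := by
  obtain ⟨t, -, hst, ht⟩ := h s hs
  exact ht ▸ Finset.card_le_card hst

section Bisect

variable [DecidableEq E] {K K' : SimplicialComplex ℝ E} {a b p : E} {n : ℕ}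

lemma bisectFaces_comm (a b p : E) : K.bisectFaces a b p = K.bisectFaces b a p := by
  simp only [bisectFaces, Finset.pair_comm]

/-- A top simplex containing the edge is replaced by two halves, in which `p` takes the place of one
end. A new face misses `a` or `b`, so it fits into one of these halves or into an untouched top
simplex. -/
lemma IsPure.bisect (hK' : K'.faces = K.bisectFaces a b p) (hab : a ≠ b)
    (hp : ∀ s ∈ K.faces, p ∉ s) (he : {a, b} ∈ K.faces) (h : K.IsPure n) : K'.IsPure n := by
  have hpa : p ≠ a := fun h => hp _ he (by simp [h])
  have hpb : p ≠ b := fun h => hp _ he (by simp [h])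
  -- it suffices to enlarge faces to faces of the form `t - a + p` or `t - b + p`
  have aux : ∀ t ∈ K.faces, {a, b} ⊆ t → t.card = n + 1 → ∀ c d, ({c, d} : Finset E) = {a, b} →
      c ≠ d → p ≠ c → p ≠ d →
      insert p (t.erase c) ∈ K'.faces ∧ (insert p (t.erase c)).card = n + 1 := by
    intro t ht habt hcard c d hcd hne hpc hpd
    have hct : c ∈ t := habt (hcd ▸ by simp)
    have hdt : d ∈ t := habt (hcd ▸ by simp)
    have hpt := hp t ht
    refine ⟨?_, by rw [Finset.card_insert_of_notMem (by simp [hpt]), Finset.card_erase_of_mem hct];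
                   omega⟩
    rw [hK']
    refine ⟨by simp, ?_, Or.inr ⟨by simp, ?_⟩⟩
    · rw [← hcd]; intro h
      have := h (Finset.mem_insert_self c _)
      simp [hpc.symm] at this
    · convert ht using 1
      rw [← hcd]
      ext v; simp only [Finset.mem_union, Finset.mem_erase, Finset.mem_insert, Finset.mem_singleton]
      grind
  intro s hs
  have hs' := hs
  rw [hK'] at hs'
  obtain ⟨-, h2, h3⟩ := hs'
  have hmiss : a ∉ s ∨ b ∉ s := by
    by_contra hc; push Not at hc
    exact h2 (by intro v; simp only [Finset.mem_insert, Finset.mem_singleton]; rintro (rfl | rfl)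
                 exacts [hc.1, hc.2])
  have fin : ∀ t ∈ K.faces, {a, b} ⊆ t → t.card = n + 1 → s.erase p ⊆ t →
      ∃ t ∈ K'.faces, s ⊆ t ∧ t.card = n + 1 := by
    intro t ht habt hcard hst
    rcases hmiss with hm | hm
    · obtain ⟨h5, h6⟩ := aux t ht habt hcard a b rfl hab hpa hpb
      refine ⟨_, h5, fun v hv => ?_, h6⟩
      have := @hst v
      simp only [Finset.mem_insert, Finset.mem_erase] at this ⊢
      grind
    · obtain ⟨h5, h6⟩ := aux t ht habt hcard b a (Finset.pair_comm _ _) hab.symm hpb hpa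
      refine ⟨_, h5, fun v hv => ?_, h6⟩
      have := @hst v
      simp only [Finset.mem_insert, Finset.mem_erase] at this ⊢
      grind
  rcases h3 with ⟨h3, h4⟩ | ⟨h3, h4⟩
  · obtain ⟨t, ht, hst, hcard⟩ := h s h4
    by_cases habt : {a, b} ⊆ t
    · exact fin t ht habt hcard ((Finset.erase_subset _ _).trans hst)
    · exact ⟨t, hK' ▸ ⟨K.nonempty_of_mem_faces ht, habt, Or.inl ⟨hp t ht, ht⟩⟩, hst, hcard⟩
  · obtain ⟨t, ht, hst, hcard⟩ := h _ h4
    exact fin t ht (Finset.subset_union_right.trans hst) hcard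
      (Finset.subset_union_left.trans hst)

/-- The case of a face containing the new vertex and one end point of the edge. -/
lemma IsNonbranching.bisect_aux (hK' : K'.faces = K.bisectFaces a b p) (hab : a ≠ b)
    (hp : ∀ s ∈ K.faces, p ∉ s) (hpb : p ≠ b) (h : K.IsNonbranching n)
    {s : Finset E} (hps : p ∈ s) (hface : s.erase p ∪ {a, b} ∈ K.faces)
    (ha : a ∈ s) (hb : b ∉ s) (hpa : p ≠ a) (hcard : s.card = n) :
    {t | t ∈ K'.faces ∧ s ⊆ t ∧ t.card = n + 1}.ncard = 2 := by
  have hs1 : s.erase p ∪ {a, b} = insert b (s.erase p) := by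
    ext v; simp only [Finset.mem_union, Finset.mem_erase, Finset.mem_insert, Finset.mem_singleton]
    grind
  have hc1 : (s.erase p ∪ {a, b}).card = n := by
    rw [hs1, Finset.card_insert_of_notMem (by simp [hb]), Finset.card_erase_of_mem hps]
    have := Finset.card_pos.2 ⟨p, hps⟩
    omega
  rw [← h _ hface hc1]
  symm
  -- Exchanging `b` for `p` is a bijection between the top simplices of `K` over `s - p + b` and
  -- those of `K'` over `s`.
  refine Set.ncard_congr (fun t _ => insert p (t.erase b)) ?_ ?_ ?_
  · rintro t ⟨ht, hst, htc⟩
    have hbt : b ∈ t := hst (by simp)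
    have hpt := hp t ht
    refine ⟨?_, ?_, ?_⟩
    · rw [hK']
      refine ⟨by simp, ?_, Or.inr ⟨by simp, ?_⟩⟩
      · intro h
        have := h (show b ∈ ({a, b} : Finset E) by simp)
        simp [hpb.symm] at this
      · convert ht using 1
        have := @hst a
        ext v; simp only [Finset.mem_union, Finset.mem_erase, Finset.mem_insert,
          Finset.mem_singleton] at this ⊢
        grind
    · intro v hv
      have := @hst v
      simp only [Finset.mem_union, Finset.mem_erase, Finset.mem_insert,
          Finset.mem_singleton] at this ⊢
      grind
    · rw [Finset.card_insert_of_notMem (by simp [hpt]), Finset.card_erase_of_mem hbt]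
      omega
  · rintro t t' ⟨ht, hst, -⟩ ⟨ht', hst', -⟩ heq
    have hbt : b ∈ t := hst (by simp)
    have hbt' : b ∈ t' := hst' (by simp)
    have hpt := hp t ht
    have hpt' := hp t' ht'
    ext v
    have := Finset.ext_iff.1 heq v
    simp only [Finset.mem_erase, Finset.mem_insert] at this
    grind
  · rintro t' ⟨ht', hst', htc⟩
    rw [hK'] at ht'
    obtain ⟨-, h2, h3⟩ := ht'
    have hpt' := hst' hps
    have hat' := hst' ha
    have hbt' : b ∉ t' := fun hb => h2 (by
      intro v; simp only [Finset.mem_insert, Finset.mem_singleton]; rintro (rfl | rfl)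
      exacts [hat', hb])
    have hface' : t'.erase p ∪ {a, b} ∈ K.faces := by
      rcases h3 with h3 | h3
      · exact absurd hpt' h3.1
      · exact h3.2
    have e : t'.erase p ∪ {a, b} = insert b (t'.erase p) := by
      ext v; simp only [Finset.mem_union, Finset.mem_erase, Finset.mem_insert,
        Finset.mem_singleton]
      grind
    refine ⟨t'.erase p ∪ {a, b}, ⟨hface', ?_, ?_⟩, ?_⟩
    · exact Finset.union_subset_union (Finset.erase_subset_erase _ hst') subset_rfl
    · rw [e, Finset.card_insert_of_notMem (by simp [hbt']), Finset.card_erase_of_mem hpt']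
      omega
    · rw [e]; ext v; simp only [Finset.mem_erase, Finset.mem_insert]
      grind

/-- If `p` is not in `s`, top simplices over `s` persist, except that one containing the edge is
replaced by `s + p`. If `s` contains `p` and an end of the edge, `bisect_aux` applies. If `s`
contains `p` and neither end, then `s` cuts a top simplex into its two halves `s + a` and `s + b`.
-/
lemma IsNonbranching.bisect (hK' : K'.faces = K.bisectFaces a b p) (hab : a ≠ b)
    (hp : ∀ s ∈ K.faces, p ∉ s) (he : {a, b} ∈ K.faces) (hpure : K.IsPure n)
    (h : K.IsNonbranching n) : K'.IsNonbranching n := by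
  have hpa : p ≠ a := fun h => hp _ he (by simp [h])
  have hpb : p ≠ b := fun h => hp _ he (by simp [h])
  intro s hs hcard
  have hs' := hs
  rw [hK'] at hs'
  obtain ⟨hne, h2, ⟨hps, hsK⟩ | ⟨hps, hface⟩⟩ := hs'
  · rw [← h s hsK hcard]
    symm
    -- Only one top simplex over `s` can contain the edge, because `s` lacks just one vertex of it.
    have hunion : ∀ t : Finset E, s ⊆ t → t.card = n + 1 → {a, b} ⊆ t → t = s ∪ {a, b} := by
      intro t hst htc habt
      symm
      refine Finset.eq_of_subset_of_card_le (Finset.union_subset hst habt) ?_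
      have : s.card < (s ∪ {a, b}).card := Finset.card_lt_card
        ⟨Finset.subset_union_left, fun hc => h2 (Finset.subset_union_right.trans hc)⟩
      omega
    refine Set.ncard_congr (fun t _ => if {a, b} ⊆ t then insert p s else t) ?_ ?_ ?_
    · rintro t ⟨ht, hst, htc⟩
      by_cases habt : {a, b} ⊆ t
      · simp only [if_pos habt]
        refine ⟨?_, Finset.subset_insert _ _, by rw [Finset.card_insert_of_notMem hps, hcard]⟩
        rw [hK']
        refine ⟨by simp, fun hc => h2 ?_, Or.inr ⟨by simp, ?_⟩⟩
        · intro v hv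
          have := hc hv
          simp only [Finset.mem_insert, Finset.mem_singleton] at hv this
          rcases this with rfl | this
          · rcases hv with hv | hv
            exacts [absurd hv hpa, absurd hv hpb]
          · exact this
        · rw [Finset.erase_insert hps]
          exact K.down_closed ht (Finset.union_subset hst habt) (by simp)
      · simp only [if_neg habt]
        exact ⟨hK' ▸ ⟨K.nonempty_of_mem_faces ht, habt, Or.inl ⟨hp t ht, ht⟩⟩, hst, htc⟩
    · rintro t t' ⟨ht, hst, htc⟩ ⟨ht', hst', htc'⟩ heq
      by_cases habt : {a, b} ⊆ t <;> by_cases habt' : {a, b} ⊆ t'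
      · rw [hunion t hst htc habt, hunion t' hst' htc' habt']
      · rw [if_pos habt, if_neg habt'] at heq
        exact absurd (heq ▸ Finset.mem_insert_self p s) (hp t' ht')
      · rw [if_neg habt, if_pos habt'] at heq
        exact absurd (heq ▸ Finset.mem_insert_self p s) (hp t ht)
      · rwa [if_neg habt, if_neg habt'] at heq
    · rintro t' ⟨ht', hst', htc⟩
      rw [hK'] at ht'
      obtain ⟨-, h4, ⟨hpt, htK⟩ | ⟨hpt, hface⟩⟩ := ht'
      · exact ⟨t', ⟨htK, hst', htc⟩, if_neg h4⟩
      · have e : t' = insert p s := by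
          symm
          refine Finset.eq_of_subset_of_card_le (Finset.insert_subset hpt hst') ?_
          rw [Finset.card_insert_of_notMem hps]; omega
        rw [e, Finset.erase_insert hps] at hface
        refine ⟨s ∪ {a, b}, ⟨hface, Finset.subset_union_left, ?_⟩, ?_⟩
        · have h5 := hpure.card_le hface
          have : s.card < (s ∪ {a, b}).card := Finset.card_lt_card
            ⟨Finset.subset_union_left, fun hc => h2 (Finset.subset_union_right.trans hc)⟩
          omega
        · rw [if_pos Finset.subset_union_right, e]
  · by_cases ha : a ∈ s
    · have hb : b ∉ s := fun hb => h2 (by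
        intro v; simp only [Finset.mem_insert, Finset.mem_singleton]; rintro (rfl | rfl)
        exacts [ha, hb])
      exact h.bisect_aux hK' hab hp hpb hps hface ha hb hpa hcard
    by_cases hb : b ∈ s
    · rw [bisectFaces_comm] at hK'
      rw [Finset.pair_comm] at hface
      exact h.bisect_aux hK' hab.symm hp hpa hps hface hb ha hpb hcard
    have : {t | t ∈ K'.faces ∧ s ⊆ t ∧ t.card = n + 1} = {insert a s, insert b s} := by
      have hmem : ∀ c d, ({c, d} : Finset E) = {a, b} → c ≠ d → c ∉ s → d ∉ s → p ≠ c →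
          insert c s ∈ K'.faces := by
        intro c d hcd hne hc hd hpc
        rw [hK']
        refine ⟨by simp, fun hsub => ?_, Or.inr ⟨by simp [hps], ?_⟩⟩
        · rw [← hcd] at hsub
          have := hsub (show d ∈ ({c, d} : Finset E) by simp)
          simp [hd, hne.symm] at this
        · convert hface using 1
          rw [← hcd]
          ext v; simp only [Finset.mem_union, Finset.mem_erase, Finset.mem_insert,
            Finset.mem_singleton]
          grind
      ext t
      simp only [Set.mem_ofPred_eq, Set.mem_insert_iff, Set.mem_singleton_iff]
      constructor
      · rintro ⟨ht, hst, htc⟩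
        obtain ⟨x, hxs, rfl⟩ : ∃ x ∉ s, insert x s = t := by
          obtain ⟨x, hx, hx'⟩ := Finset.exists_mem_notMem_of_card_lt_card (by omega : s.card < t.card)
          refine ⟨x, hx', Finset.eq_of_subset_of_card_le (Finset.insert_subset hx hst) ?_⟩
          rw [Finset.card_insert_of_notMem hx']; omega
        rw [hK'] at ht
        obtain ⟨-, -, ht | ⟨-, ht⟩⟩ := ht
        · exact absurd (Finset.mem_insert_of_mem hps) ht.1
        · by_contra hc
          push Not at hc
          have hxa : x ≠ a := fun h => hc.1 (by rw [h])
          have hxb : x ≠ b := fun h => hc.2 (by rw [h])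
          have hxp : x ≠ p := fun h => hxs (h ▸ hps)
          -- Any other vertex `x` would produce a face of `K` with `n + 2` vertices.
          have e : (insert x s).erase p ∪ {a, b} = insert x (insert a (insert b (s.erase p))) := by
            ext v; simp only [Finset.mem_union, Finset.mem_erase, Finset.mem_insert,
              Finset.mem_singleton]
            grind
          have h5 := hpure.card_le ht
          rw [e, Finset.card_insert_of_notMem (by simp [hxa, hxb, hxs]),
            Finset.card_insert_of_notMem (by simp [hab, ha]),
            Finset.card_insert_of_notMem (by simp [hb]), Finset.card_erase_of_mem hps] at h5
          have := Finset.card_pos.2 hne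
          omega
      · rintro (rfl | rfl)
        · exact ⟨hmem a b rfl hab ha hb hpa, Finset.subset_insert _ _,
            by rw [Finset.card_insert_of_notMem ha, hcard]⟩
        · exact ⟨hmem b a (Finset.pair_comm _ _) hab.symm hb ha hpb, Finset.subset_insert _ _,
            by rw [Finset.card_insert_of_notMem hb, hcard]⟩
    rw [this, Set.ncard_pair]
    intro heq
    have : a ∈ insert b s := heq ▸ Finset.mem_insert_self a s
    simp [hab, ha] at this

end Bisect

/-! ### Subdivision along hyperplanes. -/

/-- `K'` is a subdivision of `K` (as complexes, with the pseudomanifold conditions inherited). -/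
structure Subdivides (K' K : SimplicialComplex ℝ E) : Prop where
  finite : K.faces.Finite → K'.faces.Finite
  space_eq : K'.space = K.space
  refines : ∀ s' ∈ K'.faces, ∃ s ∈ K.faces, (s' : Set E) ⊆ convexHull ℝ (s : Set E)
  isPure : ∀ n, K.IsPure n → K'.IsPure n
  isNonbranching : ∀ n, K.IsPure n → K.IsNonbranching n → K'.IsNonbranching n

lemma Subdivides.refl (K : SimplicialComplex ℝ E) : K.Subdivides K :=
  ⟨id, rfl, fun s hs => ⟨s, hs, subset_convexHull _ _⟩, fun _ => id, fun _ _ => id⟩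

lemma Subdivides.trans {K₁ K₂ K₃ : SimplicialComplex ℝ E} (h : K₁.Subdivides K₂)
    (h' : K₂.Subdivides K₃) : K₁.Subdivides K₃ where
  finite hf := h.finite (h'.finite hf)
  space_eq := h.space_eq.trans h'.space_eq
  refines s hs := by
    obtain ⟨t, ht, hst⟩ := h.refines s hs
    obtain ⟨u, hu, htu⟩ := h'.refines t ht
    exact ⟨u, hu, hst.trans (convexHull_min htu (convex_convexHull _ _))⟩
  isPure n hn := h.isPure n (h'.isPure n hn)
  isNonbranching n hn hb := h.isNonbranching n (h'.isPure n hn) (h'.isNonbranching n hn hb)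

/-- A function has constant sign on the vertices of each face. -/
def SignCompatible (K : SimplicialComplex ℝ E) (h : E →ᵃ[ℝ] ℝ) : Prop :=
  ∀ s ∈ K.faces, (∀ v ∈ s, 0 ≤ h v) ∨ (∀ v ∈ s, h v ≤ 0)

lemma Subdivides.signCompatible {K' K : SimplicialComplex ℝ E} (hs : K'.Subdivides K)
    {h : E →ᵃ[ℝ] ℝ} (hh : K.SignCompatible h) : K'.SignCompatible h := by
  intro s' hs'
  obtain ⟨s, hsK, hss⟩ := hs.refines s' hs'
  rcases hh s hsK with h1 | h1
  · left
    have : convexHull ℝ (s : Set E) ⊆ h ⁻¹' Ici 0 :=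
      convexHull_min (fun v hv => h1 v hv) ((convex_Ici 0).affine_preimage h)
    exact fun v hv => this (hss hv)
  · right
    have : convexHull ℝ (s : Set E) ⊆ h ⁻¹' Iic 0 :=
      convexHull_min (fun v hv => h1 v hv) ((convex_Iic 0).affine_preimage h)
    exact fun v hv => this (hss hv)

lemma exists_subdivides_bisect [DecidableEq E] (K : SimplicialComplex ℝ E) {a b : E} (hab : a ≠ b)
    (he : {a, b} ∈ K.faces) {l : ℝ} (h0 : 0 < l) (h1 : l < 1) :
    ∃ K' : SimplicialComplex ℝ E, K'.Subdivides K ∧ {a, b} ∉ K'.faces ∧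
      ∀ s ∈ K'.faces, (1 - l) • a + l • b ∉ s → s ∈ K.faces := by
  obtain ⟨K', hK', hsp⟩ := exists_bisect hab he h0 h1
  have hp : ∀ s ∈ K.faces, (1 - l) • a + l • b ∉ s := fun s hs => edge_point_notMem hab he h0 h1 hs
  refine ⟨K', ⟨fun hf => ?_, hsp, fun s hs => ?_, fun n hn => hn.bisect hK' hab hp he,
    fun n hn hb => hb.bisect hK' hab hp he hn⟩, ?_, ?_⟩
  · have : K'.faces ⊆ ⋃ t ∈ K.faces, ((insert ((1 - l) • a + l • b) t).powerset : Set (Finset E)) := by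
      intro s hs
      rw [hK'] at hs
      simp only [Set.mem_iUnion, Finset.coe_powerset, exists_prop]
      rcases hs.2.2 with h | h
      · exact ⟨s, h.2, fun v hv => by simp [hv]⟩
      · refine ⟨_, h.2, fun v hv => ?_⟩
        simp only [Finset.coe_insert, Finset.coe_union, Finset.coe_erase]
        by_cases hv' : v = (1 - l) • a + l • b
        · left; exact hv'
        · right; left; exact ⟨hv, hv'⟩
    exact (hf.biUnion fun t _ => Finset.finite_toSet _).subset this
  · rw [hK'] at hs
    rcases hs.2.2 with h | h
    · exact ⟨s, h.2, subset_convexHull _ _⟩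
    · refine ⟨_, h.2, fun v hv => ?_⟩
      by_cases hv' : v = (1 - l) • a + l • b
      · rw [hv']
        refine convex_convexHull ℝ _ (subset_convexHull _ _ (by simp))
          (subset_convexHull _ _ (by simp)) (by linarith) h0.le (by ring)
      · exact subset_convexHull _ _ (by
          simp only [Finset.coe_union, Finset.coe_erase]; left; exact ⟨hv, hv'⟩)
  · rw [hK']; exact fun h => h.2.1 subset_rfl
  · intro s hs hps
    rw [hK'] at hs
    rcases hs.2.2 with h | h
    exacts [h.2, absurd h.1 hps]

/-- The edges on which `h` changes its sign. -/
def crossing [DecidableEq E] (K : SimplicialComplex ℝ E) (h : E →ᵃ[ℝ] ℝ) : Set (E × E) :=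
  {e | {e.1, e.2} ∈ K.faces ∧ h e.1 < 0 ∧ 0 < h e.2}

lemma crossing_finite [DecidableEq E] {K : SimplicialComplex ℝ E} (hK : K.faces.Finite)
    (h : E →ᵃ[ℝ] ℝ) : (K.crossing h).Finite := by
  have : (⋃ s ∈ K.faces, (s : Set E)).Finite := hK.biUnion fun s _ => s.finite_toSet
  refine (this.prod this).subset ?_
  rintro ⟨a, b⟩ ⟨h1, -⟩
  exact ⟨Set.mem_biUnion h1 (by simp), Set.mem_biUnion h1 (by simp)⟩

/-- Subdividing along a hyperplane. -/
lemma exists_subdivides_signCompatible_single (K : SimplicialComplex ℝ E) (hK : K.faces.Finite)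
    (h : E →ᵃ[ℝ] ℝ) : ∃ K' : SimplicialComplex ℝ E, K'.Subdivides K ∧ K'.SignCompatible h := by
  classical
  induction hN : (K.crossing h).ncard using Nat.strong_induction_on generalizing K with
  | _ N ih =>
  by_cases hc : K.crossing h = ∅
  · refine ⟨K, Subdivides.refl K, fun s hs => ?_⟩
    by_contra hcon
    push Not at hcon
    obtain ⟨⟨a, ha, ha'⟩, b, hb, hb'⟩ := hcon
    have : (a, b) ∈ K.crossing h :=
      ⟨K.down_closed hs (by
        intro v; simp only [Finset.mem_insert, Finset.mem_singleton]; rintro (rfl | rfl)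
        exacts [ha, hb]) (by simp), ha', hb'⟩
    rw [hc] at this
    exact this
  · obtain ⟨⟨a, b⟩, he, ha, hb⟩ := Set.nonempty_iff_ne_empty.2 hc
    simp only at he ha hb
    have hab : a ≠ b := by rintro rfl; linarith
    have hd : 0 < h b - h a := by linarith
    -- `h` vanishes at the new vertex, so no new edge is crossed while `{a, b}` disappears; the
    -- number of crossed edges drops.
    obtain ⟨l, hl⟩ : ∃ l, l = -h a / (h b - h a) := ⟨_, rfl⟩
    have hl0 : 0 < l := by rw [hl]; exact div_pos (by linarith) hd
    have hl1 : l < 1 := by rw [hl, div_lt_one hd]; linarith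
    have hp : h ((1 - l) • a + l • b) = 0 := by
      have : (1 - l) • a + l • b = AffineMap.lineMap a b l := by
        rw [AffineMap.lineMap_apply_module]
      rw [this, AffineMap.apply_lineMap, AffineMap.lineMap_apply_module, hl]
      simp only [smul_eq_mul]
      field_simp
      ring
    obtain ⟨K', hsub, habK', hold⟩ := K.exists_subdivides_bisect hab he hl0 hl1
    have hlt : (K'.crossing h).ncard < N := by
      rw [← hN]
      refine Set.ncard_lt_ncard ⟨?_, fun hcon => ?_⟩ (crossing_finite hK h)
      · rintro ⟨c, d⟩ ⟨h1, h2, h3⟩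
        refine ⟨hold _ h1 ?_, h2, h3⟩
        simp only [Finset.mem_insert, Finset.mem_singleton, not_or]
        constructor
        · intro heq; simp only at h2; rw [← heq, hp] at h2; exact lt_irrefl _ h2
        · intro heq; simp only at h3; rw [← heq, hp] at h3; exact lt_irrefl _ h3
      · exact habK' (hcon (show (a, b) ∈ K.crossing h from ⟨he, ha, hb⟩)).1
    obtain ⟨K'', hs'', hc''⟩ := ih _ hlt K' (hsub.finite hK) rfl
    exact ⟨K'', hs''.trans hsub, hc''⟩

/-- Subdividing along finitely many hyperplanes. -/
lemma exists_subdivides_signCompatible (K : SimplicialComplex ℝ E) (hK : K.faces.Finite)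
    {H : Set (E →ᵃ[ℝ] ℝ)} (hH : H.Finite) :
    ∃ K' : SimplicialComplex ℝ E, K'.Subdivides K ∧ ∀ h ∈ H, K'.SignCompatible h := by
  induction H, hH using Set.Finite.induction_on with
  | empty => exact ⟨K, Subdivides.refl K, by simp⟩
  | insert _ _ ih =>
    obtain ⟨K₁, h₁, h₁'⟩ := ih
    obtain ⟨K₂, h₂, h₂'⟩ := K₁.exists_subdivides_signCompatible_single (h₁.finite hK) _
    refine ⟨K₂, h₂.trans h₁, fun h hh => ?_⟩
    rcases hh with rfl | hh
    exacts [h₂', h₂.signCompatible (h₁' h hh)]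

end Geometry.SimplicialComplex

/-! ### Simplices as solution sets of affine inequalities; compatible triangulations. -/

section Affine

variable {E F : Type*} [AddCommGroup E] [Module ℝ E] [AddCommGroup F] [Module ℝ F]

lemma IsBary.map_affine {w : E →₀ ℝ} {x : E} (hw : IsBary w x) (A : E →ᵃ[ℝ] F) {s : Finset E}
    (hs : w.support ⊆ s) : A x = ∑ v ∈ s, w v • A v := by
  have h : ∀ v, A v = A.linear v + A 0 := fun v => by
    have := congrFun (AffineMap.decomp A) v
    exact this
  have h2 : ∑ v ∈ s, w v • A v = ∑ v ∈ s, (w v • A.linear v + w v • A 0) :=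
    Finset.sum_congr rfl fun v _ => by rw [h v, smul_add]
  rw [h2, h x, ← hw.point, weightedPoint_eq_sum hs, map_sum, Finset.sum_add_distrib,
    ← Finset.sum_smul, ← totalWeight_eq_sum hs, hw.total, one_smul]
  simp_rw [map_smul]

/-- Barycentric coordinates of a simplex extend to affine functions on the ambient space, and
finitely many affine inequalities cut out the simplex. -/
lemma exists_affine_coord [FiniteDimensional ℝ E] {s : Finset E}
    (hs : AffineIndependent ℝ ((↑) : s → E)) :
    ∃ (c : E → (E →ᵃ[ℝ] ℝ)) (H : Set (E →ᵃ[ℝ] ℝ)),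
      (∀ w x, IsBary w x → w.support ⊆ s → ∀ v, c v x = w v) ∧ H.Finite ∧
      convexHull ℝ (s : Set E) = {x | ∀ h ∈ H, 0 ≤ h x} := by
  classical
  obtain ⟨t', hst', hind, hspan⟩ := exists_subset_affineIndependent_affineSpan_eq_top
    (k := ℝ) (s := (s : Set E)) hs
  have hfin : t'.Finite := finite_set_of_fin_dim_affineIndependent ℝ hind
  obtain ⟨t, rfl⟩ := hfin.exists_finset_coe
  let b : AffineBasis t ℝ E := ⟨fun p => p, hind, by
    rw [← hspan]; congr 1; exact Subtype.range_coe⟩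
  have hst : s ⊆ t := Finset.coe_subset.1 hst'
  -- Weights supported on `s` vanish outside the basis `t`, so zero is the correct default there.
  let c : E → (E →ᵃ[ℝ] ℝ) := fun v => if hv : v ∈ t then b.coord ⟨v, hv⟩ else 0
  have hc : ∀ w x, IsBary w x → w.support ⊆ s → ∀ v, c v x = w v := by
    intro w x hw hws v
    by_cases hv : v ∈ t
    · simp only [c, dif_pos hv]
      rw [hw.map_affine (b.coord ⟨v, hv⟩) (hws.trans hst), Finset.sum_eq_single_of_mem v hv]
      · have : b.coord ⟨v, hv⟩ v = 1 := b.coord_apply_eq ⟨v, hv⟩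
        rw [this]; simp
      · intro u hu huv
        have : b.coord ⟨v, hv⟩ u = 0 :=
          b.coord_apply_ne (i := ⟨v, hv⟩) (j := ⟨u, hu⟩) (fun h => huv (congrArg Subtype.val h).symm)
        rw [this]; simp
    · simp only [c, dif_neg hv]
      exact (Finsupp.notMem_support_iff.1 fun h => hv (hst (hws h))).symm
  -- Inside an affine basis `t` containing `s`, the simplex is given by nonnegativity of all
  -- coordinates and nonpositivity of those outside `s`.
  refine ⟨c, (c '' t) ∪ ((fun v => - c v) '' (t \ s : Finset E)), hc,
    (t.finite_toSet.image _).union ((Finset.finite_toSet _).image _), ?_⟩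
  ext x
  constructor
  · intro hx
    obtain ⟨w, hw, hws⟩ := exists_isBary_of_mem_convexHull hx
    rintro h (⟨v, -, rfl⟩ | ⟨v, hv, rfl⟩)
    · rw [hc w x hw hws]; exact hw.nonneg v
    · have : w v = 0 := Finsupp.notMem_support_iff.1 fun h => (Finset.mem_sdiff.1 hv).2 (hws h)
      simp [hc w x hw hws, this]
  · intro hx
    have h0 : ∀ v ∈ t, 0 ≤ c v x := fun v hv => hx _ (Or.inl ⟨v, hv, rfl⟩)
    have h1 : ∀ v ∈ t, v ∉ s → c v x = 0 := fun v hv hvs => by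
      have := hx _ (Or.inr ⟨v, Finset.mem_coe.2 (Finset.mem_sdiff.2 ⟨hv, hvs⟩), rfl⟩)
      simp at this
      exact le_antisymm this (h0 v hv)
    have hcv : ∀ v (hv : v ∈ t), c v x = b.coord ⟨v, hv⟩ x := fun v hv => by
      simp only [c, dif_pos hv]
    rw [Finset.mem_convexHull']
    refine ⟨fun v => c v x, fun v hv => h0 v (hst hv), ?_, ?_⟩
    · rw [Finset.sum_subset hst fun v hv hvs => h1 v hv hvs, ← b.sum_coord_apply_eq_one x,
        ← Finset.sum_coe_sort]
      exact Finset.sum_congr rfl fun v _ => hcv v v.2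
    · rw [Finset.sum_subset hst fun v hv hvs => by
          simp only [h1 v hv hvs, zero_smul],
        ← Finset.sum_coe_sort t (fun v => c v x • v)]
      conv_rhs => rw [← b.linear_combination_coord_eq_self x]
      exact Finset.sum_congr rfl fun v _ => by rw [hcv v v.2]; rfl

end Affine

namespace Geometry.SimplicialComplex

section Compat

variable {E F : Type*} [AddCommGroup E] [Module ℝ E] [AddCommGroup F] [Module ℝ F]

/-- If `h` is nonpositive on all vertices of the carrier, a nonnegative weighted average with
positive weights forces `h` to vanish on each of them. -/
lemma SignCompatible.nonneg_of_mem_carrier {K : SimplicialComplex ℝ E} {h : E →ᵃ[ℝ] ℝ}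
    (hK : K.SignCompatible h) {x : E} (hx : x ∈ K.space) (h0 : 0 ≤ h x) :
    ∀ v ∈ K.carrier x, 0 ≤ h v := by
  rcases hK _ (K.carrier_mem hx) with hs | hs
  · exact hs
  · intro v hv
    have hw := K.isBary_bary hx
    rw [hw.map_affine h (s := K.carrier x) subset_rfl] at h0
    have hle : ∀ u ∈ K.carrier x, K.bary x u • h u ≤ 0 := fun u hu => by
      rw [smul_eq_mul]
      exact mul_nonpos_of_nonneg_of_nonpos (hw.nonneg u) (hs u hu)
    have := (Finset.sum_eq_zero_iff_of_nonpos hle).1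
      (le_antisymm (Finset.sum_nonpos hle) h0) v hv
    rw [smul_eq_mul] at this
    rcases mul_eq_zero.1 this with h | h
    · exact absurd h (Finsupp.mem_support_iff.1 hv)
    · exact h.ge

/-- A finite complex has a subdivision for which the preimages of finitely many given simplices
are unions of simplices. -/
lemma exists_subdivides_compatible [FiniteDimensional ℝ F] (K : SimplicialComplex ℝ E)
    (hK : K.faces.Finite) (A : E →ᵃ[ℝ] F) {S : Set (Finset F)} (hS : S.Finite)
    (hind : ∀ l ∈ S, AffineIndependent ℝ ((↑) : l → F)) :
    ∃ T : SimplicialComplex ℝ E, T.Subdivides K ∧ ∀ l ∈ S, ∀ x ∈ T.space,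
      A x ∈ convexHull ℝ (l : Set F) → ∀ v ∈ T.carrier x, A v ∈ convexHull ℝ (l : Set F) := by
  choose! c H hc hH hHl using fun l hl => exists_affine_coord (hind l hl)
  obtain ⟨T, hT, hT'⟩ := K.exists_subdivides_signCompatible hK
    (hS.biUnion fun l hl => (hH l hl).image fun h => h.comp A)
  refine ⟨T, hT, fun l hl x hx hAx v hv => ?_⟩
  rw [hHl l hl] at hAx ⊢
  intro h hh
  exact (hT' (h.comp A) (Set.mem_biUnion hl ⟨h, hh, rfl⟩)).nonneg_of_mem_carrier hx (hAx h hh) v hv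

end Compat

variable {E : Type*} [NormedAddCommGroup E] [NormedSpace ℝ E] [FiniteDimensional ℝ E]

/-- A subpolyhedron of positive codimension has dense complement. -/
lemma exists_mem_notMem_space_of_isPure {K L : SimplicialComplex ℝ E} {n : ℕ}
    (hK : K.faces.Finite) (hpure : K.IsPure n) (hL : L.faces.Finite)
    (hdim : ∀ s ∈ L.faces, s.card ≤ n) {O : Set E} (hO : IsOpen O) {x : E} (hx : x ∈ K.space)
    (hxO : x ∈ O) : ∃ y ∈ O, y ∈ K.space ∧ y ∉ L.space := by
  obtain ⟨T, hT, hcomp⟩ := K.exists_subdivides_compatible hK (AffineMap.id ℝ E) hL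
    (fun l hl => L.indep hl)
  rw [← hT.space_eq] at hx ⊢
  obtain ⟨t, ht, hxt, htc⟩ := hT.isPure n hpure _ (T.carrier_mem hx)
  obtain ⟨hb, hbc⟩ := barycenter_mem ht
  have hcont : Filter.Tendsto (fun s : ℝ => (1 - s) • x + s • t.barycenter)
      (nhdsWithin 0 (Ioi 0)) (nhds x) := by
    have : Continuous (fun s : ℝ => (1 - s) • x + s • t.barycenter) := by fun_prop
    have h := this.tendsto 0
    simp only [sub_zero, one_smul, zero_smul, add_zero] at h
    exact h.mono_left nhdsWithin_le_nhds
  have h1 : ∀ᶠ s : ℝ in nhdsWithin 0 (Ioi 0), (1 - s) • x + s • t.barycenter ∈ O :=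
    hcont (hO.mem_nhds hxO)
  have h2 : ∀ᶠ s : ℝ in nhdsWithin 0 (Ioi 0), s ∈ Ioo (0 : ℝ) 1 :=
    Ioo_mem_nhdsGT one_pos
  obtain ⟨s, hsO, hs0, hs1⟩ := (h1.and h2).exists
  obtain ⟨hy, hyc⟩ := carrier_combo hx hb (hbc.symm ▸ hxt) (by linarith : 0 ≤ 1 - s) hs0 (by ring)
  refine ⟨_, hsO, hy, fun hyL => ?_⟩
  obtain ⟨l, hl, hyl⟩ := mem_space_iff.1 hyL
  -- The perturbed point lies in an open top simplex. Were it in `l`, compatibility would put `n +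
  -- 1` independent vertices into a simplex with at most `n`.
  have hsub := hcomp l hl _ hy hyl
  rw [hyc, hbc] at hsub
  have := (T.indep ht).card_le_card_of_subset_affineSpan (t := l)
    (fun v hv => convexHull_subset_affineSpan _ (hsub v hv))
  have := hdim l hl
  omega

/-- A triangulation compatible with a subpolyhedron. -/
lemma exists_subdivides_subcomplex {K L : SimplicialComplex ℝ E}
    (hK : K.faces.Finite) (hL : L.faces.Finite) :
    ∃ T : SimplicialComplex ℝ E, T.Subdivides K ∧ ∃ D : Set (Finset E),
      (∀ x ∈ T.space, x ∈ L.space ↔ T.carrier x ∈ D) ∧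
      (∀ s ∈ T.faces, ∀ t ∈ D, s ⊆ t → s ∈ D) ∧
      (∀ c, (∀ s ∈ L.faces, s.card ≤ c) → ∀ s ∈ T.faces, s ∈ D → s.card ≤ c) := by
  obtain ⟨T, hT, hcomp⟩ := K.exists_subdivides_compatible hK (AffineMap.id ℝ E) hL
    (fun l hl => L.indep hl)
  -- `D` may contain sets that are not faces. For the dimension bound, a simplex of `L` containing
  -- the barycenter of a face in `D` contains all its vertices.
  refine ⟨T, hT, {s | convexHull ℝ (s : Set E) ⊆ L.space}, fun x hx => ⟨fun hxL => ?_, fun h => ?_⟩,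
    fun s hs t ht hst => (convexHull_mono hst).trans ht, fun c hc s hs hsL => ?_⟩
  · obtain ⟨l, hl, hxl⟩ := mem_space_iff.1 hxL
    exact (convexHull_min (hcomp l hl x hx hxl) (convex_convexHull _ _)).trans
      (convexHull_subset_space hl)
  · exact h (mem_convexHull_carrier hx)
  · obtain ⟨hb, hbc⟩ := barycenter_mem hs
    have hbs := mem_convexHull_carrier hb
    rw [hbc] at hbs
    obtain ⟨l, hl, hyl⟩ := mem_space_iff.1 (hsL hbs)
    have hsub := hcomp l hl _ hb hyl
    rw [hbc] at hsub
    exact ((T.indep hs).card_le_card_of_subset_affineSpan (t := l)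
      (fun v hv => convexHull_subset_affineSpan _ (hsub v hv))).trans (hc l hl)

end Geometry.SimplicialComplex

/-! ### Simplicial posets and their order complexes -/

/-- A poset whose elements carry labels in such a way that the elements below `q` correspond to the
nonempty subsets of the label of `q`. -/
structure IsSimplicialPoset {Q W : Type*} [PartialOrder Q] (lab : Q → Finset W) : Prop where
  nonempty : ∀ q, (lab q).Nonempty
  mono : ∀ q q', q ≤ q' → lab q ⊆ lab q'
  exists_le : ∀ q σ, σ.Nonempty → σ ⊆ lab q → ∃ q' ≤ q, lab q' = σ
  unique_le : ∀ q p p', p ≤ q → p' ≤ q → lab p = lab p' → p = p'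

namespace IsSimplicialPoset

variable {Q W : Type*} [PartialOrder Q] {lab : Q → Finset W} (h : IsSimplicialPoset lab)
include h

/-- Below a fixed element, the order is decided by labels, since an element there is determined by
its label. -/
lemma le_of_subset {q p p' : Q} (hp : p ≤ q) (hp' : p' ≤ q) (hs : lab p ⊆ lab p') : p ≤ p' := by
  obtain ⟨r, hr, hrl⟩ := h.exists_le p' (lab p) (h.nonempty p) hs
  rwa [h.unique_le q p r hp (hr.trans hp') hrl.symm]

lemma card_le {p q : Q} (hpq : p ≤ q) : (lab p).card ≤ (lab q).card :=
  Finset.card_le_card (h.mono _ _ hpq)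

lemma eq_of_card_le {p q : Q} (hpq : p ≤ q) (hc : (lab q).card ≤ (lab p).card) : p = q :=
  h.unique_le q p q hpq le_rfl (Finset.eq_of_subset_of_card_le (h.mono _ _ hpq) hc)

lemma le_of_chain {C : Set Q} (hC : IsChain (· ≤ ·) C) {p q : Q} (hp : p ∈ C) (hq : q ∈ C)
    (hc : (lab p).card ≤ (lab q).card) : p ≤ q := by
  rcases hC.total hp hq with h1 | h1
  · exact h1
  · exact (h.eq_of_card_le h1 hc).ge

lemma card_injOn {C : Set Q} (hC : IsChain (· ≤ ·) C) : InjOn (fun q => (lab q).card) C :=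
  fun _ hp _ hq hpq => le_antisymm (h.le_of_chain hC hp hq hpq.le) (h.le_of_chain hC hq hp hpq.ge)

/-- The elements of rank `r` that can be inserted into a chain with a gap at `r`. -/
lemma exists_gap {C : Finset Q} (hC : IsChain (· ≤ ·) (C : Set Q)) {r : ℕ} (hr : 0 < r)
    (hmiss : ∀ q ∈ C, (lab q).card ≠ r) (habove : ∃ q ∈ C, r < (lab q).card) :
    ∃ q₁ ∈ C, ∃ τ : Finset W, r < (lab q₁).card ∧ τ.card < r ∧ τ ⊆ lab q₁ ∧
      (∀ q ∈ C, r < (lab q).card → (lab q₁).card ≤ (lab q).card) ∧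
      (∀ q ∈ C, (lab q).card < r → (lab q).card ≤ τ.card) ∧
      ∀ q, ((lab q).card = r ∧ ∀ p ∈ C, p ≤ q ∨ q ≤ p) ↔
        (q ≤ q₁ ∧ τ ⊆ lab q ∧ (lab q).card = r) := by
  classical
  obtain ⟨q₁, hq₁, hmin⟩ := Finset.exists_min_image (C.filter fun q => r < (lab q).card)
    (fun q => (lab q).card) (by obtain ⟨q, hq, hq'⟩ := habove; exact ⟨q, by simp [hq, hq']⟩)
  rw [Finset.mem_filter] at hq₁
  have hmin' : ∀ q ∈ C, r < (lab q).card → (lab q₁).card ≤ (lab q).card := fun q hq hqr =>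
    hmin q (by simp [hq, hqr])
  -- `q₁` is the lowest chain element above the gap. `τ` is the label of the highest one below it,
  -- or empty if there is none.
  obtain ⟨τ, hτ, hτr, hτ'⟩ : ∃ τ : Finset W, (∀ q, q ≤ q₁ → ((∀ p ∈ C, (lab p).card < r → p ≤ q) ↔
      τ ⊆ lab q)) ∧ τ.card < r ∧ ∀ q ∈ C, (lab q).card < r → lab q ⊆ τ := by
    by_cases hbelow : ∃ q ∈ C, (lab q).card < r
    · obtain ⟨q₀, hq₀, hmax⟩ := Finset.exists_max_image (C.filter fun q => (lab q).card < r)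
        (fun q => (lab q).card) (by obtain ⟨q, hq, hq'⟩ := hbelow; exact ⟨q, by simp [hq, hq']⟩)
      rw [Finset.mem_filter] at hq₀
      refine ⟨lab q₀, fun q hq => ⟨fun hall => h.mono _ _ (hall q₀ hq₀.1 hq₀.2),
        fun hsub p hp hpr => ?_⟩, hq₀.2, fun q hq hqr =>
          h.mono _ _ (h.le_of_chain hC hq hq₀.1 (hmax q (by simp [hq, hqr])))⟩
      have h1 : p ≤ q₀ := h.le_of_chain hC hp hq₀.1 (hmax p (by simp [hp, hpr]))
      have h2 : q₀ ≤ q₁ := h.le_of_chain hC hq₀.1 hq₁.1 (hq₀.2.trans hq₁.2).le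
      exact h1.trans (h.le_of_subset h2 hq hsub)
    · push Not at hbelow
      refine ⟨∅, fun q hq => ⟨fun _ => Finset.empty_subset _, fun _ p hp hpr => ?_⟩, by simpa using hr,
        fun q hq hqr => ?_⟩
      · exact absurd (hbelow p hp) (not_le.2 hpr)
      · exact absurd (hbelow q hq) (not_le.2 hqr)
  refine ⟨q₁, hq₁.1, τ, hq₁.2, hτr, (hτ q₁ le_rfl).1 fun p hp hpr =>
    h.le_of_chain hC hp hq₁.1 (hpr.trans hq₁.2).le, hmin',
    fun q hq hqr => Finset.card_le_card (hτ' q hq hqr), fun q => ⟨?_, ?_⟩⟩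
  · rintro ⟨hqr, hcomp⟩
    have hle : q ≤ q₁ := by
      rcases hcomp q₁ hq₁.1 with h1 | h1
      · exact absurd (h.card_le h1) (not_le.2 (hqr ▸ hq₁.2))
      · exact h1
    refine ⟨hle, (hτ q hle).1 fun p hp hpr => ?_, hqr⟩
    rcases hcomp p hp with h1 | h1
    · exact h1
    · exact absurd (h.card_le h1) (not_le.2 (hqr ▸ hpr))
  · rintro ⟨hle, hsub, hqr⟩
    refine ⟨hqr, fun p hp => ?_⟩
    rcases lt_trichotomy (lab p).card r with h1 | h1 | h1
    · exact Or.inl ((hτ q hle).2 hsub p hp h1)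
    · exact absurd h1 (hmiss p hp)
    · exact Or.inr (hle.trans (h.le_of_chain hC hq₁.1 hp (hmin' p hp h1)))

lemma exists_top {C : Finset Q} (hC : IsChain (· ≤ ·) (C : Set Q)) (hne : C.Nonempty) :
    ∃ q ∈ C, ∀ p ∈ C, p ≤ q := by
  obtain ⟨q, hq, hmax⟩ := Finset.exists_max_image C (fun q => (lab q).card) hne
  exact ⟨q, hq, fun p hp => h.le_of_chain hC hp hq (hmax p hp)⟩

/-- Ranks along a chain are distinct, so a chain with fewer than `n + 1` elements omits one. If the
top rank is omitted, the chain is extended upwards; otherwise a gap is filled. -/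
lemma exists_chain_insert [DecidableEq Q] {n : ℕ} (hext : ∀ q, ∃ q', q ≤ q' ∧ (lab q').card = n + 1)
    {C : Finset Q} (hC : IsChain (· ≤ ·) (C : Set Q)) (hne : C.Nonempty) (hcard : C.card < n + 1) :
    ∃ q ∉ C, IsChain (· ≤ ·) ((insert q C : Finset Q) : Set Q) := by
  have key : ∃ q, (∀ p ∈ C, p ≤ q ∨ q ≤ p) ∧ ∀ p ∈ C, (lab p).card ≠ (lab q).card := by
    by_cases htop : ∃ q ∈ C, (lab q).card = n + 1
    · obtain ⟨r, hr, hr'⟩ : ∃ r ∈ Finset.Icc 1 (n + 1), r ∉ C.image fun q => (lab q).card := by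
        apply Finset.exists_mem_notMem_of_card_lt_card
        rw [Finset.card_image_of_injOn (h.card_injOn hC)]
        simpa using hcard
      rw [Finset.mem_Icc] at hr
      simp only [Finset.mem_image, not_exists, not_and] at hr'
      obtain ⟨qt, hqt, hqt'⟩ := htop
      have hrn : r ≠ n + 1 := fun h => hr' qt hqt (hqt'.trans h.symm)
      obtain ⟨q₁, hq₁, τ, h1, h2, h3, -, -, h4⟩ := h.exists_gap hC (by omega : 0 < r)
        (fun q hq => hr' q hq) ⟨qt, hqt, by omega⟩
      obtain ⟨σ, hσ1, hσ2, hσ3⟩ := Finset.exists_subsuperset_card_eq h3 h2.le h1.le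
      obtain ⟨q, hq, hqσ⟩ := h.exists_le q₁ σ (Finset.card_pos.1 (by omega)) hσ2
      have := (h4 q).2 ⟨hq, hqσ ▸ hσ1, hqσ ▸ hσ3⟩
      exact ⟨q, this.2, fun p hp => by rw [this.1]; exact hr' p hp⟩
    · push Not at htop
      obtain ⟨q₀, -, hmax⟩ := h.exists_top hC hne
      obtain ⟨q, hq, hqc⟩ := hext q₀
      exact ⟨q, fun p hp => Or.inl ((hmax p hp).trans hq), fun p hp => by rw [hqc]; exact htop p hp⟩
  obtain ⟨q, hq, hq'⟩ := key
  refine ⟨q, fun hqC => hq' q hqC rfl, ?_⟩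
  rw [Finset.coe_insert]
  exact hC.insert fun p hp _ => (hq p hp).symm

lemma exists_chain_card_eq {n : ℕ} (hext : ∀ q, ∃ q', q ≤ q' ∧ (lab q').card = n + 1)
    {C : Finset Q} (hC : IsChain (· ≤ ·) (C : Set Q)) (hne : C.Nonempty) :
    ∃ C' : Finset Q, C ⊆ C' ∧ IsChain (· ≤ ·) (C' : Set Q) ∧ C'.card = n + 1 := by
  classical
  have hle : C.card ≤ n + 1 := by
    rw [← Finset.card_image_of_injOn (h.card_injOn hC)]
    calc _ ≤ (Finset.Icc 1 (n + 1)).card := Finset.card_le_card fun r hr => by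
            obtain ⟨q, -, rfl⟩ := Finset.mem_image.1 hr
            obtain ⟨q', hq', hc⟩ := hext q
            have := h.card_le hq'
            have := (h.nonempty q).card_pos
            rw [Finset.mem_Icc]; omega
      _ = n + 1 := by simp
  induction hk : n + 1 - C.card generalizing C with
  | zero => exact ⟨C, subset_rfl, hC, by omega⟩
  | succ k ih =>
    obtain ⟨q, hq, hC'⟩ := h.exists_chain_insert hext hC hne (by omega)
    have hc := Finset.card_insert_of_notMem hq
    obtain ⟨C', h1, h2, h3⟩ := ih hC' (by simp) (by omega) (by omega)
    exact ⟨C', (Finset.subset_insert _ _).trans h1, h2, h3⟩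

/-- Exactly one rank is missing. At the top, the choices are counted by `htwo`. At a lower rank, the
label above the gap has two elements more than the one below, and adding either of them gives the
two choices. -/
lemma ncard_chains {n : ℕ} (hext : ∀ q, ∃ q', q ≤ q' ∧ (lab q').card = n + 1)
    (htwo : ∀ q, (lab q).card = n → {q' | q ≤ q' ∧ (lab q').card = n + 1}.ncard = 2)
    {C : Finset Q} (hC : IsChain (· ≤ ·) (C : Set Q)) (hne : C.Nonempty) (hcard : C.card = n) :
    {C' : Finset Q | IsChain (· ≤ ·) (C' : Set Q) ∧ C ⊆ C' ∧ C'.card = n + 1}.ncard = 2 := by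
  classical
  have hrank : ∀ q, (lab q).card ∈ Finset.Icc 1 (n + 1) := fun q => by
    obtain ⟨q', hq', hc⟩ := hext q
    have := h.card_le hq'
    have := (h.nonempty q).card_pos
    rw [Finset.mem_Icc]; omega
  -- exactly one rank is missing in `C`
  obtain ⟨r, hr⟩ : ∃ r, Finset.Icc 1 (n + 1) \ C.image (fun q => (lab q).card) = {r} := by
    rw [← Finset.card_eq_one, Finset.card_sdiff_of_subset, Finset.card_image_of_injOn (h.card_injOn hC)]
    · simp [hcard]
    · intro r hr
      obtain ⟨q, -, rfl⟩ := Finset.mem_image.1 hr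
      exact hrank q
  have hr1 : r ∈ Finset.Icc 1 (n + 1) ∧ ∀ q ∈ C, (lab q).card ≠ r := by
    have : r ∈ Finset.Icc 1 (n + 1) \ C.image (fun q => (lab q).card) := by simp [hr]
    simpa using this
  have hr2 : ∀ s ∈ Finset.Icc 1 (n + 1), s ≠ r → ∃ q ∈ C, (lab q).card = s := by
    intro s hs hsr
    by_contra hc
    have : s ∈ Finset.Icc 1 (n + 1) \ C.image (fun q => (lab q).card) := by
      rw [Finset.mem_sdiff]
      exact ⟨hs, fun h => hc (by simpa using h)⟩
    rw [hr, Finset.mem_singleton] at this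
    exact hsr this
  have hnC : ∀ q, (lab q).card = r → q ∉ C := fun q hq hqC => hr1.2 q hqC hq
  have hset : {C' : Finset Q | IsChain (· ≤ ·) (C' : Set Q) ∧ C ⊆ C' ∧ C'.card = n + 1} =
      (fun q => insert q C) '' {q | (lab q).card = r ∧ ∀ p ∈ C, p ≤ q ∨ q ≤ p} := by
    ext C'
    constructor
    · rintro ⟨hC', hsub, hc⟩
      obtain ⟨q, hq, hqC⟩ := Finset.exists_mem_notMem_of_card_lt_card (by omega : C.card < C'.card)
      refine ⟨q, ⟨?_, fun p hp => hC'.total (hsub hp) hq⟩, ?_⟩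
      · by_contra hne'
        obtain ⟨p, hp, hpq⟩ := hr2 _ (hrank q) hne'
        have := h.card_injOn hC' (hsub hp) hq hpq
        exact hqC (this ▸ hp)
      · refine Finset.eq_of_subset_of_card_le (Finset.insert_subset hq hsub) ?_
        rw [Finset.card_insert_of_notMem hqC]; omega
    · rintro ⟨q, ⟨hq, hcomp⟩, rfl⟩
      refine ⟨?_, Finset.subset_insert _ _, by
        rw [Finset.card_insert_of_notMem (hnC q hq), hcard]⟩
      rw [Finset.coe_insert]
      exact hC.insert fun p hp _ => (hcomp p hp).symm
  rw [hset, Set.InjOn.ncard_image]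
  · by_cases hrn : r = n + 1
    · obtain ⟨q₀, hq₀, hq₀max⟩ := h.exists_top hC hne
      have hq₀c : (lab q₀).card = n := by
        have h1 := hne.card_pos
        obtain ⟨q, hq, hqn⟩ := hr2 n (by rw [Finset.mem_Icc]; omega) (by omega)
        have h2 := h.card_le (hq₀max q hq)
        have h3 := Finset.mem_Icc.1 (hrank q₀)
        have h4 := hr1.2 q₀ hq₀
        omega
      rw [← htwo q₀ hq₀c]
      congr 1
      ext q
      constructor
      · rintro ⟨hq, hcomp⟩
        refine ⟨?_, hq.trans hrn⟩
        rcases hcomp q₀ hq₀ with h1 | h1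
        · exact h1
        · have := h.card_le h1; omega
      · rintro ⟨hq, hqc⟩
        exact ⟨hqc.trans hrn.symm, fun p hp => Or.inl ((hq₀max p hp).trans hq)⟩
    · have hrI := Finset.mem_Icc.1 hr1.1
      obtain ⟨qa, hqa, hqac⟩ := hr2 (r + 1) (by rw [Finset.mem_Icc]; omega) (by omega)
      obtain ⟨q₁, hq₁, τ, h1, h2, h3, h5, h6, h4⟩ := h.exists_gap hC (by omega : 0 < r)
        hr1.2 ⟨qa, hqa, by omega⟩
      have hq₁c : (lab q₁).card = r + 1 := by
        have := h5 qa hqa (by omega); omega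
      -- For `r = 1` there is nothing below the gap and `τ` is empty.
      have hτc : τ.card + 1 = r := by
        by_cases hr1' : r = 1
        · omega
        · obtain ⟨qb, hqb, hqbc⟩ := hr2 (r - 1) (by rw [Finset.mem_Icc]; omega) (by omega)
          have := h6 qb hqb (by omega)
          omega
      have h2c : (lab q₁ \ τ).card = 2 := by
        rw [Finset.card_sdiff_of_subset h3]; omega
      obtain ⟨x, y, hxy, hxyeq⟩ := Finset.card_eq_two.1 h2c
      have hx : x ∈ lab q₁ ∧ x ∉ τ := Finset.mem_sdiff.1 (hxyeq ▸ by simp)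
      have hy : y ∈ lab q₁ ∧ y ∉ τ := Finset.mem_sdiff.1 (hxyeq ▸ by simp)
      obtain ⟨qx, hqx, hqxl⟩ := h.exists_le q₁ (insert x τ) (by simp)
        (Finset.insert_subset hx.1 h3)
      obtain ⟨qy, hqy, hqyl⟩ := h.exists_le q₁ (insert y τ) (by simp)
        (Finset.insert_subset hy.1 h3)
      have : {q | (lab q).card = r ∧ ∀ p ∈ C, p ≤ q ∨ q ≤ p} = {qx, qy} := by
        ext q
        rw [Set.mem_ofPred_eq, h4 q, Set.mem_insert_iff, Set.mem_singleton_iff]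
        constructor
        · rintro ⟨hq, hτq, hqr⟩
          obtain ⟨z, hz, hzτ⟩ := Finset.exists_mem_notMem_of_card_lt_card
            (by omega : τ.card < (lab q).card)
          have hqz : insert z τ = lab q := by
            refine Finset.eq_of_subset_of_card_le (Finset.insert_subset hz hτq) ?_
            rw [Finset.card_insert_of_notMem hzτ]; omega
          have hz' : z ∈ ({x, y} : Finset W) := by
            rw [← hxyeq, Finset.mem_sdiff]; exact ⟨h.mono _ _ hq hz, hzτ⟩
          rcases (by simpa using hz' : z = x ∨ z = y) with rfl | rfl
          · exact Or.inl (h.unique_le q₁ q qx hq hqx (by rw [hqxl, hqz]))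
          · exact Or.inr (h.unique_le q₁ q qy hq hqy (by rw [hqyl, hqz]))
        · rintro (rfl | rfl)
          · exact ⟨hqx, hqxl ▸ Finset.subset_insert _ _, by
              rw [hqxl, Finset.card_insert_of_notMem hx.2]; omega⟩
          · exact ⟨hqy, hqyl ▸ Finset.subset_insert _ _, by
              rw [hqyl, Finset.card_insert_of_notMem hy.2]; omega⟩
      rw [this, Set.ncard_pair]
      rintro rfl
      have : x ∈ insert y τ := by rw [← hqyl, hqxl]; simp
      simp [hxy, hx.2] at this
  · rintro q ⟨hq, -⟩ q' ⟨hq', -⟩ heq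
    have : q ∈ insert q' C := by
      have := Finset.mem_insert_self q C
      simp only at heq
      rwa [heq] at this
    exact (Finset.mem_insert.1 this).resolve_right (hnC q hq)

end IsSimplicialPoset

/-! ### Geometric realization of the order complex. -/

section ChainWeights

variable {Q W : Type*} [Fintype Q] [PartialOrder Q]

/-- The weights on a labelled poset that are supported on a chain. The weight of `q` counts once
for each element of the label of `q`. -/
def chainWeights (lab : Q → Finset W) : Set (Q → ℝ) :=
  {y | (∀ q, 0 ≤ y q) ∧ ∑ q, ((lab q).card : ℝ) * y q = 1 ∧ IsChain (· ≤ ·) {q | y q ≠ 0}}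

lemma isCompact_chainWeights {lab : Q → Finset W} (hlab : ∀ q, (lab q).Nonempty) :
    IsCompact (chainWeights lab) := by
  have hsub : chainWeights lab ⊆ Set.pi univ fun _ => Icc (0 : ℝ) 1 := by
    rintro y ⟨h0, h1, -⟩ q -
    refine ⟨h0 q, ?_⟩
    have h2 : ((lab q).card : ℝ) * y q ≤ 1 := by
      rw [← h1]
      exact Finset.single_le_sum (f := fun q => ((lab q).card : ℝ) * y q)
        (fun q _ => mul_nonneg (Nat.cast_nonneg _) (h0 q)) (Finset.mem_univ q)
    have h3 : (1 : ℝ) ≤ (lab q).card := by exact_mod_cast (hlab q).card_pos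
    nlinarith [h0 q]
  refine IsCompact.of_isClosed_subset (isCompact_univ_pi fun _ => isCompact_Icc) ?_ hsub
  -- Being supported on a chain is a closed condition: products of the values at incomparable
  -- elements vanish.
  have : chainWeights lab = {y | (∀ q, 0 ≤ y q)} ∩ {y | ∑ q, ((lab q).card : ℝ) * y q = 1} ∩
      {y | ∀ p q, ¬ (p ≤ q ∨ q ≤ p) → y p * y q = 0} := by
    ext y
    constructor
    · rintro ⟨h0, h1, h2⟩
      refine ⟨⟨h0, h1⟩, fun p q hpq => ?_⟩
      by_contra hne
      exact hpq (h2.total (left_ne_zero_of_mul hne) (right_ne_zero_of_mul hne))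
    · rintro ⟨⟨h0, h1⟩, h2⟩
      refine ⟨h0, h1, fun p hp q hq _ => ?_⟩
      by_contra hpq
      exact mul_ne_zero hp hq (h2 p q hpq)
  rw [this]
  refine (IsClosed.inter ?_ ?_).inter ?_
  · simp only [Set.ofPred_forall]
    exact isClosed_iInter fun q => isClosed_le continuous_const (continuous_apply q)
  · exact isClosed_eq (by fun_prop) continuous_const
  · simp only [Set.ofPred_forall]
    exact isClosed_iInter fun p => isClosed_iInter fun q => isClosed_iInter fun _ =>
      isClosed_eq (by fun_prop) continuous_const

end ChainWeights

section OrderComplex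

open Geometry

variable {Q W : Type*} {N : ℕ}

/-- The vertices of the realization of a labelled poset. -/
noncomputable def posetVertex (lab : Q → Finset W) (ι : Q ≃ Fin N) (q : Q) :
    EuclideanSpace ℝ (Fin N) :=
  ((lab q).card : ℝ)⁻¹ • EuclideanSpace.single (ι q) (1 : ℝ)

variable {lab : Q → Finset W} {ι : Q ≃ Fin N}

lemma posetVertex_apply [DecidableEq Q] (q p : Q) :
    posetVertex lab ι q (ι p) = if p = q then ((lab q).card : ℝ)⁻¹ else 0 := by
  simp [posetVertex, PiLp.single_apply]

lemma posetVertex_injective (hlab : ∀ q, (lab q).Nonempty) :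
    Function.Injective (posetVertex lab ι) := by
  classical
  intro p q hpq
  have := congrArg (fun v : EuclideanSpace ℝ (Fin N) => v (ι p)) hpq
  simp only [posetVertex_apply, if_true] at this
  by_contra hne
  rw [if_neg hne] at this
  have h3 : (0 : ℝ) < (lab p).card := by exact_mod_cast (hlab p).card_pos
  exact (inv_pos.2 h3).ne' this

/-- Vertices are multiples of distinct standard basis vectors, so coordinates recover the weights.
The scaling by the label size turns coordinates into `chainWeights`, for which the projection to the
base becomes linear. -/
lemma IsBary.apply_posetVertex (hlab : ∀ q, (lab q).Nonempty)
    {w : EuclideanSpace ℝ (Fin N) →₀ ℝ} {x : EuclideanSpace ℝ (Fin N)} (hw : IsBary w x)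
    {C : Finset Q} (hC : w.support ⊆ C.map ⟨posetVertex lab ι, posetVertex_injective hlab⟩) (q : Q) :
    x (ι q) = w (posetVertex lab ι q) * ((lab q).card : ℝ)⁻¹ := by
  classical
  rw [← hw.point, weightedPoint_eq_sum hC, Finset.sum_map]
  simp only [Function.Embedding.coeFn_mk, WithLp.ofLp_sum, WithLp.ofLp_smul, Finset.sum_apply,
    Pi.smul_apply, posetVertex_apply, smul_eq_mul]
  by_cases hq : q ∈ C
  · rw [Finset.sum_eq_single_of_mem q hq]
    · simp
    · intro p _ hpq; rw [if_neg hpq.symm, mul_zero]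
  · have h0 : w (posetVertex lab ι q) = 0 := Finsupp.notMem_support_iff.1 fun h => hq (by
      have := hC h
      rw [Finset.mem_map] at this
      obtain ⟨p, hp, hpq⟩ := this
      rwa [← posetVertex_injective hlab hpq])
    rw [h0, zero_mul]
    refine Finset.sum_eq_zero fun p hp => ?_
    rw [if_neg (by rintro rfl; exact hq hp), mul_zero]

variable [PartialOrder Q]

/-- The faces of the order complex. -/
def orderFaces (lab : Q → Finset W) (ι : Q ≃ Fin N) (hlab : ∀ q, (lab q).Nonempty) :
    Set (Finset (EuclideanSpace ℝ (Fin N))) :=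
  {s | ∃ C : Finset Q, C.Nonempty ∧ IsChain (· ≤ ·) (C : Set Q) ∧
    s = C.map ⟨posetVertex lab ι, posetVertex_injective hlab⟩}

/-- The order complex of a labelled poset. -/
noncomputable def orderComplex (lab : Q → Finset W) (ι : Q ≃ Fin N) (hlab : ∀ q, (lab q).Nonempty) :
    SimplicialComplex ℝ (EuclideanSpace ℝ (Fin N)) :=
  SimplicialComplex.ofUniqueWeights (orderFaces lab ι hlab)
    (by rintro s ⟨C, hC, -, rfl⟩; simpa using hC)
    (by
      rintro s ⟨C, hC, hchain, rfl⟩ t hts ht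
      obtain ⟨D, hD, rfl⟩ := Finset.subset_map_iff.1 hts
      exact ⟨D, by simpa using ht, hchain.mono (by exact_mod_cast hD), rfl⟩)
    (by
      rintro w w' x hw hw' ⟨C, -, -, hC⟩ ⟨C', -, -, hC'⟩
      ext v
      by_cases hv : ∃ q, posetVertex lab ι q = v
      · obtain ⟨q, rfl⟩ := hv
        have h3 : (0 : ℝ) < (lab q).card := by exact_mod_cast (hlab q).card_pos
        have h1 := hw.apply_posetVertex hlab hC.le q
        have h2 := hw'.apply_posetVertex hlab hC'.le q
        exact mul_right_cancel₀ (inv_pos.2 h3).ne' (h1.symm.trans h2)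
      · have key : ∀ (u : EuclideanSpace ℝ (Fin N) →₀ ℝ) (D : Finset Q),
            u.support = D.map ⟨posetVertex lab ι, posetVertex_injective hlab⟩ → u v = 0 := by
          intro u D hD
          refine Finsupp.notMem_support_iff.1 fun h => hv ?_
          rw [hD, Finset.mem_map] at h
          obtain ⟨p, -, hp⟩ := h
          exact ⟨p, hp⟩
        rw [key w C hC, key w' C' hC'])

variable (hlab : ∀ q, (lab q).Nonempty)

lemma isPure_orderComplex (h : IsSimplicialPoset lab) {n : ℕ}
    (hext : ∀ q, ∃ q', q ≤ q' ∧ (lab q').card = n + 1) : (orderComplex lab ι hlab).IsPure n := by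
  rintro s ⟨C, hne, hC, rfl⟩
  obtain ⟨C', hsub, hC', hc⟩ := h.exists_chain_card_eq hext hC hne
  exact ⟨_, ⟨C', hne.mono hsub, hC', rfl⟩, Finset.map_subset_map.2 hsub, by rw [Finset.card_map, hc]⟩

lemma isNonbranching_orderComplex (h : IsSimplicialPoset lab) {n : ℕ}
    (hext : ∀ q, ∃ q', q ≤ q' ∧ (lab q').card = n + 1)
    (htwo : ∀ q, (lab q).card = n → {q' | q ≤ q' ∧ (lab q').card = n + 1}.ncard = 2) :
    (orderComplex lab ι hlab).IsNonbranching n := by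
  rintro s ⟨C, hne, hC, rfl⟩ hcard
  rw [Finset.card_map] at hcard
  rw [← h.ncard_chains hext htwo hC hne hcard,
    ← Set.ncard_image_of_injective _
      (Finset.map_injective ⟨posetVertex lab ι, posetVertex_injective hlab⟩)]
  congr 1
  ext t
  constructor
  · rintro ⟨⟨C', -, hC', rfl⟩, hsub, hc⟩
    exact ⟨C', ⟨hC', Finset.map_subset_map.1 hsub, by rwa [Finset.card_map] at hc⟩, rfl⟩
  · rintro ⟨C', ⟨hC', hsub, hc⟩, rfl⟩
    exact ⟨⟨C', hne.mono hsub, hC', rfl⟩, Finset.map_subset_map.2 hsub, by rwa [Finset.card_map]⟩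

variable [Fintype Q]

lemma orderComplex_finite : (orderComplex lab ι hlab).faces.Finite := by
  have : (orderComplex lab ι hlab).faces ⊆ range fun C : Finset Q =>
      C.map ⟨posetVertex lab ι, posetVertex_injective hlab⟩ := by
    rintro s ⟨C, -, -, rfl⟩; exact ⟨C, rfl⟩
  exact (Set.finite_range _).subset this

lemma mem_orderComplex_space {x : EuclideanSpace ℝ (Fin N)} :
    x ∈ (orderComplex lab ι hlab).space ↔ (fun q => x (ι q)) ∈ chainWeights lab := by
  classical
  have hpos : ∀ q, (0 : ℝ) < (lab q).card := fun q => by exact_mod_cast (hlab q).card_pos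
  constructor
  · intro hx
    obtain ⟨w, hw, C, hne, hC, hs⟩ := SimplicialComplex.exists_isBary _ hx
    have hx : ∀ q, x (ι q) = w (posetVertex lab ι q) * ((lab q).card : ℝ)⁻¹ :=
      hw.apply_posetVertex hlab hs.le
    have hzero : ∀ q, q ∉ C → w (posetVertex lab ι q) = 0 := fun q hq =>
      Finsupp.notMem_support_iff.1 fun h => hq (by
        rw [hs, Finset.mem_map] at h
        obtain ⟨p, hp, hpq⟩ := h
        rwa [← posetVertex_injective hlab hpq])
    refine ⟨fun q => ?_, ?_, ?_⟩
    · simp only [hx q]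
      exact mul_nonneg (hw.nonneg _) (inv_nonneg.2 (hpos q).le)
    · have := hw.total
      rw [totalWeight_eq_sum hs.le, Finset.sum_map] at this
      rw [← this, ← Finset.sum_subset (Finset.subset_univ C)]
      · refine Finset.sum_congr rfl fun q _ => ?_
        simp only [hx q]; have := (hpos q).ne'
        simp only [Function.Embedding.coeFn_mk]; field_simp
      · intro q _ hq; simp only [hx q, hzero q hq]; ring
    · refine hC.mono fun q hq => ?_
      by_contra hqC
      apply hq
      simp only [hx q, hzero q hqC, zero_mul]
  · rintro ⟨h0, h1, hC⟩
    let C : Finset Q := Finset.univ.filter fun q => x (ι q) ≠ 0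
    let w : EuclideanSpace ℝ (Fin N) →₀ ℝ :=
      ∑ q, Finsupp.single (posetVertex lab ι q) ((lab q).card * x (ι q))
    have hwv : ∀ q, w (posetVertex lab ι q) = (lab q).card * x (ι q) := fun q => by
      simp only [w, Finsupp.finsetSum_apply, Finsupp.single_apply]
      rw [Finset.sum_eq_single_of_mem q (Finset.mem_univ q)]
      · simp
      · intro p _ hpq; rw [if_neg fun h => hpq (posetVertex_injective hlab h)]
    have hwo : ∀ v, (∀ q, posetVertex lab ι q ≠ v) → w v = 0 := fun v hv => by
      simp only [w, Finsupp.finsetSum_apply, Finsupp.single_apply]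
      exact Finset.sum_eq_zero fun q _ => if_neg (hv q)
    have hsupp : w.support = C.map ⟨posetVertex lab ι, posetVertex_injective hlab⟩ := by
      ext v
      rw [Finsupp.mem_support_iff, Finset.mem_map]
      by_cases hv : ∃ q, posetVertex lab ι q = v
      · obtain ⟨q, rfl⟩ := hv
        rw [hwv]
        have := (hpos q).ne'
        simp only [ne_eq, mul_eq_zero, this, false_or, Finset.mem_filter, Finset.mem_univ, true_and,
          Function.Embedding.coeFn_mk, C]
        constructor
        · intro h; exact ⟨q, h, rfl⟩
        · rintro ⟨p, hp, hpq⟩; rwa [← posetVertex_injective hlab hpq]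
      · push Not at hv
        simp only [hwo v hv, ne_eq, not_true, false_iff, not_exists, not_and]
        exact fun q _ => hv q
    have hw : IsBary w x := by
      refine ⟨fun v => ?_, ?_, ?_⟩
      · by_cases hv : ∃ q, posetVertex lab ι q = v
        · obtain ⟨q, rfl⟩ := hv
          rw [hwv]; exact mul_nonneg (hpos q).le (h0 q)
        · push Not at hv; exact (hwo v hv).ge
      · simpa only [w, map_sum, totalWeight_single] using h1
      · simp only [w, map_sum, weightedPoint_single]
        ext j
        obtain ⟨q, rfl⟩ := ι.surjective j
        simp only [WithLp.ofLp_sum, WithLp.ofLp_smul, Finset.sum_apply, Pi.smul_apply,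
          posetVertex_apply, smul_eq_mul]
        rw [Finset.sum_eq_single_of_mem q (Finset.mem_univ q)]
        · rw [if_pos rfl]; have := (hpos q).ne'; field_simp
        · intro p _ hpq; rw [if_neg hpq.symm, mul_zero]
    refine SimplicialComplex.mem_space_of_isBary hw ⟨C, ?_, ?_, hsupp⟩
    · have := hw.support_nonempty
      rw [hsupp] at this
      simpa using this
    · refine hC.mono ?_
      intro q hq
      simpa [C] using hq

end OrderComplex

/-! ### Coordinates with respect to the barycentric subdivision. -/

namespace Geometry.SimplicialComplex

section Layers

variable {E : Type*} [AddCommGroup E] [Module ℝ E] {K : SimplicialComplex ℝ E} [Fintype K.faces]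

/-- The barycentric weights of a combination of the vertex sums of the faces. -/
noncomputable def faceWeights (t : K.faces → ℝ) : E →₀ ℝ :=
  ∑ σ, t σ • ∑ v ∈ σ.1, Finsupp.single v (1 : ℝ)

/-- The combination of the vertex sums of the faces. -/
noncomputable def faceSum (t : K.faces → ℝ) : E := ∑ σ, t σ • ∑ v ∈ σ.1, v

lemma faceWeights_apply [DecidableEq E] (t : K.faces → ℝ) (v : E) :
    faceWeights t v = ∑ σ : K.faces, if v ∈ σ.1 then t σ else 0 := by
  simp only [faceWeights, Finsupp.finsetSum_apply, Finsupp.smul_apply, Finsupp.single_apply,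
    smul_eq_mul]
  refine Finset.sum_congr rfl fun σ _ => ?_
  rw [Finset.sum_ite_eq' σ.1 v (fun _ => (1 : ℝ))]
  split_ifs <;> simp

lemma weightedPoint_faceWeights (t : K.faces → ℝ) : weightedPoint (faceWeights t) = faceSum t := by
  simp [faceWeights, faceSum, map_sum]

lemma totalWeight_faceWeights (t : K.faces → ℝ) :
    totalWeight E (faceWeights t) = ∑ σ : K.faces, (σ.1.card : ℝ) * t σ := by
  simp [faceWeights, map_sum, mul_comm]

lemma support_faceWeights {t : K.faces → ℝ} (h0 : ∀ σ, 0 ≤ t σ) (v : E) :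
    v ∈ (faceWeights t).support ↔ ∃ σ : K.faces, t σ ≠ 0 ∧ v ∈ σ.1 := by
  classical
  rw [Finsupp.mem_support_iff, faceWeights_apply, ne_eq, Finset.sum_eq_zero_iff_of_nonneg]
  · simp only [Finset.mem_univ, true_implies, not_forall]
    refine exists_congr fun σ => ?_
    by_cases hv : v ∈ σ.1 <;> simp [hv]
  · intro σ _; split_ifs
    exacts [h0 σ, le_rfl]

/-- The support of the resulting weights is the union of a chain of faces, that is, its largest
member. -/
lemma exists_top_layer {t : K.faces → ℝ} (ht : t ∈ chainWeights fun σ : K.faces => σ.1) :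
    ∃ σ : K.faces, t σ ≠ 0 ∧ (∀ τ, t τ ≠ 0 → τ ≤ σ) ∧ (faceWeights t).support = σ.1 := by
  classical
  obtain ⟨h0, h1, hC⟩ := ht
  have hne : (Finset.univ.filter fun σ => t σ ≠ 0).Nonempty := by
    rw [Finset.nonempty_iff_ne_empty]
    intro he
    have hz : ∀ σ, t σ = 0 := fun σ => by
      by_contra h
      have : σ ∈ Finset.univ.filter fun σ => t σ ≠ 0 := by simp [h]
      rw [he] at this
      simp at this
    simp [hz] at h1
  obtain ⟨σ, hσ, hmax⟩ := Finset.exists_max_image _ (fun σ : K.faces => σ.1.card) hne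
  simp only [Finset.mem_filter, Finset.mem_univ, true_and] at hσ hmax
  have htop : ∀ τ, t τ ≠ 0 → τ ≤ σ := by
    intro τ hτ
    rcases hC.total hτ hσ with h | h
    · exact h
    · exact (Subtype.ext (Finset.eq_of_subset_of_card_le h (hmax τ hτ))).ge
  refine ⟨σ, hσ, htop, ?_⟩
  ext v
  rw [support_faceWeights h0]
  exact ⟨fun ⟨τ, hτ, hv⟩ => htop τ hτ hv, fun hv => ⟨σ, hσ, hv⟩⟩

lemma isBary_faceWeights {t : K.faces → ℝ} (ht : t ∈ chainWeights fun σ : K.faces => σ.1) :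
    IsBary (faceWeights t) (faceSum t) where
  nonneg v := by
    classical
    rw [faceWeights_apply]
    refine Finset.sum_nonneg fun σ _ => ?_
    split_ifs
    exacts [ht.1 σ, le_rfl]
  total := by rw [totalWeight_faceWeights]; exact ht.2.1
  point := weightedPoint_faceWeights t

lemma support_faceWeights_mem {t : K.faces → ℝ} (ht : t ∈ chainWeights fun σ : K.faces => σ.1) :
    (faceWeights t).support ∈ K.faces := by
  obtain ⟨σ, -, -, h⟩ := exists_top_layer ht
  rw [h]; exact σ.2

lemma faceSum_mem_space {t : K.faces → ℝ} (ht : t ∈ chainWeights fun σ : K.faces => σ.1) :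
    faceSum t ∈ K.space :=
  mem_space_of_isBary (isBary_faceWeights ht) (support_faceWeights_mem ht)

lemma exists_carrier_faceSum {t : K.faces → ℝ} (ht : t ∈ chainWeights fun σ : K.faces => σ.1) :
    ∃ σ : K.faces, t σ ≠ 0 ∧ (∀ τ, t τ ≠ 0 → τ ≤ σ) ∧ K.carrier (faceSum t) = σ.1 := by
  obtain ⟨σ, h1, h2, h3⟩ := exists_top_layer ht
  exact ⟨σ, h1, h2, (carrier_eq (isBary_faceWeights ht) (support_faceWeights_mem ht)).trans h3⟩

-- The total of the layers above σ is the smallest vertex weight on σ, so the point determines it.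
-- The minimum occurs at a vertex of σ outside the largest layer not containing σ.
open Classical in
lemma sum_above_le {t : K.faces → ℝ} (ht : t ∈ chainWeights fun σ : K.faces => σ.1) (σ : K.faces) :
    (∀ v ∈ σ.1, (∑ τ, if σ ≤ τ then t τ else 0) ≤ faceWeights t v) ∧
      ∃ v ∈ σ.1, faceWeights t v = ∑ τ, if σ ≤ τ then t τ else 0 := by
  obtain ⟨h0, -, hC⟩ := ht
  constructor
  · intro v hv
    rw [faceWeights_apply]
    refine Finset.sum_le_sum fun τ _ => ?_
    by_cases h : σ ≤ τ
    · rw [if_pos h, if_pos (h hv)]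
    · rw [if_neg h]; split_ifs
      exacts [h0 τ, le_rfl]
  · obtain ⟨v, hv, hvτ⟩ : ∃ v ∈ σ.1, ∀ τ, t τ ≠ 0 → ¬ σ ≤ τ → v ∉ τ.1 := by
      by_cases hne : (Finset.univ.filter fun τ => t τ ≠ 0 ∧ ¬ σ ≤ τ).Nonempty
      · obtain ⟨τ, hτ, hmax⟩ := Finset.exists_max_image _ (fun τ : K.faces => τ.1.card) hne
        simp only [Finset.mem_filter, Finset.mem_univ, true_and] at hτ hmax
        obtain ⟨v, hv, hvτ⟩ := Finset.not_subset.1 hτ.2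
        refine ⟨v, hv, fun τ' hτ' hσ hv' => hvτ ?_⟩
        rcases hC.total hτ' hτ.1 with h | h
        · exact h hv'
        · rwa [Subtype.ext (Finset.eq_of_subset_of_card_le h (hmax τ' ⟨hτ', hσ⟩))]
      · obtain ⟨v, hv⟩ := K.nonempty_of_mem_faces σ.2
        refine ⟨v, hv, fun τ hτ hσ => absurd ⟨τ, ?_⟩ hne⟩
        simp [hτ, hσ]
    refine ⟨v, hv, ?_⟩
    rw [faceWeights_apply]
    refine Finset.sum_congr rfl fun τ _ => ?_
    by_cases h : σ ≤ τ
    · rw [if_pos h, if_pos (h hv)]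
    · rw [if_neg h]
      by_cases h' : t τ = 0
      · simp [h']
      · rw [if_neg (hvτ τ h' h)]

/-- The point determines the vertex weights, hence the totals above every face (`sum_above_le`).
Single layers follow by induction from larger to smaller faces. -/
lemma faceSum_injOn : InjOn faceSum (chainWeights fun σ : K.faces => σ.1) := by
  classical
  intro t ht t' ht' heq
  have hw : faceWeights t = faceWeights t' := K.isBary_unique (isBary_faceWeights ht)
    (heq ▸ isBary_faceWeights ht') (support_faceWeights_mem ht) (support_faceWeights_mem ht')
  have hsum : ∀ σ, (∑ τ, if σ ≤ τ then t τ else 0) = ∑ τ, if σ ≤ τ then t' τ else 0 := by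
    intro σ
    obtain ⟨h1, v, hv, h2⟩ := sum_above_le ht σ
    obtain ⟨h1', v', hv', h2'⟩ := sum_above_le ht' σ
    apply le_antisymm
    · rw [← h2', ← hw]; exact h1 v' hv'
    · rw [← h2, hw]; exact h1' v hv
  have hsplit : ∀ (s : K.faces → ℝ) σ, (∑ τ, if σ ≤ τ then s τ else 0) =
      s σ + ∑ τ, if σ < τ then s τ else 0 := by
    intro s σ
    have : s σ = ∑ τ, if τ = σ then s τ else 0 := by simp
    rw [this, ← Finset.sum_add_distrib]
    refine Finset.sum_congr rfl fun τ _ => ?_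
    by_cases h : τ = σ
    · subst h; simp
    · by_cases h' : σ ≤ τ
      · simp [h, h', lt_of_le_of_ne h' (Ne.symm h)]
      · have h'' : ¬ σ < τ := fun h'' => h' h''.le
        simp [h, h', h'']
  ext σ
  induction σ using (wellFounded_gt (α := K.faces)).induction with
  | _ σ ih =>
  have := hsum σ
  rw [hsplit, hsplit] at this
  have h2 : (∑ τ, if σ < τ then t τ else 0) = ∑ τ, if σ < τ then t' τ else 0 := by
    refine Finset.sum_congr rfl fun τ _ => ?_
    split_ifs with h
    exacts [ih τ h, rfl]
  linarith

/-- The least weight times the whole support is taken off as one layer; what remains has a strictly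
smaller support. The induction ends at `w = 0`, which is why that case is admitted. -/
lemma exists_layers (w : E →₀ ℝ) (h0 : ∀ v, 0 ≤ w v) (hw : w = 0 ∨ w.support ∈ K.faces) :
    ∃ t : K.faces → ℝ, (∀ σ, 0 ≤ t σ) ∧ IsChain (· ≤ ·) {σ | t σ ≠ 0} ∧
      (∀ σ, t σ ≠ 0 → σ.1 ⊆ w.support) ∧ faceWeights t = w := by
  classical
  induction hn : w.support.card using Nat.strong_induction_on generalizing w with
  | _ n ih =>
  rcases hw with rfl | hw
  · refine ⟨0, fun _ => le_rfl, ?_, fun σ h => absurd rfl h, by simp [faceWeights]⟩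
    simp [IsChain]
  · obtain ⟨v₀, hv₀, hmin⟩ := Finset.exists_min_image w.support w (K.nonempty_of_mem_faces hw)
    have hm : 0 < w v₀ := lt_of_le_of_ne (h0 v₀) (Ne.symm (Finsupp.mem_support_iff.1 hv₀))
    let w' : E →₀ ℝ := w - w v₀ • ∑ v ∈ w.support, Finsupp.single v (1 : ℝ)
    have hw' : ∀ v, w' v = if v ∈ w.support then w v - w v₀ else 0 := fun v => by
      simp only [w', Finsupp.sub_apply, Finsupp.smul_apply, Finsupp.finsetSum_apply,
        Finsupp.single_apply, smul_eq_mul]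
      rw [Finset.sum_ite_eq' w.support v (fun _ => (1 : ℝ))]
      by_cases hv : v ∈ w.support
      · simp only [if_pos hv]; ring
      · simp only [if_neg hv, Finsupp.notMem_support_iff.1 hv]; ring
    have hsub : w'.support ⊆ w.support := fun v hv => by
      by_contra h
      exact Finsupp.mem_support_iff.1 hv (by rw [hw', if_neg h])
    have hss : w'.support ⊂ w.support := ⟨hsub, fun h => by
      have := Finsupp.mem_support_iff.1 (h hv₀)
      rw [hw', if_pos hv₀, sub_self] at this
      exact this rfl⟩
    have h0' : ∀ v, 0 ≤ w' v := fun v => by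
      rw [hw']; split_ifs with h
      exacts [sub_nonneg.2 (hmin v h), le_rfl]
    have hface : w' = 0 ∨ w'.support ∈ K.faces := by
      by_cases h : w' = 0
      · exact Or.inl h
      · exact Or.inr (K.down_closed hw hsub (Finsupp.support_nonempty_iff.2 h))
    obtain ⟨t, ht0, htC, htsub, htw⟩ := ih _ (hn ▸ Finset.card_lt_card hss) w' h0' hface rfl
    let σ₀ : K.faces := ⟨w.support, hw⟩
    have htσ₀ : t σ₀ = 0 := by
      by_contra h
      exact hss.2 (htsub σ₀ h)
    refine ⟨t + Pi.single σ₀ (w v₀), fun σ => ?_, ?_, fun σ hσ => ?_, ?_⟩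
    · have : 0 ≤ (Pi.single σ₀ (w v₀) : K.faces → ℝ) σ := by
        by_cases h : σ = σ₀
        · subst h; simpa using hm.le
        · simp [h]
      exact add_nonneg (ht0 σ) this
    · refine (htC.insert (a := σ₀) fun τ hτ _ => Or.inr ((htsub τ hτ).trans hsub)).mono ?_
      intro σ hσ
      by_cases h : σ = σ₀
      · exact Or.inl h
      · right
        simpa [h] using hσ
    · by_cases h : σ = σ₀
      · subst h; exact subset_rfl
      · exact (htsub σ (by simpa [h] using hσ)).trans hsub
    · have hlin : faceWeights (t + Pi.single σ₀ (w v₀)) =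
          faceWeights t + w v₀ • ∑ v ∈ w.support, Finsupp.single v (1 : ℝ) := by
        simp only [faceWeights, Pi.add_apply, add_smul, Finset.sum_add_distrib]
        congr 1
        rw [Finset.sum_eq_single_of_mem σ₀ (Finset.mem_univ _)]
        · rw [Pi.single_eq_same]
        · intro σ _ h; rw [Pi.single_eq_of_ne h, zero_smul]
      rw [hlin, htw]
      simp [w']

lemma exists_faceSum_eq {x : E} (hx : x ∈ K.space) :
    ∃ t ∈ chainWeights (fun σ : K.faces => σ.1), faceSum t = x := by
  have hb := K.isBary_bary hx
  obtain ⟨t, h0, hC, -, ht⟩ := exists_layers (K.bary x) hb.nonneg (Or.inr (K.carrier_mem hx))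
  exact ⟨t, ⟨h0, by rw [← totalWeight_faceWeights, ht, hb.total], hC⟩, by
    rw [← weightedPoint_faceWeights, ht, hb.point]⟩

open Classical in
/-- The coordinates of a point with respect to the barycentric subdivision. -/
noncomputable def layers (K : SimplicialComplex ℝ E) [Fintype K.faces] (x : E) : K.faces → ℝ :=
  if hx : x ∈ K.space then (exists_faceSum_eq hx).choose else 0

lemma layers_mem {x : E} (hx : x ∈ K.space) :
    K.layers x ∈ chainWeights (fun σ : K.faces => σ.1) := by
  rw [layers, dif_pos hx]; exact (exists_faceSum_eq hx).choose_spec.1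

lemma faceSum_layers {x : E} (hx : x ∈ K.space) : faceSum (K.layers x) = x := by
  rw [layers, dif_pos hx]; exact (exists_faceSum_eq hx).choose_spec.2

lemma layers_faceSum {t : K.faces → ℝ} (ht : t ∈ chainWeights fun σ : K.faces => σ.1) :
    K.layers (faceSum t) = t :=
  faceSum_injOn (layers_mem (faceSum_mem_space ht)) ht (faceSum_layers (faceSum_mem_space ht))

lemma layers_carrier {x : E} (hx : x ∈ K.space) :
    (∀ σ, K.layers x σ ≠ 0 → σ.1 ⊆ K.carrier x) ∧
      K.layers x ⟨K.carrier x, K.carrier_mem hx⟩ ≠ 0 := by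
  obtain ⟨σ, h1, h2, h3⟩ := exists_carrier_faceSum (layers_mem hx)
  rw [faceSum_layers hx] at h3
  refine ⟨fun τ hτ => h3 ▸ h2 τ hτ, ?_⟩
  convert h1

end Layers

section Topology

variable {E : Type*} [NormedAddCommGroup E] [NormedSpace ℝ E] {K : SimplicialComplex ℝ E}

lemma isCompact_space (hK : K.faces.Finite) : IsCompact K.space :=
  hK.isCompact_biUnion fun s _ => s.finite_toSet.isCompact_convexHull ℝ

variable [Fintype K.faces]

/-- The layers invert a continuous bijection from a compact space to a Hausdorff space. -/
lemma continuous_layers : Continuous fun x : K.space => K.layers x := by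
  have hne : ∀ σ : K.faces, σ.1.Nonempty := fun σ => K.nonempty_of_mem_faces σ.2
  have : CompactSpace (chainWeights fun σ : K.faces => σ.1) :=
    isCompact_iff_compactSpace.1 (isCompact_chainWeights hne)
  let e : chainWeights (fun σ : K.faces => σ.1) ≃ K.space :=
    { toFun t := ⟨faceSum t.1, faceSum_mem_space t.2⟩
      invFun x := ⟨K.layers x, layers_mem x.2⟩
      left_inv t := Subtype.ext (layers_faceSum t.2)
      right_inv x := Subtype.ext (faceSum_layers x.2) }
  have he : Continuous e := by
    refine Continuous.subtype_mk ?_ _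
    exact continuous_finsetSum _ fun σ _ =>
      ((continuous_apply σ).comp continuous_subtype_val).smul continuous_const
  exact continuous_subtype_val.comp (he.homeoOfEquivCompactToT2 (f := e)).symm.continuous

/-- Being in the open star of a face is an open condition. -/
lemma isOpen_star {σ : Finset E} : IsOpen {x : K.space | σ ⊆ K.carrier x} := by
  have hK : K.faces.Finite := Set.toFinite _
  rw [← isClosed_compl_iff]
  have : {x : K.space | σ ⊆ K.carrier x}ᶜ =
      Subtype.val ⁻¹' ⋃ s ∈ {s ∈ K.faces | ¬ σ ⊆ s}, convexHull ℝ (s : Set E) := by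
    ext x
    simp only [mem_compl_iff, Set.mem_ofPred_eq, mem_preimage, mem_iUnion, exists_prop]
    constructor
    · intro h
      exact ⟨_, ⟨K.carrier_mem x.2, h⟩, mem_convexHull_carrier x.2⟩
    · rintro ⟨s, ⟨hs, hσ⟩, hx⟩ h
      exact hσ (h.trans ((mem_convexHull_iff_carrier_subset x.2 hs).1 hx))
  rw [this]
  exact ((hK.subset (Set.sep_subset _ _)).isCompact_biUnion fun s _ =>
    s.finite_toSet.isCompact_convexHull ℝ).isClosed.preimage continuous_subtype_val

end Topology

end Geometry.SimplicialComplex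

/-! ### Sheets over open stars. -/

namespace Geometry.SimplicialComplex

section Stars

variable {E : Type*} [NormedAddCommGroup E] [NormedSpace ℝ E]
  {K : SimplicialComplex ℝ E} {V : Set K.space} {D : Set (Finset E)}
  {Y₁ : Type*} {f₁ : Y₁ → ↥(Vᶜ)}

/-- A map to the complement of `V`, regarded as a map to the ambient space. -/
def basePoint (f₁ : Y₁ → ↥(Vᶜ)) (y : Y₁) : E := ((f₁ y : K.space) : E)

/-- The part of the domain lying over the open star of a simplex. -/
def overStar (f₁ : Y₁ → ↥(Vᶜ)) (σ : Finset E) : Set Y₁ := {y | σ ⊆ K.carrier (basePoint f₁ y)}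

lemma basePoint_mem (y : Y₁) : basePoint f₁ y ∈ K.space := (f₁ y : K.space).2

lemma eq_of_basePoint_eq {y y' : Y₁} (h : basePoint f₁ y = basePoint f₁ y') : f₁ y = f₁ y' :=
  Subtype.ext (Subtype.ext h)

lemma carrier_basePoint_mem (y : Y₁) : K.carrier (basePoint f₁ y) ∈ K.faces :=
  K.carrier_mem (basePoint_mem y)

lemma carrier_basePoint_notMem (hD : ∀ x : K.space, x ∈ V ↔ K.carrier x ∈ D) (y : Y₁) :
    K.carrier (basePoint f₁ y) ∉ D := fun h => (f₁ y).2 ((hD _).2 h)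

lemma overStar_anti {σ τ : Finset E} (h : σ ⊆ τ) : overStar f₁ τ ⊆ overStar f₁ σ :=
  fun _ hy => h.trans hy

variable [TopologicalSpace Y₁]

/-- The component of the part over an open star which contains a given point. -/
def sheet (f₁ : Y₁ → ↥(Vᶜ)) (σ : Finset E) (y : Y₁) : Set Y₁ :=
  connectedComponentIn (overStar f₁ σ) y

lemma continuous_basePoint (cov : IsCoveringMap f₁) : Continuous (basePoint f₁) :=
  continuous_subtype_val.comp (continuous_subtype_val.comp cov.continuous)

lemma mem_sheet {σ : Finset E} {y : Y₁} (hy : y ∈ overStar f₁ σ) : y ∈ sheet f₁ σ y :=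
  mem_connectedComponentIn hy

lemma sheet_subset (σ : Finset E) (y : Y₁) : sheet f₁ σ y ⊆ overStar f₁ σ :=
  connectedComponentIn_subset _ _

lemma sheet_eq {σ : Finset E} {y y' : Y₁} (h : y' ∈ sheet f₁ σ y) :
    sheet f₁ σ y = sheet f₁ σ y' := connectedComponentIn_eq h

lemma sheet_anti {σ τ : Finset E} (h : σ ⊆ τ) (y : Y₁) : sheet f₁ τ y ⊆ sheet f₁ σ y :=
  connectedComponentIn_mono y (overStar_anti h)

lemma isOpen_overStar [Fintype K.faces] (cov : IsCoveringMap f₁) (σ : Finset E) :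
    IsOpen (overStar f₁ σ) :=
  (isOpen_star (K := K) (σ := σ)).preimage (continuous_subtype_val.comp cov.continuous)

/-- Pushing the part over the open star of the carrier of `p` towards `p`. -/
lemma exists_contraction (hD : ∀ x : K.space, x ∈ V ↔ K.carrier x ∈ D) (cov : IsCoveringMap f₁)
    {p : E} (hp : p ∈ K.space) {σ : Finset E} (hpσ : K.carrier p = σ) {s : ℝ} (hs0 : 0 ≤ s)
    (hs1 : s ≤ 1) (h : 0 < s ∨ σ ∉ D) :
    ∃ H : C(unitInterval × overStar f₁ σ, Y₁), (∀ y, H (0, y) = y) ∧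
      (∀ u y, basePoint f₁ (H (u, y)) =
        ((u : ℝ) * (1 - s)) • p + (1 - (u : ℝ) * (1 - s)) • basePoint f₁ y.1) ∧
      ∀ (u : unitInterval) (y : overStar f₁ σ), H (u, y) ∈ sheet f₁ σ y.1 := by
  subst hpσ
  -- While the coefficient of the base point is positive, its carrier does not change and `V` is
  -- avoided. The coefficient can vanish only for `s = 0`, when the track ends at `p`, which is then
  -- outside `V`.
  have key : ∀ (u : unitInterval) (y : overStar f₁ (K.carrier p)),
      ∃ hm : ((u : ℝ) * (1 - s)) • p + (1 - (u : ℝ) * (1 - s)) • basePoint f₁ y ∈ K.space,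
        (⟨_, hm⟩ : K.space) ∈ Vᶜ ∧ K.carrier p ⊆
          K.carrier (((u : ℝ) * (1 - s)) • p + (1 - (u : ℝ) * (1 - s)) • basePoint f₁ y) := by
    intro u y
    have hu0 := u.2.1
    have hu1 := u.2.2
    have hr : 0 ≤ (u : ℝ) * (1 - s) := mul_nonneg hu0 (by linarith)
    have hr' : s ≤ 1 - (u : ℝ) * (1 - s) := by nlinarith
    rcases (hs0.trans hr').eq_or_lt with h0 | h0
    · have hsD : K.carrier p ∉ D := by
        rcases h with h | h
        · linarith
        · exact h
      have e : ((u : ℝ) * (1 - s)) • p + (1 - (u : ℝ) * (1 - s)) • basePoint f₁ y = p := by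
        rw [← h0, (by linarith : (u : ℝ) * (1 - s) = 1)]; simp
      refine ⟨e.symm ▸ hp, fun hV => hsD ?_, by rw [e]⟩
      have := (hD _).1 hV
      simpa only [e] using this
    · obtain ⟨h1, h2⟩ := carrier_combo hp (basePoint_mem y.1) y.2 hr h0 (by ring)
      exact ⟨h1, fun hV => carrier_basePoint_notMem hD y.1 (h2 ▸ (hD _).1 hV), h2 ▸ y.2⟩
  choose hm hV hsub using key
  let B : C(unitInterval × overStar f₁ (K.carrier p), ↥(Vᶜ)) :=
    ⟨fun q => ⟨⟨_, hm q.1 q.2⟩, hV q.1 q.2⟩, by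
      have := continuous_basePoint cov
      exact Continuous.subtype_mk (Continuous.subtype_mk (by fun_prop) _) _⟩
  have hB0 : ∀ y, B (0, y) = f₁ ((⟨Subtype.val, continuous_subtype_val⟩ :
      C(overStar f₁ (K.carrier p), Y₁)) y) := fun y => by
    apply Subtype.ext; apply Subtype.ext
    simp [B, basePoint]
  let H := cov.liftHomotopy B ⟨Subtype.val, continuous_subtype_val⟩ hB0
  have hH : ∀ u y, f₁ (H (u, y)) = B (u, y) := fun u y =>
    congrFun (cov.liftHomotopy_lifts B ⟨Subtype.val, continuous_subtype_val⟩ hB0) (u, y)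
  have hb : ∀ u y, basePoint f₁ (H (u, y)) =
        ((u : ℝ) * (1 - s)) • p + (1 - (u : ℝ) * (1 - s)) • basePoint f₁ y := fun u y => by
    rw [basePoint, hH]; rfl
  have h0 : ∀ y, H (0, y) = y := fun y =>
    cov.liftHomotopy_zero B ⟨Subtype.val, continuous_subtype_val⟩ hB0 y
  refine ⟨H, h0, hb, fun u y => ?_⟩
  have hc : Continuous fun u : unitInterval => H (u, y) := by fun_prop
  have hpre := isPreconnected_range hc
  refine hpre.subset_connectedComponentIn ⟨0, h0 y⟩ ?_ ⟨u, rfl⟩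
  rintro _ ⟨v, rfl⟩
  change K.carrier p ⊆ K.carrier (basePoint f₁ (H (v, y)))
  rw [hb]
  exact hsub v y

/-- The map is injective on sheets over open stars of simplices outside `V`. -/
lemma sheet_injOn (hD : ∀ x : K.space, x ∈ V ↔ K.carrier x ∈ D) (cov : IsCoveringMap f₁)
    {σ : Finset E} (hσ : σ ∈ K.faces) (hσD : σ ∉ D) {y y' : Y₁} (hy : y ∈ overStar f₁ σ)
    (hy' : y' ∈ sheet f₁ σ y) (heq : basePoint f₁ y = basePoint f₁ y') : y = y' := by
  obtain ⟨hp, hpc⟩ := barycenter_mem hσ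
  obtain ⟨H, h0, hb, hs⟩ := exists_contraction hD cov hp hpc le_rfl zero_le_one (Or.inr hσD)
  have hy'' : y' ∈ overStar f₁ σ := sheet_subset _ _ hy'
  have hR : H (1, ⟨y, hy⟩) = H (1, ⟨y', hy''⟩) := by
    -- At time 1 the connected sheet goes into a single fibre, so its image is one point.
    refine cov.constOn_of_comp (s := connectedComponent (⟨y, hy⟩ : overStar f₁ σ))
      (g := fun z => H (1, z)) isPreconnected_connectedComponent
      (by fun_prop : Continuous fun z => H (1, z)).continuousOn ?_ ?_ ?_
    · intro a _ b _
      apply eq_of_basePoint_eq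
      rw [hb, hb]; simp
    · exact mem_connectedComponent
    · rw [sheet, connectedComponentIn_eq_image hy] at hy'
      obtain ⟨z, hz, hzy⟩ := hy'
      convert hz
      exact hzy.symm
  -- The tracks of `y` and `y'` lift the same path and agree at time 1, hence also at time 0.
  have := cov.eq_of_comp_eq (g₁ := fun u : unitInterval => H (u, ⟨y, hy⟩))
    (g₂ := fun u : unitInterval => H (u, ⟨y', hy''⟩)) (by fun_prop) (by fun_prop) (by
      ext1 u
      change f₁ (H (u, ⟨y, hy⟩)) = f₁ (H (u, ⟨y', hy''⟩))
      apply eq_of_basePoint_eq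
      rw [hb, hb]
      simp only [heq]) 1 hR
  have := congrFun this 0
  simpa only [h0] using this

/-- Sheets over open stars of simplices outside `V` map onto the open star. -/
lemma exists_mem_sheet (hD : ∀ x : K.space, x ∈ V ↔ K.carrier x ∈ D) (cov : IsCoveringMap f₁)
    {σ : Finset E} (hσ : σ ∈ K.faces) (hσD : σ ∉ D)
    (hdown : ∀ s ∈ K.faces, ∀ t ∈ D, s ⊆ t → s ∈ D) {y : Y₁} (hy : y ∈ overStar f₁ σ)
    {x : E} (hx : x ∈ K.space) (hxσ : σ ⊆ K.carrier x) :
    ∃ y' ∈ sheet f₁ σ y, basePoint f₁ y' = x := by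
  obtain ⟨hp, hpc⟩ := barycenter_mem hσ
  obtain ⟨H, h0, hb, hs⟩ := exists_contraction hD cov hp hpc le_rfl zero_le_one (Or.inr hσD)
  have key : ∀ u : unitInterval, ∃ hm : (1 - (u : ℝ)) • σ.barycenter + (u : ℝ) • x ∈ K.space,
      (⟨_, hm⟩ : K.space) ∈ Vᶜ ∧
        σ ⊆ K.carrier ((1 - (u : ℝ)) • σ.barycenter + (u : ℝ) • x) := by
    intro u
    have : ∃ hm : (1 - (u : ℝ)) • σ.barycenter + (u : ℝ) • x ∈ K.space,
        σ ⊆ K.carrier ((1 - (u : ℝ)) • σ.barycenter + (u : ℝ) • x) := by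
      rcases u.2.1.eq_or_lt with hu | hu
      · have e : (1 - (u : ℝ)) • σ.barycenter + (u : ℝ) • x = σ.barycenter := by
          rw [← hu]; simp
        rw [e]
        exact ⟨hp, hpc.ge⟩
      · obtain ⟨h1, h2⟩ := carrier_combo hp hx (hpc.symm ▸ hxσ)
          (by linarith [u.2.2] : 0 ≤ 1 - (u : ℝ)) hu (by ring)
        exact ⟨h1, h2 ▸ hxσ⟩
    obtain ⟨h1, h2⟩ := this
    exact ⟨h1, fun hV => hσD (hdown σ hσ _ ((hD _).1 hV) h2), h2⟩
  choose hm hV hsub using key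
  let γ : C(unitInterval, ↥(Vᶜ)) := ⟨fun u => ⟨⟨_, hm u⟩, hV u⟩,
    Continuous.subtype_mk (Continuous.subtype_mk (by fun_prop) _) _⟩
  have hγ0 : γ 0 = f₁ (H (1, ⟨y, hy⟩)) := by
    apply Subtype.ext; apply Subtype.ext
    have := hb 1 ⟨y, hy⟩
    simp only [basePoint] at this
    rw [this]; simp [γ]
  -- The point `y` has been contracted to the barycenter inside its sheet; lifting the segment from
  -- there to `x` leads on to a point over `x`.
  obtain ⟨Γ, hΓ, hΓ0⟩ := cov.exists_path_lifts γ _ hγ0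
  have hbΓ : ∀ u, basePoint f₁ (Γ u) = (1 - (u : ℝ)) • σ.barycenter + (u : ℝ) • x := fun u => by
    have := congrFun hΓ u
    simp only [Function.comp_apply] at this
    rw [basePoint, this]; rfl
  refine ⟨Γ 1, ?_, by rw [hbΓ]; simp⟩
  rw [sheet_eq (hs 1 ⟨y, hy⟩)]
  refine (isPreconnected_range Γ.continuous).subset_connectedComponentIn ⟨0, hΓ0⟩ ?_ ⟨1, rfl⟩
  rintro _ ⟨u, rfl⟩
  change σ ⊆ K.carrier (basePoint f₁ (Γ u))
  rw [hbΓ]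
  exact hsub u

variable [Fintype K.faces]

/-- Contraction gives a continuous map to the discrete fibre over the barycenter. Its fibres are
open, and each lies in one sheet, because every point stays in its sheet during the contraction. -/
lemma sheet_mem_nhds_of_notMem (hD : ∀ x : K.space, x ∈ V ↔ K.carrier x ∈ D)
    (cov : IsCoveringMap f₁) {σ : Finset E} (hσ : σ ∈ K.faces) (hσD : σ ∉ D) {y : Y₁}
    (hy : y ∈ overStar f₁ σ) : sheet f₁ σ y ∈ nhds y := by
  obtain ⟨hp, hpc⟩ := barycenter_mem hσ
  obtain ⟨H, h0, hb, hs⟩ := exists_contraction hD cov hp hpc le_rfl zero_le_one (Or.inr hσD)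
  have hpV : (⟨σ.barycenter, hp⟩ : K.space) ∈ Vᶜ := fun h => hσD (hpc ▸ (hD _).1 h)
  have := (cov ⟨_, hpV⟩).1
  let g : overStar f₁ σ → f₁ ⁻¹' {⟨_, hpV⟩} := fun z => ⟨H (1, z), by
    rw [mem_preimage, mem_singleton_iff]
    apply Subtype.ext; apply Subtype.ext
    have := hb 1 z
    simp only [basePoint] at this
    rw [this]; simp⟩
  have hg : Continuous g := Continuous.subtype_mk (by fun_prop) _
  have hO : IsOpen (Subtype.val '' (g ⁻¹' {g ⟨y, hy⟩})) :=
    (isOpen_overStar cov σ).isOpenMap_subtype_val _ ((isOpen_discrete _).preimage hg)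
  refine Filter.mem_of_superset (hO.mem_nhds ⟨⟨y, hy⟩, rfl, rfl⟩) ?_
  rintro _ ⟨z, hz, rfl⟩
  have hz' : H (1, z) = H (1, ⟨y, hy⟩) := congrArg Subtype.val hz
  rw [sheet_eq (hs 1 ⟨y, hy⟩), ← hz', ← sheet_eq (hs 1 z)]
  exact mem_sheet z.2

/-- Also when σ lies in `V`, each point of the sheet has a carrier outside `V`, and the sheet over
the star of that carrier is a smaller neighbourhood. -/
lemma isOpen_sheet (hD : ∀ x : K.space, x ∈ V ↔ K.carrier x ∈ D) (cov : IsCoveringMap f₁)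
    (σ : Finset E) (y : Y₁) : IsOpen (sheet f₁ σ y) := by
  rw [isOpen_iff_mem_nhds]
  intro z hz
  rw [sheet_eq hz]
  have h := sheet_mem_nhds_of_notMem hD cov (carrier_basePoint_mem z)
    (carrier_basePoint_notMem hD z) (y := z) (Finset.Subset.refl _)
  exact Filter.mem_of_superset h (sheet_anti (sheet_subset _ _ hz) z)

/-- Each sheet contains a point over the barycenter of some simplex, namely of the carrier of any of
its points. Finite fibres leave only finitely many such points. -/
lemma finite_sheets (hD : ∀ x : K.space, x ∈ V ↔ K.carrier x ∈ D) (cov : IsCoveringMap f₁)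
    (hdown : ∀ s ∈ K.faces, ∀ t ∈ D, s ⊆ t → s ∈ D) (hfin : ∀ x, (f₁ ⁻¹' {x}).Finite)
    (σ : Finset E) : {c | ∃ y ∈ overStar f₁ σ, c = sheet f₁ σ y}.Finite := by
  have h1 : ∀ b : E, {y | basePoint f₁ y = b}.Finite := by
    intro b
    rcases {y | basePoint f₁ y = b}.eq_empty_or_nonempty with h | ⟨y, hy⟩
    · rw [h]; exact Set.finite_empty
    · refine (hfin (f₁ y)).subset fun z hz => eq_of_basePoint_eq ?_
      exact Eq.trans hz (Eq.symm hy)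
  have h2 : (⋃ τ ∈ K.faces, {y | basePoint f₁ y = τ.barycenter}).Finite :=
    (Set.toFinite K.faces).biUnion fun τ _ => h1 _
  refine (h2.image (sheet f₁ σ)).subset ?_
  rintro _ ⟨y, hy, rfl⟩
  have hτ := carrier_basePoint_mem (f₁ := f₁) y
  obtain ⟨hb, hbc⟩ := barycenter_mem hτ
  obtain ⟨z, hz, hzb⟩ := exists_mem_sheet hD cov hτ (carrier_basePoint_notMem hD y) hdown
    (y := y) (Finset.Subset.refl _) hb hbc.ge
  refine ⟨z, Set.mem_biUnion hτ hzb, ?_⟩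
  exact (sheet_eq (sheet_anti hy y hz)).symm

/-- The part of a sheet over the open star of the carrier of `p` that lies over a small ball
around `p` is connected. -/
lemma isPreconnected_sheet_inter (hD : ∀ x : K.space, x ∈ V ↔ K.carrier x ∈ D)
    (cov : IsCoveringMap f₁) {p : E} (hp : p ∈ K.space) (y : Y₁) {ε : ℝ} (hε : 0 < ε) :
    IsPreconnected (sheet f₁ (K.carrier p) y ∩ {z | dist (basePoint f₁ z) p < ε}) := by
  obtain ⟨M, hM⟩ := (isCompact_space (Set.toFinite K.faces)).isBounded.subset_closedBall p
  have hM' : ∀ x ∈ K.space, dist x p ≤ |M| := fun x hx => (hM hx).trans (le_abs_self M)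
  have hpos : 0 < ε + |M| := by positivity
  -- Shrinking by this factor brings the whole space into the ε-ball around `p`, yet stops before
  -- `p`, which may lie in `V`.
  obtain ⟨s, hs⟩ : ∃ s, s = ε / (ε + |M|) := ⟨_, rfl⟩
  have hs0 : 0 < s := hs ▸ div_pos hε hpos
  have hs1 : s ≤ 1 := by rw [hs, div_le_one hpos]; linarith [abs_nonneg M]
  have hsM : s * |M| < ε := by
    rw [hs, div_mul_eq_mul_div, div_lt_iff₀ hpos]
    nlinarith [abs_nonneg M]
  obtain ⟨H, h0, hb, hsh⟩ := exists_contraction hD cov hp rfl hs0.le hs1 (Or.inl hs0)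
  have hdist : ∀ u z, dist (basePoint f₁ (H (u, z))) p =
      (1 - (u : ℝ) * (1 - s)) * dist (basePoint f₁ z) p := by
    intro u z
    have hu0 := u.2.1
    have hu1 := u.2.2
    have hr' : 0 ≤ 1 - (u : ℝ) * (1 - s) := by nlinarith
    rw [hb, dist_eq_norm, dist_eq_norm, ← Real.norm_of_nonneg hr', ← norm_smul,
      Real.norm_of_nonneg hr']
    congr 1
    module
  have hsheet : ∀ u (z : overStar f₁ (K.carrier p)), z.1 ∈ sheet f₁ (K.carrier p) y →
      H (u, z) ∈ sheet f₁ (K.carrier p) y := fun u z hz => by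
    rw [sheet_eq hz]; exact hsh u z
  have hpush : ∀ z : overStar f₁ (K.carrier p), dist (basePoint f₁ (H (1, z))) p < ε := by
    intro z
    rw [hdist]
    have h1 := hM' _ (basePoint_mem (f₁ := f₁) z.1)
    have : (1 - ((1 : unitInterval) : ℝ) * (1 - s)) = s := by simp
    rw [this]
    nlinarith
  -- The shrunken sheet is a connected core inside the ball; the track of any other point in the
  -- ball joins it to this core.
  have hcore : IsPreconnected ((fun z => H (1, z)) ''
      {z : overStar f₁ (K.carrier p) | z.1 ∈ sheet f₁ (K.carrier p) y}) := by
    refine IsPreconnected.image ?_ _ (by fun_prop : Continuous fun z => H (1, z)).continuousOn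
    by_cases hy : y ∈ overStar f₁ (K.carrier p)
    · convert isPreconnected_connectedComponent (x := (⟨y, hy⟩ : overStar f₁ (K.carrier p)))
      ext z
      rw [Set.mem_ofPred_eq, sheet, connectedComponentIn_eq_image hy]
      simp
    · convert isPreconnected_empty
      ext z
      simp [sheet, connectedComponentIn_eq_empty hy]
  rcases (sheet f₁ (K.carrier p) y ∩ {z | dist (basePoint f₁ z) p < ε}).eq_empty_or_nonempty with
    he | ⟨z₀, hz₀, hz₀'⟩
  · rw [he]; exact isPreconnected_empty
  have hpath : ∀ z : overStar f₁ (K.carrier p), z.1 ∈ sheet f₁ (K.carrier p) y →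
      dist (basePoint f₁ z.1) p < ε → range (fun u => H (u, z)) ⊆
        sheet f₁ (K.carrier p) y ∩ {z | dist (basePoint f₁ z) p < ε} := by
    rintro z hz hzε _ ⟨u, rfl⟩
    refine ⟨hsheet u z hz, ?_⟩
    rw [Set.mem_ofPred_eq, hdist]
    have hu0 := u.2.1
    have hu1 := u.2.2
    have : (1 - (u : ℝ) * (1 - s)) ≤ 1 := by nlinarith
    have : 0 ≤ (1 - (u : ℝ) * (1 - s)) := by nlinarith
    nlinarith [dist_nonneg (x := basePoint f₁ z.1) (y := p)]
  have hpc : ∀ z : overStar f₁ (K.carrier p), IsPreconnected (range fun u => H (u, z)) := fun z =>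
    isPreconnected_range (by fun_prop)
  refine isPreconnected_of_forall z₀ fun z hz => ?_
  have hzo := sheet_subset _ _ hz.1
  have hzo₀ := sheet_subset _ _ hz₀
  refine ⟨(range fun u => H (u, ⟨z₀, hzo₀⟩)) ∪ ((fun z => H (1, z)) ''
      {z : overStar f₁ (K.carrier p) | z.1 ∈ sheet f₁ (K.carrier p) y} ∪
        range fun u => H (u, ⟨z, hzo⟩)), ?_, Or.inl ⟨0, h0 _⟩, Or.inr (Or.inr ⟨0, h0 _⟩), ?_⟩
  · refine union_subset (hpath _ hz₀ hz₀') (union_subset ?_ (hpath _ hz.1 hz.2))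
    rintro _ ⟨w, hw, rfl⟩
    exact ⟨hsheet 1 w hw, hpush w⟩
  · refine IsPreconnected.union (H (1, ⟨z₀, hzo₀⟩)) ⟨1, rfl⟩ (Or.inl ⟨_, hz₀, rfl⟩) (hpc _) ?_
    exact IsPreconnected.union (H (1, ⟨z, hzo⟩)) ⟨_, hz.1, rfl⟩ ⟨1, rfl⟩ hcore (hpc _)

end Stars

end Geometry.SimplicialComplex

/-! ### The simplicial poset of the completed covering and its weights. -/

namespace Geometry.SimplicialComplex

section CoverSimplex

variable {E : Type*} [NormedAddCommGroup E] [NormedSpace ℝ E]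
  {K : SimplicialComplex ℝ E} {V : Set K.space} {D : Set (Finset E)}
  {Y₁ : Type*} [TopologicalSpace Y₁] {f₁ : Y₁ → ↥(Vᶜ)}

/-- The simplices of the completed covering: pairs of a simplex of the base and a sheet over its
open star. -/
def CoverSimplex (f₁ : Y₁ → ↥(Vᶜ)) : Type _ :=
  {q : Finset E × Set Y₁ // q.1 ∈ K.faces ∧ ∃ y ∈ overStar f₁ q.1, q.2 = sheet f₁ q.1 y}

namespace CoverSimplex

/-- The simplex of the base under a simplex of the completed covering. -/
def face (q : CoverSimplex f₁) : K.faces := ⟨q.1.1, q.2.1⟩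

/-- The vertex set of the underlying simplex of the base. -/
def label (q : CoverSimplex f₁) : Finset E := q.1.1

/-- The sheet of a simplex of the completed covering. -/
def star (q : CoverSimplex f₁) : Set Y₁ := q.1.2

lemma label_mem (q : CoverSimplex f₁) : q.label ∈ K.faces := q.2.1

lemma label_nonempty (q : CoverSimplex f₁) : q.label.Nonempty :=
  K.nonempty_of_mem_faces q.label_mem

lemma ext_label_star {q q' : CoverSimplex f₁} (h : q.label = q'.label) (h' : q.star = q'.star) :
    q = q' := Subtype.ext (Prod.ext h h')

/-- Larger simplices have smaller stars and hence smaller sheets, so the order on sheets is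
reversed. -/
instance : PartialOrder (CoverSimplex f₁) :=
  PartialOrder.lift (fun q => (q.label, OrderDual.toDual q.star)) fun _ _ h =>
    ext_label_star (congrArg Prod.fst h) (congrArg Prod.snd h)

lemma le_def {q q' : CoverSimplex f₁} : q ≤ q' ↔ q.label ⊆ q'.label ∧ q'.star ⊆ q.star := Iff.rfl

lemma star_eq {q : CoverSimplex f₁} {y : Y₁} (hy : y ∈ q.star) : q.star = sheet f₁ q.label y := by
  obtain ⟨-, z, -, hz⟩ := q.2
  change q.star = sheet f₁ q.label z at hz
  rw [hz] at hy ⊢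
  exact sheet_eq hy

lemma star_nonempty (q : CoverSimplex f₁) : q.star.Nonempty := by
  obtain ⟨-, z, hzo, hz⟩ := q.2
  change q.star = sheet f₁ q.label z at hz
  exact ⟨z, hz ▸ mem_sheet hzo⟩

lemma star_subset (q : CoverSimplex f₁) : q.star ⊆ overStar f₁ q.label := fun y hy => by
  rw [star_eq hy] at hy
  exact sheet_subset _ _ hy

lemma le_of_mem {q q' : CoverSimplex f₁} {y : Y₁} (h : y ∈ q.star) (h' : y ∈ q'.star)
    (hl : q.label ⊆ q'.label) : q ≤ q' := by
  refine ⟨hl, ?_⟩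
  change q'.star ⊆ q.star
  rw [star_eq h, star_eq h']
  exact sheet_anti hl y

lemma eq_of_mem {q q' : CoverSimplex f₁} {y : Y₁} (h : y ∈ q.star) (h' : y ∈ q'.star)
    (hl : q.label = q'.label) : q = q' :=
  le_antisymm (le_of_mem h h' hl.subset) (le_of_mem h' h hl.symm.subset)

lemma exists_label_eq {σ : Finset E} (hσ : σ ∈ K.faces) {y : Y₁} (hy : y ∈ overStar f₁ σ) :
    ∃ q : CoverSimplex f₁, q.label = σ ∧ y ∈ q.star :=
  ⟨⟨(σ, sheet f₁ σ y), hσ, y, hy, rfl⟩, rfl, mem_sheet hy⟩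

/-- A point of the sheet of `q` lies over the star of every face of the label, and there it selects
exactly one sheet. -/
lemma isSimplicialPoset : IsSimplicialPoset (label : CoverSimplex f₁ → Finset E) where
  nonempty := label_nonempty
  mono _ _ h := (le_def.1 h).1
  exists_le q σ hσ hsub := by
    obtain ⟨y, hy⟩ := q.star_nonempty
    obtain ⟨q', hq', hy'⟩ := exists_label_eq (f₁ := f₁) (K.down_closed q.label_mem hsub hσ)
      (hsub.trans (q.star_subset hy))
    exact ⟨q', le_of_mem hy' hy (hq' ▸ hsub), hq'⟩
  unique_le q p p' hp hp' hl := by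
    obtain ⟨y, hy⟩ := q.star_nonempty
    exact eq_of_mem ((le_def.1 hp).2 hy) ((le_def.1 hp').2 hy) hl

lemma finite [Fintype K.faces] (hD : ∀ x : K.space, x ∈ V ↔ K.carrier x ∈ D)
    (cov : IsCoveringMap f₁) (hdown : ∀ s ∈ K.faces, ∀ t ∈ D, s ⊆ t → s ∈ D)
    (hfin : ∀ x, (f₁ ⁻¹' {x}).Finite) : Finite (CoverSimplex f₁) := by
  have h : ({q : Finset E × Set Y₁ | q.1 ∈ K.faces ∧
      ∃ y ∈ overStar f₁ q.1, q.2 = sheet f₁ q.1 y}).Finite := by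
    refine Set.Finite.subset ((Set.toFinite K.faces).biUnion fun σ _ =>
      (finite_sheets hD cov hdown hfin σ).image (Prod.mk σ)) ?_
    rintro ⟨σ, c⟩ ⟨h1, h2⟩
    exact Set.mem_biUnion h1 ⟨c, h2, rfl⟩
  exact h.to_subtype

section Combinatorics

variable (hD : ∀ x : K.space, x ∈ V ↔ K.carrier x ∈ D) (cov : IsCoveringMap f₁)
  (hdown : ∀ s ∈ K.faces, ∀ t ∈ D, s ⊆ t → s ∈ D)

include hD cov hdown

lemma exists_mem_star (q : CoverSimplex f₁) (hq : q.label ∉ D) {x : E} (hx : x ∈ K.space)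
    (hxq : q.label ⊆ K.carrier x) : ∃ y ∈ q.star, basePoint f₁ y = x := by
  obtain ⟨y, hy⟩ := q.star_nonempty
  rw [star_eq hy]
  exact exists_mem_sheet hD cov q.label_mem hq hdown (q.star_subset hy) hx hxq

omit hdown in
lemma star_injOn (q : CoverSimplex f₁) (hq : q.label ∉ D) : InjOn (basePoint f₁) q.star := by
  intro y hy y' hy' h
  rw [star_eq hy] at hy'
  exact sheet_injOn hD cov q.label_mem hq (q.star_subset hy) hy' h

/-- The label of `q` may lie in `V`, but the carrier of a point of its sheet does not. The sheet
over that carrier maps onto the open star and so reaches the barycenter of a top simplex. -/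
lemma exists_le_card {n : ℕ} (hpure : K.IsPure n) (q : CoverSimplex f₁) :
    ∃ q' : CoverSimplex f₁, q ≤ q' ∧ q'.label.card = n + 1 := by
  obtain ⟨y, hy⟩ := q.star_nonempty
  have hc := carrier_basePoint_mem (f₁ := f₁) y
  obtain ⟨p, hp, hyp⟩ := exists_label_eq (f₁ := f₁) hc (y := y) (Finset.Subset.refl _)
  have hqp : q ≤ p := le_of_mem hy hyp (hp ▸ q.star_subset hy)
  obtain ⟨t, ht, hsub, hcard⟩ := hpure _ hc
  obtain ⟨hb, hbc⟩ := barycenter_mem ht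
  obtain ⟨z, hz, hzb⟩ := exists_mem_star hD cov hdown p
    (hp ▸ carrier_basePoint_notMem hD y) hb (by rw [hp, hbc]; exact hsub)
  obtain ⟨r, hr, hzr⟩ := exists_label_eq (f₁ := f₁) ht (y := z)
    (show t ⊆ K.carrier (basePoint f₁ z) by rw [hzb, hbc])
  exact ⟨r, hqp.trans (le_of_mem hz hzr (by rw [hp, hr]; exact hsub)), hr ▸ hcard⟩

/-- By codimension the label is not in `V`, so the sheet maps bijectively onto the open star, and
the top simplices above `q` correspond to those above its label. -/
lemma ncard_le_card {n : ℕ} (hnb : K.IsNonbranching n)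
    (hdim : ∀ s ∈ K.faces, s ∈ D → s.card < n) (q : CoverSimplex f₁) (hq : q.label.card = n) :
    {q' : CoverSimplex f₁ | q ≤ q' ∧ q'.label.card = n + 1}.ncard = 2 := by
  have hqD : q.label ∉ D := fun h => (hdim _ q.label_mem h).ne hq
  rw [← hnb _ q.label_mem hq]
  have hinj : InjOn label {q' : CoverSimplex f₁ | q ≤ q' ∧ q'.label.card = n + 1} := by
    rintro p ⟨hp, hpc⟩ p' ⟨hp', hpc'⟩ heq
    have hpD : p.label ∉ D := fun h => by have := hdim _ p.label_mem h; omega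
    obtain ⟨hb, hbc⟩ := barycenter_mem p.label_mem
    obtain ⟨z, hz, hzb⟩ := exists_mem_star hD cov hdown p hpD hb hbc.ge
    obtain ⟨z', hz', hzb'⟩ := exists_mem_star hD cov hdown p' (heq ▸ hpD) hb
      (by rw [hbc, heq])
    have : z = z' := star_injOn hD cov q hqD (hp.2 hz) (hp'.2 hz') (hzb.trans hzb'.symm)
    exact eq_of_mem hz (this ▸ hz') heq
  rw [← hinj.ncard_image]
  congr 1
  ext t
  constructor
  · rintro ⟨p, ⟨hp, hpc⟩, rfl⟩
    exact ⟨p.label_mem, hp.1, hpc⟩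
  · rintro ⟨ht, hsub, hcard⟩
    obtain ⟨hb, hbc⟩ := barycenter_mem ht
    obtain ⟨z, hz, hzb⟩ := exists_mem_star hD cov hdown q hqD hb (by rw [hbc]; exact hsub)
    obtain ⟨r, hr, hzr⟩ := exists_label_eq (f₁ := f₁) ht (y := z)
      (show t ⊆ K.carrier (basePoint f₁ z) by rw [hzb, hbc])
    exact ⟨r, ⟨le_of_mem hz hzr (hr ▸ hsub), hr ▸ hcard⟩, hr⟩

end Combinatorics

section Weights

set_option linter.unusedSectionVars false

variable [Fintype K.faces] [Fintype (CoverSimplex f₁)]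

open Classical in
/-- The weights on the base obtained by adding up weights on the completed covering. -/
noncomputable def push (w : CoverSimplex f₁ → ℝ) (σ : K.faces) : ℝ :=
  ∑ q, if q.face = σ then w q else 0

/-- The point of the base given by weights on the completed covering. -/
noncomputable def coverSum (w : CoverSimplex f₁ → ℝ) : E := ∑ q, w q • ∑ v ∈ q.label, v

lemma faceSum_push (w : CoverSimplex f₁ → ℝ) : faceSum (push w) = coverSum w := by
  simp only [faceSum, push, coverSum, Finset.sum_smul, ite_smul, zero_smul]
  rw [Finset.sum_comm]
  classical
  refine Finset.sum_congr rfl fun q _ => ?_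
  rw [Finset.sum_ite_eq, if_pos (Finset.mem_univ _)]
  rfl

lemma sum_push (w : CoverSimplex f₁ → ℝ) :
    ∑ σ : K.faces, (σ.1.card : ℝ) * push w σ = ∑ q, (q.label.card : ℝ) * w q := by
  simp only [push, Finset.mul_sum, mul_ite, mul_zero]
  rw [Finset.sum_comm]
  classical
  refine Finset.sum_congr rfl fun q _ => ?_
  rw [Finset.sum_ite_eq, if_pos (Finset.mem_univ _)]
  rfl

lemma exists_of_push_ne {w : CoverSimplex f₁ → ℝ} {σ : K.faces} (h : push w σ ≠ 0) :
    ∃ q, w q ≠ 0 ∧ q.face = σ := by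
  classical
  obtain ⟨q, -, hq⟩ := Finset.exists_ne_zero_of_sum_ne_zero h
  exact ⟨q, (ite_ne_right_iff.1 hq).2, (ite_ne_right_iff.1 hq).1⟩

lemma push_mem {w : CoverSimplex f₁ → ℝ} (hw : w ∈ chainWeights label) :
    push w ∈ chainWeights fun σ : K.faces => σ.1 := by
  refine ⟨fun σ => Finset.sum_nonneg fun q _ => ?_, (sum_push w).trans hw.2.1, ?_⟩
  · split_ifs
    exacts [hw.1 q, le_rfl]
  · intro σ hσ τ hτ _
    obtain ⟨q, hq, rfl⟩ := exists_of_push_ne hσ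
    obtain ⟨q', hq', rfl⟩ := exists_of_push_ne hτ
    rcases hw.2.2.total hq hq' with h | h
    · exact Or.inl h.1
    · exact Or.inr h.1

/-- Members of a chain have different labels, so no weights are merged. -/
lemma push_face {w : CoverSimplex f₁ → ℝ} (hw : w ∈ chainWeights label) {q : CoverSimplex f₁}
    (hq : w q ≠ 0) : push w q.face = w q := by
  rw [push, Finset.sum_eq_single q]
  · simp
  · intro p _ hpq
    split_ifs with h
    · by_contra hp
      refine hpq ?_
      have hl : p.label = q.label := congrArg Subtype.val h
      rcases hw.2.2.total hp hq with h' | h'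
      · exact isSimplicialPoset.eq_of_card_le h' (by rw [hl])
      · exact (isSimplicialPoset.eq_of_card_le h' (by rw [hl])).symm
    · rfl
  · simp

lemma coverSum_mem {w : CoverSimplex f₁ → ℝ} (hw : w ∈ chainWeights label) :
    coverSum w ∈ K.space := faceSum_push w ▸ faceSum_mem_space (push_mem hw)

lemma layers_coverSum {w : CoverSimplex f₁ → ℝ} (hw : w ∈ chainWeights label) :
    K.layers (coverSum w) = push w := by
  rw [← faceSum_push, layers_faceSum (push_mem hw)]

lemma exists_top {w : CoverSimplex f₁ → ℝ} (hw : w ∈ chainWeights label) :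
    ∃ q, w q ≠ 0 ∧ (∀ p, w p ≠ 0 → p ≤ q) ∧ K.carrier (coverSum w) = q.label := by
  obtain ⟨σ, h1, h2, h3⟩ := exists_carrier_faceSum (push_mem hw)
  obtain ⟨q, hq, rfl⟩ := exists_of_push_ne h1
  refine ⟨q, hq, fun p hp => ?_, by rw [← faceSum_push, h3]; rfl⟩
  refine isSimplicialPoset.le_of_chain hw.2.2 hp hq (Finset.card_le_card ?_)
  exact h2 p.face (by rwa [push_face hw hp])

lemma le_of_label_eq_carrier {w : CoverSimplex f₁ → ℝ} (hw : w ∈ chainWeights label)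
    {q : CoverSimplex f₁} (hq : w q ≠ 0) (hql : q.label = K.carrier (coverSum w))
    {p : CoverSimplex f₁} (hp : w p ≠ 0) : p ≤ q := by
  obtain ⟨r, hr, hmax, hrl⟩ := exists_top hw
  rw [isSimplicialPoset.unique_le r q r (hmax q hq) le_rfl (hql.trans hrl)]
  exact hmax p hp

/-- The point below fixes the layers, and each layer has only one lift below the common top simplex
`q`. -/
lemma eq_of_coverSum_eq {w w' : CoverSimplex f₁ → ℝ} (hw : w ∈ chainWeights label)
    (hw' : w' ∈ chainWeights label) (h : coverSum w = coverSum w') {q : CoverSimplex f₁}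
    (hq : w q ≠ 0) (hq' : w' q ≠ 0) (hql : q.label = K.carrier (coverSum w)) : w = w' := by
  have hpush : push w = push w' := by rw [← layers_coverSum hw, h, layers_coverSum hw']
  have key : ∀ {u u' : CoverSimplex f₁ → ℝ}, u ∈ chainWeights label → u' ∈ chainWeights label →
      push u = push u' → (∀ p, u p ≠ 0 → p ≤ q) → (∀ p, u' p ≠ 0 → p ≤ q) →
      ∀ p, u p ≠ 0 → u' p = u p := by
    intro u u' hu hu' hp hle hle' p hup
    have h1 : push u' p.face = u p := by rw [← hp, push_face hu hup]
    obtain ⟨p', hp', hf⟩ := exists_of_push_ne (h1 ▸ hup)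
    have : p' = p := isSimplicialPoset.unique_le q p' p (hle' _ hp') (hle _ hup)
      (congrArg Subtype.val hf)
    subst this
    rw [← h1, push_face hu' hp']
  have hle := fun p hp => le_of_label_eq_carrier (p := p) hw hq hql hp
  have hle' := fun p hp => le_of_label_eq_carrier (p := p) hw' hq' (hql.trans (by rw [h])) hp
  ext p
  by_cases hp : w p = 0
  · by_cases hp' : w' p = 0
    · rw [hp, hp']
    · exact key hw' hw hpush.symm hle' hle p hp'
  · exact (key hw hw' hpush hle hle' p hp).symm

lemma finite_coverSum_eq (x : E) :
    {w : CoverSimplex f₁ → ℝ | w ∈ chainWeights label ∧ coverSum w = x}.Finite := by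
  -- Within a fibre, the top simplex determines the weights. `Option` supplies a value where there
  -- is no top simplex.
  have : ∀ w : CoverSimplex f₁ → ℝ, ∃ q : Option (CoverSimplex f₁), w ∈ chainWeights label →
      ∃ r, q = some r ∧ w r ≠ 0 ∧ r.label = K.carrier (coverSum w) := by
    intro w
    by_cases hw : w ∈ chainWeights label
    · obtain ⟨r, hr, -, hl⟩ := exists_top hw
      exact ⟨some r, fun _ => ⟨r, rfl, hr, hl.symm⟩⟩
    · exact ⟨none, fun h => absurd h hw⟩
  choose T hT using this
  refine Set.Finite.of_injOn (f := T) (t := univ) (fun _ _ => mem_univ _) ?_ Set.finite_univ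
  rintro w ⟨hw, hx⟩ w' ⟨hw', hx'⟩ heq
  obtain ⟨r, h1, h2, h3⟩ := hT w hw
  obtain ⟨r', h1', h2', h3'⟩ := hT w' hw'
  obtain rfl : r = r' := by
    rw [h1, h1'] at heq; exact Option.some.inj heq
  exact eq_of_coverSum_eq hw hw' (hx.trans hx'.symm) h2 h2' h3

open Classical in
/-- The weights on the completed covering of a point of the covering. -/
noncomputable def coverWeights (y : Y₁) (q : CoverSimplex f₁) : ℝ :=
  if y ∈ q.star then K.layers (basePoint f₁ y) q.face else 0

/-- A face with nonzero layer lies in the carrier, so exactly one sheet over its star contains `y`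
and receives the layer. -/
lemma push_coverWeights (y : Y₁) :
    push (coverWeights (f₁ := f₁) y) = K.layers (basePoint f₁ y) := by
  ext σ
  by_cases h : K.layers (basePoint f₁ y) σ = 0
  · rw [h]
    refine Finset.sum_eq_zero fun q _ => ?_
    split_ifs with hq
    · rw [coverWeights, hq, h, ite_self]
    · rfl
  · obtain ⟨q, hq, hy⟩ := exists_label_eq (f₁ := f₁) σ.2 (y := y)
      ((layers_carrier (basePoint_mem y)).1 σ h)
    have hqσ : q.face = σ := Subtype.ext hq
    rw [push, Finset.sum_eq_single q]
    · rw [if_pos hqσ, coverWeights, if_pos hy, hqσ]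
    · intro p _ hpq
      split_ifs with hp
      · rw [coverWeights, if_neg]
        exact fun hyp => hpq (eq_of_mem hyp hy (congrArg Subtype.val (hp.trans hqσ.symm)))
      · rfl
    · simp

lemma coverSum_coverWeights (y : Y₁) :
    coverSum (coverWeights (f₁ := f₁) y) = basePoint f₁ y := by
  rw [← faceSum_push, push_coverWeights, faceSum_layers (basePoint_mem y)]

lemma mem_star_of_coverWeights_ne {y : Y₁} {q : CoverSimplex f₁} (h : coverWeights y q ≠ 0) :
    y ∈ q.star := by
  by_contra hy
  exact h (if_neg hy)

lemma layers_ne_of_coverWeights_ne {y : Y₁} {q : CoverSimplex f₁} (h : coverWeights y q ≠ 0) :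
    K.layers (basePoint f₁ y) q.face ≠ 0 := by
  intro hy
  rw [coverWeights, hy, ite_self] at h
  exact h rfl

lemma coverWeights_mem (y : Y₁) : coverWeights (f₁ := f₁) y ∈ chainWeights label := by
  have hl := layers_mem (basePoint_mem (f₁ := f₁) y)
  refine ⟨fun q => ?_, ?_, ?_⟩
  · unfold coverWeights
    split_ifs
    exacts [hl.1 _, le_rfl]
  · rw [← sum_push, push_coverWeights]
    exact hl.2.1
  · intro q hq q' hq' _
    have h1 := mem_star_of_coverWeights_ne hq
    have h2 := mem_star_of_coverWeights_ne hq'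
    rcases hl.2.2.total (layers_ne_of_coverWeights_ne hq)
      (layers_ne_of_coverWeights_ne hq') with h | h
    · exact Or.inl (le_of_mem h1 h2 h)
    · exact Or.inr (le_of_mem h2 h1 h)

lemma coverWeights_ne {y : Y₁} {q : CoverSimplex f₁} (hy : y ∈ q.star)
    (hq : q.label = K.carrier (basePoint f₁ y)) : coverWeights y q ≠ 0 := by
  rw [coverWeights, if_pos hy]
  have := (layers_carrier (basePoint_mem (f₁ := f₁) y)).2
  convert this
  exact hq

lemma coverWeights_injective (hD : ∀ x : K.space, x ∈ V ↔ K.carrier x ∈ D)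
    (cov : IsCoveringMap f₁) : Function.Injective (coverWeights (f₁ := f₁)) := by
  intro y y' h
  obtain ⟨q, hq, hy⟩ := exists_label_eq (f₁ := f₁) (carrier_basePoint_mem y) (y := y)
    (Finset.Subset.refl _)
  have hb : basePoint f₁ y = basePoint f₁ y' := by
    rw [← coverSum_coverWeights, h, coverSum_coverWeights]
  have hy' : y' ∈ q.star := mem_star_of_coverWeights_ne (h ▸ coverWeights_ne hy hq)
  exact star_injOn hD cov q (hq ▸ carrier_basePoint_notMem hD y) hy hy' hb

lemma exists_coverWeights_eq (hD : ∀ x : K.space, x ∈ V ↔ K.carrier x ∈ D)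
    (cov : IsCoveringMap f₁) (hdown : ∀ s ∈ K.faces, ∀ t ∈ D, s ⊆ t → s ∈ D)
    {w : CoverSimplex f₁ → ℝ} (hw : w ∈ chainWeights label) (h : K.carrier (coverSum w) ∉ D) :
    ∃ y, coverWeights y = w := by
  obtain ⟨q, hq, -, hl⟩ := exists_top hw
  obtain ⟨y, hy, hb⟩ := exists_mem_star hD cov hdown q (hl ▸ h) (coverSum_mem hw) hl.ge
  refine ⟨y, eq_of_coverSum_eq (coverWeights_mem y) hw
    (by rw [coverSum_coverWeights, hb]) (q := q) (coverWeights_ne hy (by rw [hb, hl])) hq ?_⟩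
  rw [coverSum_coverWeights, hb, hl]

end Weights

end CoverSimplex

end CoverSimplex

end Geometry.SimplicialComplex

/-! ### From extensions to coverings outside the branched part. -/

section Extension

lemma mapsTo_compl_preimage {Y X : Type*} (f : Y → X) (V : Set X) :
    MapsTo f (f ⁻¹' V)ᶜ (f '' (f ⁻¹' V))ᶜ := by
  rintro y hy ⟨z, hz, hzy⟩
  exact hy (by rwa [mem_preimage, ← hzy])

variable {Y₁ Y X : Type*} [TopologicalSpace Y₁] [TopologicalSpace Y] {V : Set X} {f₁ : Y₁ → ↥(Vᶜ)}
  {f : Y → X} {i : Y₁ → Y}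

/-- The homeomorphism given by an extension. -/
noncomputable def IsExtension.homeomorph (h : IsExtension f₁ f i) : Y₁ ≃ₜ ↥(f ⁻¹' V)ᶜ :=
  h.isEmbedding.toHomeomorph.trans (Homeomorph.setCongr h.range_eq)

variable [TopologicalSpace X]

/-- Over the complement of `V` this is `f₁` up to a homeomorphism. The target also contains the
points of `V` missed by `f`; near these the fibres are empty because the range is closed. -/
lemma IsExtension.isCoveringMap (h : IsExtension f₁ f i) (cov : IsCoveringMap f₁)
    (hV : IsClosed V) (hf : IsClosed (range f)) :
    IsCoveringMap ((mapsTo_compl_preimage f V).restrict f _ _) := by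
  rintro ⟨x, hx⟩
  by_cases hxV : x ∈ V
  · have hxf : x ∉ range f := by
      rintro ⟨y, rfl⟩
      exact hx ⟨y, hxV, rfl⟩
    refine IsEvenlyCovered.to_isEvenlyCovered_preimage (I := Empty)
      (.of_preimage_eq_empty Empty (U := Subtype.val ⁻¹' (range f)ᶜ)
        ((hf.isOpen_compl.preimage continuous_subtype_val).mem_nhds hxf) ?_)
    exact Set.eq_empty_of_forall_notMem fun y hy => hy ⟨y, rfl⟩
  · have h1 := (cov ⟨x, hxV⟩).subtypeVal_comp _ hV.isOpen_compl
    have h2 := h1.restrictPreimage (f '' (f ⁻¹' V))ᶜ hx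
    have huniv : ((Subtype.val ∘ f₁) ⁻¹' (f '' (f ⁻¹' V))ᶜ) = univ := by
      refine Set.eq_univ_of_forall ?_
      rintro y ⟨z, hz, hzy⟩
      exact (f₁ y).2 (by rw [Function.comp_apply] at hzy; rwa [← hzy])
    have h3 := h2.comp_homeomorph (h.homeomorph.symm.trans ((Homeomorph.Set.univ Y₁).symm.trans
      (Homeomorph.setCongr huniv.symm)))
    have hfac : (mapsTo_compl_preimage f V).restrict f _ _ =
        ((f '' (f ⁻¹' V))ᶜ.restrictPreimage (Subtype.val ∘ f₁)) ∘
          (h.homeomorph.symm.trans ((Homeomorph.Set.univ Y₁).symm.trans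
            (Homeomorph.setCongr huniv.symm))) := by
      ext1 y
      obtain ⟨z, rfl⟩ := h.homeomorph.surjective y
      apply Subtype.ext
      change f (i z) = f₁ (h.homeomorph.symm (h.homeomorph z))
      rw [h.comm, h.homeomorph.symm_apply_apply]
    rw [hfac]
    exact h3.to_isEvenlyCovered_preimage

/-- A point of `V` missed by `f` has an empty fibre. It exists only for `k = 0`: otherwise the
closed range contains the dense complement of `V`. -/
lemma IsExtension.ncard_fiber (h : IsExtension f₁ f i) (hf : IsClosed (range f)) (hV : Dense Vᶜ)
    {k : ℕ} (hk : ∀ x, (f₁ ⁻¹' {x}).ncard = k) (x) :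
    (((mapsTo_compl_preimage f V).restrict f _ _) ⁻¹' {x}).ncard = k := by
  obtain ⟨x, hx⟩ := x
  by_cases hxV : x ∈ V
  · have hxf : x ∉ range f := by
      rintro ⟨y, rfl⟩
      exact hx ⟨y, hxV, rfl⟩
    have h0 : ((mapsTo_compl_preimage f V).restrict f _ _) ⁻¹' {⟨x, hx⟩} = ∅ :=
      Set.eq_empty_of_forall_notMem fun y hy => hxf ⟨y, congrArg Subtype.val hy⟩
    rw [h0, Set.ncard_empty]
    by_contra hne
    have : Vᶜ ⊆ range f := fun z hz => by
      obtain ⟨y, hy⟩ := Set.nonempty_of_ncard_ne_zero (hk ⟨z, hz⟩ ▸ Ne.symm hne)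
      exact ⟨i y, by rw [h.comm, show f₁ y = _ from hy]⟩
    exact hxf (hf.closure_subset_iff.2 this (hV x))
  · rw [← hk ⟨x, hxV⟩, ← Set.ncard_image_of_injective _ h.homeomorph.injective]
    congr 1
    ext y
    obtain ⟨z, rfl⟩ := h.homeomorph.surjective y
    rw [h.homeomorph.injective.mem_set_image]
    simp only [mem_preimage, mem_singleton_iff, Subtype.ext_iff]
    change f (i z) = x ↔ _
    rw [h.comm]

end Extension

/-! ### Subcomplexes, closed subpolyhedra and continuity of piecewise linear maps. -/

namespace Geometry.SimplicialComplex

variable {E : Type*} [AddCommGroup E] [Module ℝ E]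

/-- The subcomplex of the faces satisfying a predicate that passes to subsets. -/
def restrictFaces (K : SimplicialComplex ℝ E) (P : Finset E → Prop)
    (hP : ∀ s t, s ⊆ t → P t → P s) : SimplicialComplex ℝ E :=
  ofUniqueWeights {s ∈ K.faces | P s} (fun _ hs => K.nonempty_of_mem_faces hs.1)
    (fun s hs t hts ht => ⟨K.down_closed hs.1 hts ht, hP t s hts hs.2⟩)
    (fun _ _ _ hw hw' h h' => K.isBary_unique hw hw' h.1 h'.1)

lemma mem_restrictFaces_space {K : SimplicialComplex ℝ E} {P : Finset E → Prop}
    (hP : ∀ s t, s ⊆ t → P t → P s) {x : E} :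
    x ∈ (K.restrictFaces P hP).space ↔ x ∈ K.space ∧ P (K.carrier x) := by
  constructor
  · intro hx
    obtain ⟨w, hw, hs, hPs⟩ := exists_isBary _ hx
    exact ⟨mem_space_of_isBary hw hs, by rwa [carrier_eq hw hs]⟩
  · rintro ⟨hx, hPx⟩
    exact convexHull_subset_space (K := K.restrictFaces P hP) (s := K.carrier x)
      ⟨K.carrier_mem hx, hPx⟩ (mem_convexHull_carrier hx)

end Geometry.SimplicialComplex

section Subpolyhedron

open Geometry.SimplicialComplex

variable {E : Type*} [NormedAddCommGroup E] [NormedSpace ℝ E] {X : Set E}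
  {n c : ℕ} {B : Set X}

lemma IsPseudomanifold.isCompact (hX : IsPseudomanifold n X) : IsCompact X := by
  obtain ⟨K, hK, -⟩ := hX
  exact hK.space_eq ▸ isCompact_space hK.finite

lemma IsSubpolyhedronOfCodimGE.isClosed (hB : IsSubpolyhedronOfCodimGE n c B) : IsClosed B := by
  obtain ⟨L, hL, -⟩ := hB
  have : B = Subtype.val ⁻¹' L.space := by
    rw [hL.space_eq, Set.preimage_image_eq _ Subtype.val_injective]
  rw [this]
  exact (isCompact_space hL.finite).isClosed.preimage continuous_subtype_val

lemma IsSubpolyhedronOfCodimGE.dense_compl [FiniteDimensional ℝ E]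
    (hB : IsSubpolyhedronOfCodimGE n c B) (hc : c ≠ 0)
    (hX : IsPseudomanifold n X) : Dense Bᶜ := by
  obtain ⟨L, hL, hdim⟩ := hB
  obtain ⟨K, hK, hpure, -⟩ := hX
  rw [dense_iff_inter_open]
  rintro _ ⟨O, hO, rfl⟩ ⟨x, hx⟩
  obtain ⟨y, hyO, hyK, hyL⟩ := exists_mem_notMem_space_of_isPure hK.finite (n := n) hpure hL.finite
    (fun s hs => by have := hdim s hs; omega) hO (hK.space_eq.symm ▸ x.2) hx
  rw [hK.space_eq] at hyK
  rw [hL.space_eq] at hyL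
  exact ⟨⟨y, hyK⟩, hyO, fun h => hyL ⟨_, h, rfl⟩⟩

lemma IsPiecewiseLinear.continuous {F : Type*} [NormedAddCommGroup F] [NormedSpace ℝ F]
    {Y : Set F} [FiniteDimensional ℝ F] {f : Y → X} (hf : IsPiecewiseLinear f) :
    Continuous f := by
  obtain ⟨K, hK, hA⟩ := hf
  rw [continuous_induced_rng]
  have hcl : ∀ s ∈ K.faces, IsClosed ((Subtype.val : Y → F) ⁻¹' convexHull ℝ (s : Set F)) :=
    fun s _ => (s.finite_toSet.isClosed_convexHull ℝ).preimage continuous_subtype_val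
  have : LocallyFinite fun s : K.faces => ((Subtype.val : Y → F) ⁻¹' convexHull ℝ (s.1 : Set F)) := by
    have := hK.finite.to_subtype
    exact locallyFinite_of_finite _
  refine this.continuous ?_ (fun s => hcl s.1 s.2) fun s => ?_
  · refine Set.eq_univ_of_forall fun y => ?_
    have hy : (y : F) ∈ K.space := hK.space_eq.symm ▸ y.2
    exact mem_iUnion.2 ⟨⟨_, K.carrier_mem hy⟩, mem_convexHull_carrier hy⟩
  · obtain ⟨A, hA⟩ := hA s.1 s.2
    refine ((AffineMap.continuous_of_finiteDimensional A).comp continuous_subtype_val).continuousOn.congr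
      fun y hy => hA y hy

end Subpolyhedron

/-! ### The completed covering as a polyhedron over the base. -/

namespace Geometry.SimplicialComplex

section OrderComplexCarrier

variable {Q W : Type*} [PartialOrder Q] {N : ℕ} {lab : Q → Finset W} {ι : Q ≃ Fin N}
  {hlab : ∀ q, (lab q).Nonempty}

lemma posetVertex_mem_carrier {x : EuclideanSpace ℝ (Fin N)}
    (hx : x ∈ (orderComplex lab ι hlab).space) (q : Q) :
    posetVertex lab ι q ∈ (orderComplex lab ι hlab).carrier x ↔ x (ι q) ≠ 0 := by
  obtain ⟨C, hne, hC, hs⟩ := carrier_mem _ hx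
  have h := (isBary_bary _ hx).apply_posetVertex hlab (C := C) hs.subset q
  have hpos : ((lab q).card : ℝ) ≠ 0 := by exact_mod_cast (hlab q).card_pos.ne'
  rw [h, carrier, Finsupp.mem_support_iff]
  simp [hpos]

end OrderComplexCarrier

namespace CoverSimplex

set_option linter.unusedSectionVars false

variable {E : Type*} [NormedAddCommGroup E] [NormedSpace ℝ E]
  {K : SimplicialComplex ℝ E} {V : Set K.space} {D : Set (Finset E)}
  {Y₁ : Type*} [TopologicalSpace Y₁] {f₁ : Y₁ → ↥(Vᶜ)} {N : ℕ}
  [Fintype K.faces] [Fintype (CoverSimplex f₁)]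

/-- The polyhedron of the completed covering. -/
def completion (ι : CoverSimplex f₁ ≃ Fin N) : Set (EuclideanSpace ℝ (Fin N)) :=
  (orderComplex label ι label_nonempty).space

/-- The weights of a point of the completed covering. -/
def coords (ι : CoverSimplex f₁ ≃ Fin N) (y : EuclideanSpace ℝ (Fin N)) (q : CoverSimplex f₁) : ℝ :=
  y (ι q)

variable {ι : CoverSimplex f₁ ≃ Fin N}

lemma coords_mem (y : completion ι) : coords ι y.1 ∈ chainWeights label :=
  (mem_orderComplex_space label_nonempty).1 y.2

lemma coords_injective : Function.Injective (coords ι) := by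
  intro y y' h
  ext j
  simpa [coords] using congrFun h (ι.symm j)

lemma continuous_coords (q : CoverSimplex f₁) :
    Continuous fun y : completion ι => coords ι y.1 q := by
  unfold coords; fun_prop

variable (ι) in
/-- The affine map underlying the projection of the completed covering. -/
noncomputable def completionLinear : EuclideanSpace ℝ (Fin N) →ₗ[ℝ] E where
  toFun y := coverSum (coords ι y)
  map_add' y z := by simp [coverSum, coords, add_smul, Finset.sum_add_distrib]
  map_smul' r y := by simp [coverSum, coords, mul_smul, Finset.smul_sum]

variable (ι) in
/-- The projection of the completed covering. -/
noncomputable def completionMap (y : completion ι) : K.space :=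
  ⟨coverSum (coords ι y.1), coverSum_mem (coords_mem y)⟩

lemma continuous_completionMap : Continuous (completionMap ι) := by
  refine Continuous.subtype_mk ?_ _
  unfold coverSum
  exact continuous_finsetSum _ fun q _ => (continuous_coords q).smul continuous_const

variable (ι) in
/-- The inclusion of the covering into its completion. -/
noncomputable def completionIncl (y : Y₁) : completion ι :=
  ⟨WithLp.toLp 2 fun j => coverWeights y (ι.symm j), (mem_orderComplex_space label_nonempty).2 (by
    simpa using coverWeights_mem (f₁ := f₁) y)⟩

lemma coords_completionIncl (y : Y₁) : coords ι (completionIncl ι y).1 = coverWeights y := by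
  ext q; simp [coords, completionIncl]

lemma completionMap_completionIncl (y : Y₁) : completionMap ι (completionIncl ι y) = f₁ y := by
  apply Subtype.ext
  change coverSum (coords ι (completionIncl ι y).1) = _
  rw [coords_completionIncl, coverSum_coverWeights]
  rfl

lemma finite_fiber_completionMap (x : K.space) : (completionMap ι ⁻¹' {x}).Finite := by
  refine Set.Finite.of_finite_image (f := fun y => coords ι y.1)
    ((finite_coverSum_eq (f₁ := f₁) x.1).subset ?_) ?_
  · rintro _ ⟨y, hy, rfl⟩
    exact ⟨coords_mem y, congrArg Subtype.val hy⟩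
  · exact (coords_injective.comp Subtype.val_injective).injOn

lemma isPiecewiseLinear_completionMap : IsPiecewiseLinear (completionMap ι) :=
  ⟨orderComplex label ι label_nonempty, ⟨orderComplex_finite label_nonempty, rfl⟩, fun _ _ =>
    ⟨(completionLinear ι).toAffineMap, fun _ _ => rfl⟩⟩

section

variable (hD : ∀ x : K.space, x ∈ V ↔ K.carrier x ∈ D) (cov : IsCoveringMap f₁)

include hD cov

lemma isOpen_star (q : CoverSimplex f₁) : IsOpen q.star := by
  obtain ⟨y, hy⟩ := q.star_nonempty
  rw [star_eq hy]
  exact isOpen_sheet hD cov _ _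

/-- The sheet is open, so only its frontier matters. A frontier point with nonzero layer would lie
in another sheet over the same star, which is open and disjoint from the first. -/
lemma continuous_coverWeights (q : CoverSimplex f₁) :
    Continuous fun y : Y₁ => coverWeights y q := by
  classical
  have h : Continuous fun y => K.layers (basePoint f₁ y) q.face :=
    (continuous_apply q.face).comp
      (continuous_layers.comp (continuous_subtype_val.comp cov.continuous))
  have heq : (fun y : Y₁ => coverWeights y q) =
      fun y => if y ∈ q.star then K.layers (basePoint f₁ y) q.face else 0 := by
    ext y; unfold coverWeights; congr
  rw [heq]
  refine Continuous.if (fun y hy => ?_) h continuous_const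
  have hyo : y ∉ q.star := (isOpen_star hD cov q).frontier_eq ▸ hy |>.2
  by_contra hne
  obtain ⟨r, hr, hyr⟩ := exists_label_eq (f₁ := f₁) q.label_mem (y := y)
    ((layers_carrier (basePoint_mem y)).1 q.face hne)
  obtain ⟨z, hzr, hzq⟩ := mem_closure_iff.1 (frontier_subset_closure hy) _
    (isOpen_star hD cov r) hyr
  exact hyo (eq_of_mem hzr hzq hr ▸ hyr)

lemma continuous_completionIncl : Continuous (completionIncl ι) := by
  refine Continuous.subtype_mk ((PiLp.continuous_toLp 2 _).comp ?_) _
  exact continuous_pi fun j => continuous_coverWeights hD cov _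

/-- Near `y`, a nonzero coordinate at the simplex `q` over the carrier of `y` selects a sheet on
which `f₁` is injective. Together with the open image under `f₁`, this recovers a neighbourhood of
`y`. -/
lemma isEmbedding_completionIncl : Topology.IsEmbedding (completionIncl ι) := by
  have hc := continuous_completionIncl (ι := ι) hD cov
  refine ⟨Topology.isInducing_iff_nhds.2 fun y => le_antisymm hc.continuousAt.le_comap ?_, ?_⟩
  · intro U hU
    obtain ⟨q, hq, hy⟩ := exists_label_eq (f₁ := f₁) (carrier_basePoint_mem y) (y := y)
      (Finset.Subset.refl _)
    obtain ⟨U', hU', hUo, hyU⟩ := mem_nhds_iff.1 hU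
    have hO := cov.isOpenMap _ (hUo.inter (isOpen_star hD cov q))
    obtain ⟨O, hO, hOeq⟩ := isOpen_induced_iff.1 hO
    refine ⟨{z | coords ι z.1 q ≠ 0} ∩ completionMap ι ⁻¹' O, IsOpen.mem_nhds ?_ ?_, ?_⟩
    · exact ((continuous_coords q).isOpen_preimage _ isOpen_ne).inter
        (hO.preimage continuous_completionMap)
    · refine ⟨?_, ?_⟩
      · change coords ι (completionIncl ι y).1 q ≠ 0
        rw [coords_completionIncl]
        exact coverWeights_ne hy hq
      · change completionMap ι (completionIncl ι y) ∈ O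
        rw [completionMap_completionIncl]
        change f₁ y ∈ Subtype.val ⁻¹' O
        rw [hOeq]
        exact ⟨y, ⟨hyU, hy⟩, rfl⟩
    · rintro z ⟨hz1, hz2⟩
      change coords ι (completionIncl ι z).1 q ≠ 0 at hz1
      rw [coords_completionIncl] at hz1
      change completionMap ι (completionIncl ι z) ∈ O at hz2
      rw [completionMap_completionIncl] at hz2
      change f₁ z ∈ Subtype.val ⁻¹' O at hz2
      rw [hOeq] at hz2
      obtain ⟨u, ⟨huU, huq⟩, hu⟩ := hz2
      have := star_injOn hD cov q (hq ▸ carrier_basePoint_notMem hD y) huq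
        (mem_star_of_coverWeights_ne hz1) (by unfold basePoint; rw [hu])
      exact hU' (this ▸ huU)
  · intro y y' h
    apply coverWeights_injective hD cov
    rw [← coords_completionIncl (ι := ι), h, coords_completionIncl]

lemma isExtension_completionMap (hdown : ∀ s ∈ K.faces, ∀ t ∈ D, s ⊆ t → s ∈ D) :
    IsExtension f₁ (completionMap ι) (completionIncl ι) where
  isEmbedding := isEmbedding_completionIncl hD cov
  range_eq := by
    ext y
    constructor
    · rintro ⟨z, rfl⟩
      rw [mem_compl_iff, mem_preimage, completionMap_completionIncl (f₁ := f₁) (ι := ι)]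
      exact (f₁ z).2
    · intro hy
      obtain ⟨z, hz⟩ := exists_coverWeights_eq hD cov hdown (coords_mem y)
        (fun h => hy ((hD _).2 h))
      refine ⟨z, Subtype.ext (coords_injective (ι := ι) ?_)⟩
      rw [coords_completionIncl, hz]
  comm := fun y => completionMap_completionIncl (f₁ := f₁) (ι := ι) y

omit [Fintype K.faces] in
lemma isPseudomanifold_completion {n : ℕ} (hdown : ∀ s ∈ K.faces, ∀ t ∈ D, s ⊆ t → s ∈ D)
    (hpure : K.IsPure n) (hnb : K.IsNonbranching n)
    (hdim : ∀ s ∈ K.faces, s ∈ D → s.card < n) : IsPseudomanifold n (completion ι) :=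
  have hext := fun q : CoverSimplex f₁ => exists_le_card hD cov hdown hpure q
  have htwo := fun (q : CoverSimplex f₁) hq => ncard_le_card hD cov hdown hnb hdim q hq
  ⟨orderComplex label ι label_nonempty, ⟨orderComplex_finite label_nonempty, rfl⟩,
    isPure_orderComplex label_nonempty isSimplicialPoset hext,
    isNonbranching_orderComplex label_nonempty isSimplicialPoset hext htwo⟩

end

/-- The preimage of `V` is the subcomplex of chains with all labels in `D`. Ranks along such a chain
are distinct and bounded by the size of its top label, which is less than `n`. -/
lemma isSubpolyhedron_preimage {n : ℕ} (hD : ∀ x : K.space, x ∈ V ↔ K.carrier x ∈ D)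
    (hdown : ∀ s ∈ K.faces, ∀ t ∈ D, s ⊆ t → s ∈ D)
    (hdim : ∀ s ∈ K.faces, s ∈ D → s.card < n) :
    IsSubpolyhedronOfCodimGE n 2 (completionMap ι ⁻¹' V) := by
  let P : Finset (EuclideanSpace ℝ (Fin N)) → Prop := fun s =>
    ∀ q : CoverSimplex f₁, posetVertex label ι q ∈ s → q.label ∈ D
  have hP : ∀ s t, s ⊆ t → P t → P s := fun s t h ht q hq => ht q (h hq)
  refine ⟨(orderComplex label ι label_nonempty).restrictFaces P hP, ⟨?_, ?_⟩, ?_⟩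
  · exact (orderComplex_finite label_nonempty).subset fun s hs => hs.1
  · ext y
    rw [mem_restrictFaces_space]
    have key : ∀ hy : y ∈ completion ι, completionMap ι ⟨y, hy⟩ ∈ V ↔
        P ((orderComplex label ι label_nonempty).carrier y) := by
      intro hy
      obtain ⟨q, hq, hmax, hc⟩ := exists_top (coords_mem ⟨y, hy⟩)
      rw [hD]
      change K.carrier (coverSum (coords ι y)) ∈ D ↔ _
      rw [hc]
      constructor
      · intro h p hp
        rw [posetVertex_mem_carrier hy] at hp
        exact hdown _ p.label_mem _ h (hmax p hp).1
      · intro h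
        exact h q ((posetVertex_mem_carrier hy q).2 hq)
    constructor
    · rintro ⟨hy, hy'⟩
      exact ⟨⟨y, hy⟩, (key hy).2 hy', rfl⟩
    · rintro ⟨⟨z, hz⟩, hzV, rfl⟩
      exact ⟨hz, (key hz).1 hzV⟩
  · rintro s ⟨⟨C, hne, hC, rfl⟩, hs⟩
    obtain ⟨q, hq, hmax⟩ := isSimplicialPoset.exists_top hC hne
    have hqD : q.label ∈ D := hs q (Finset.mem_map.2 ⟨q, hq, rfl⟩)
    have h1 := hdim _ q.label_mem hqD
    have h2 : C.card ≤ q.label.card := by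
      rw [← Finset.card_image_of_injOn (isSimplicialPoset.card_injOn hC)]
      calc _ ≤ (Finset.Icc 1 q.label.card).card := Finset.card_le_card fun r hr => by
              obtain ⟨p, hp, rfl⟩ := Finset.mem_image.1 hr
              exact Finset.mem_Icc.2 ⟨p.label_nonempty.card_pos,
                isSimplicialPoset.card_le (hmax p hp)⟩
        _ = _ := by simp
    rw [Finset.card_map]
    omega

end CoverSimplex

end Geometry.SimplicialComplex

/-! ### Continuous extension from a dense subspace. -/

section ContinuousExtension

open Filter Topology

variable {Y₁ Y Y' X : Type*} [TopologicalSpace Y₁] [TopologicalSpace Y] [TopologicalSpace Y']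
  [TopologicalSpace X]

/-- A preconnected set covered by finitely many closed sets, any two of which have the same trace on
it or disjoint traces, lies in one of them. -/
lemma IsPreconnected.exists_subset_of_closed_cover {I : Type*} {s : Set Y} (hs : IsPreconnected s)
    (hne : s.Nonempty) {J : Set I} (hJ : J.Finite) {C : I → Set Y} (hC : ∀ j ∈ J, IsClosed (C j))
    (hcov : ∀ y ∈ s, ∃ j ∈ J, y ∈ C j)
    (hdisj : ∀ j ∈ J, ∀ k ∈ J, (s ∩ (C j ∩ C k)).Nonempty → s ∩ C j ⊆ C k) :
    ∃ j ∈ J, s ⊆ C j := by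
  obtain ⟨x, hx⟩ := hne
  obtain ⟨j, hj, hxj⟩ := hcov x hx
  refine ⟨j, hj, ?_⟩
  have h2 : IsClosed (⋃ k ∈ {k ∈ J | ¬ (s ∩ (C k ∩ C j)).Nonempty}, C k) :=
    (hJ.subset (sep_subset _ _)).isClosed_biUnion fun k hk => hC k hk.1
  have hsub : s ⊆ C j ∪ ⋃ k ∈ {k ∈ J | ¬ (s ∩ (C k ∩ C j)).Nonempty}, C k := by
    intro y hy
    obtain ⟨k, hk, hyk⟩ := hcov y hy
    by_cases hkj : (s ∩ (C k ∩ C j)).Nonempty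
    · exact Or.inl (hdisj k hk j hj hkj ⟨hy, hyk⟩)
    · exact Or.inr (mem_biUnion ⟨hk, hkj⟩ hyk)
  have hemp : s ∩ (C j ∩ ⋃ k ∈ {k ∈ J | ¬ (s ∩ (C k ∩ C j)).Nonempty}, C k) = ∅ := by
    refine Set.eq_empty_of_forall_notMem ?_
    rintro y ⟨hy, hyj, hy2⟩
    obtain ⟨k, hk, hyk⟩ := mem_iUnion₂.1 hy2
    exact hk.2 ⟨y, hy, hyk, hyj⟩
  rcases isPreconnected_iff_subset_of_disjoint_closed.1 hs _ _ (hC j hj) h2 hsub hemp with h | h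
  · exact h
  · obtain ⟨k, hk, hxk⟩ := mem_iUnion₂.1 (h hx)
    exact absurd ⟨x, hx, hxk, hxj⟩ hk.2

lemma Homeomorph.isCoveringMap (e : Y ≃ₜ Y') : IsCoveringMap e := fun _ =>
  IsEvenlyCovered.to_isEvenlyCovered_preimage (I := Unit)
    ⟨inferInstance, _root_.Set.univ, trivial, isOpen_univ, isOpen_univ,
      (Homeomorph.Set.univ Y).trans
        (e.trans ((Homeomorph.Set.univ Y').symm.trans (Homeomorph.prodPUnit _).symm)), fun _ => rfl⟩

/-- Extension of a map into a compact space with finite fibres over `X`, from a dense subspace which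
is locally connected over `X` at the added points. -/
lemma exists_continuous_extension [CompactSpace Y'] [T2Space Y'] [T2Space X] {f : Y → X}
    (hf : Continuous f) {f' : Y' → X} (hf' : Continuous f') (hfin : ∀ x, (f' ⁻¹' {x}).Finite)
    {i : Y₁ → Y} (hi : IsDenseInducing i) {i' : Y₁ → Y'} (hi' : Continuous i')
    (hcomm : ∀ y, f' (i' y) = f (i y))
    (hloc : ∀ p : Y, ∀ O ∈ 𝓝 (f p), ∃ W ∈ 𝓝 p, W ⊆ f ⁻¹' O ∧ IsPreconnected (i ⁻¹' W)) :
    ∃ g : Y → Y', Continuous g ∧ f' ∘ g = f ∧ g ∘ i = i' := by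
  have key : ∀ p : Y, ∃ z, Tendsto i' (comap i (𝓝 p)) (𝓝 z) := by
    intro p
    have hne : (comap i (𝓝 p)).NeBot := hi.comap_nhds_neBot p
    have htend : Tendsto (f' ∘ i') (comap i (𝓝 p)) (𝓝 (f p)) := by
      have : f' ∘ i' = f ∘ i := funext hcomm
      rw [this]
      exact (hf.tendsto p).comp tendsto_comap
    have hfib : ∀ z, ClusterPt z (map i' (comap i (𝓝 p))) → f' z = f p := by
      intro z hz
      have h1 : MapClusterPt (f' z) (comap i (𝓝 p)) (f' ∘ i') :=
        MapClusterPt.continuousAt_comp hf'.continuousAt hz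
      have h2 : ClusterPt (f' z) (𝓝 (f p)) := ClusterPt.mono h1 htend
      have h3 : (𝓝 (f' z) ⊓ 𝓝 (f p)).NeBot := h2
      exact eq_of_nhds_neBot h3
    obtain ⟨z, hz⟩ := exists_clusterPt_of_compactSpace (map i' (comap i (𝓝 p)))
    refine ⟨z, le_nhds_of_unique_clusterPt fun z' hz' => ?_⟩
    by_contra hzz
    obtain ⟨U, hU, hUd⟩ := (hfin (f p)).t2_separation
    let v : Set Y' := ⋃ s ∈ f' ⁻¹' {f p} \ {z}, U s
    have hv : IsOpen v := isOpen_biUnion fun s _ => (hU s).2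
    -- By compactness of `Y'`, everything over a small neighbourhood of `f p` lies in the disjoint
    -- neighbourhoods chosen around the fibre.
    have hclosed : IsClosed (f' '' (U z ∪ v)ᶜ) :=
      (((hU z).2.union hv).isClosed_compl.isCompact.image hf').isClosed
    have hmem : (f' '' (U z ∪ v)ᶜ)ᶜ ∈ 𝓝 (f p) := by
      refine hclosed.isOpen_compl.mem_nhds ?_
      rintro ⟨s, hs, hsp⟩
      refine hs ?_
      by_cases hsz : s = z
      · exact Or.inl (hsz ▸ (hU s).1)
      · exact Or.inr (mem_biUnion ⟨hsp, hsz⟩ (hU s).1)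
    obtain ⟨W, hW, hWO, hWc⟩ := hloc p _ hmem
    have hsub : i' '' (i ⁻¹' W) ⊆ U z ∪ v := by
      rintro _ ⟨y, hy, rfl⟩
      by_contra hn
      exact hWO hy ⟨i' y, hn, hcomm y⟩
    have hF : i' '' (i ⁻¹' W) ∈ map i' (comap i (𝓝 p)) :=
      image_mem_map (preimage_mem_comap hW)
    have hmeet : ∀ s, ClusterPt s (map i' (comap i (𝓝 p))) → (i' '' (i ⁻¹' W) ∩ U s).Nonempty := by
      intro s hs
      rw [inter_comm]
      exact clusterPt_iff_nonempty.1 hs ((hU s).2.mem_nhds (hU s).1) hF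
    have hdis : Disjoint (U z) v := by
      rw [Set.disjoint_iUnion₂_right]
      rintro s ⟨hs, hsz⟩
      exact hUd (hfib z hz) hs (Ne.symm hsz)
    -- The connected image meets `U z` and so stays in it, leaving no room for a second cluster
    -- point.
    have h1 := (hWc.image i' hi'.continuousOn).subset_left_of_subset_union (hU z).2 hv hdis hsub
      (hmeet z hz)
    obtain ⟨t, ht, htU⟩ := hmeet z' hz'
    exact Set.disjoint_left.1 (hUd (hfib z hz) (hfib z' hz') (Ne.symm hzz)) (h1 ht) htU
  have hg : Continuous (hi.extend i') := hi.continuous_extend key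
  have hgi : ∀ y, hi.extend i' (i y) = i' y := fun y => hi.extend_eq hi' y
  refine ⟨hi.extend i', hg, ?_, funext hgi⟩
  refine hi.dense.equalizer (hf'.comp hg) hf (funext fun y => ?_)
  simp only [Function.comp_apply, hgi, hcomm]

variable {V : Set X} {f₁ : Y₁ → ↥(Vᶜ)} {f : Y → X} {i : Y₁ → Y} {f' : Y' → X} {i' : Y₁ → Y'}

omit [TopologicalSpace X] in
lemma IsExtension.denseRange (h : IsExtension f₁ f i) (hV : Dense (f ⁻¹' V)ᶜ) : DenseRange i := by
  rw [DenseRange, h.range_eq]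
  exact hV

omit [TopologicalSpace X] in
lemma IsExtension.isDenseInducing (h : IsExtension f₁ f i) (hV : Dense (f ⁻¹' V)ᶜ) :
    IsDenseInducing i := ⟨h.isEmbedding.isInducing, h.denseRange hV⟩

omit [TopologicalSpace Y₁] in
lemma surjective_of_denseRange [CompactSpace Y] [T2Space Y'] {g : Y → Y'} (hg : Continuous g)
    (hgi : g ∘ i = i') (hi' : DenseRange i') : Function.Surjective g := by
  rw [← Set.range_eq_univ, ← (isCompact_range hg).isClosed.closure_eq, ← dense_iff_closure_eq]
  refine hi'.mono ?_
  rintro _ ⟨y, rfl⟩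
  exact ⟨i y, congrFun hgi y⟩

omit [TopologicalSpace X] in
/-- A map between extensions is a homeomorphism over the complement of `V`. -/
lemma IsExtension.exists_homeomorph (h : IsExtension f₁ f i) (h' : IsExtension f₁ f' i')
    {g : Y → Y'} (hfg : f' ∘ g = f) (hgi : g ∘ i = i') (hg : Function.Surjective g)
    (hm : MapsTo g (f ⁻¹' V)ᶜ (g '' (f ⁻¹' V))ᶜ) :
    ∃ e : ↥(f ⁻¹' V)ᶜ ≃ₜ ↥(g '' (f ⁻¹' V))ᶜ, hm.restrict g _ _ = e := by
  have him : g '' (f ⁻¹' V) = f' ⁻¹' V := by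
    rw [← hfg, preimage_comp, image_preimage_eq _ hg]
  refine ⟨h.homeomorph.symm.trans (h'.homeomorph.trans (Homeomorph.setCongr (by rw [him]))), ?_⟩
  ext1 y
  obtain ⟨z, rfl⟩ := h.homeomorph.surjective y
  apply Subtype.ext
  change g (i z) = i' (h.homeomorph.symm (h.homeomorph z))
  rw [h.homeomorph.symm_apply_apply]
  exact congrFun hgi z

end ContinuousExtension

/-! ### Maps between extensions are one-fold branched coverings. -/

section BranchedCovering

variable {E F : Type*} [NormedAddCommGroup E] [NormedSpace ℝ E] [FiniteDimensional ℝ E]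
  [NormedAddCommGroup F] [NormedSpace ℝ F] {Y : Set E} {X : Set F}

/-- The preimage of a nowhere dense closed set under a branched covering map is nowhere dense. -/
lemma IsBranchedCovering.dense_preimage_compl {f : Y → X} {B : Set Y} (hf : IsBranchedCovering f B)
    {V : Set X} (hV : Dense Vᶜ) : Dense (f ⁻¹' V)ᶜ := by
  obtain ⟨n, hY, hB⟩ := hf.source
  have hc := hf.piecewiseLinear.continuous
  have : CompactSpace Y := isCompact_iff_compactSpace.1 hY.isCompact
  have hBd := hB.dense_compl two_ne_zero hY
  have hfB : IsClosed (f '' B) := (hB.isClosed.isCompact.image hc).isClosed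
  rw [dense_iff_inter_open]
  intro U hU hne
  obtain ⟨y, hyU, hyB⟩ := (dense_iff_inter_open.1 hBd) U hU hne
  -- Off the nowhere dense branched part, the map is a covering and hence open, so the image of `U`
  -- meets the dense complement of `V`.
  have ho : IsOpen (Subtype.val '' (hf.mapsTo.restrict f _ _ '' (Subtype.val ⁻¹' U))) :=
    hfB.isOpen_compl.isOpenMap_subtype_val _
      (hf.covering.isOpenMap _ (hU.preimage continuous_subtype_val))
  obtain ⟨x, hx, hxV⟩ := (dense_iff_inter_open.1 hV) _ ho ⟨_, _, ⟨⟨y, hyB⟩, hyU, rfl⟩, rfl⟩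
  obtain ⟨_, ⟨z, hz, rfl⟩, rfl⟩ := hx
  exact ⟨z, hz, hxV⟩

/-- A piecewise linear map between extensions of a covering is a one-fold branched covering map. -/
lemma IsExtension.isFoldBranchedCovering {Y₁ : Type*} [TopologicalSpace Y₁] {G : Type*}
    [NormedAddCommGroup G] [NormedSpace ℝ G] [FiniteDimensional ℝ G] {Y' : Set G} {n : ℕ}
    {V : Set X} {f₁ : Y₁ → ↥(Vᶜ)}
    {f : Y → X} {i : Y₁ → Y} {f' : Y' → X} {i' : Y₁ → Y'} {B' : Set Y'} (h : IsExtension f₁ f i)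
    (hY : IsPseudomanifold n Y) (hB : IsSubpolyhedronOfCodimGE n 2 (f ⁻¹' V))
    (hfin : ∀ x, (f ⁻¹' {x}).Finite)
    (h' : IsExtension f₁ f' i') (hf' : IsBranchedCovering f' B') (hV : Dense Vᶜ)
    {g : Y → Y'} (hg : IsPiecewiseLinear g) (hfg : f' ∘ g = f) (hgi : g ∘ i = i') :
    IsFoldBranchedCovering 1 g (f ⁻¹' V) := by
  have : CompactSpace Y := isCompact_iff_compactSpace.1 hY.isCompact
  have hsurj := surjective_of_denseRange hg.continuous hgi
    (h'.denseRange (hf'.dense_preimage_compl hV))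
  have hm : MapsTo g (f ⁻¹' V)ᶜ (g '' (f ⁻¹' V))ᶜ := by
    rintro y hy ⟨c, hc, hcy⟩
    refine hy ?_
    rw [mem_preimage, ← hfg, Function.comp_apply, ← hcy]
    rwa [mem_preimage, ← hfg] at hc
  obtain ⟨e, he⟩ := h.exists_homeomorph h' hfg hgi hsurj hm
  refine { target := ?_, source := ⟨n, hY, hB⟩, piecewiseLinear := hg, finite_fiber := ?_,
           mapsTo := hm, covering := ?_, card_fiber := ?_ }
  · obtain ⟨k, hk, -⟩ := hf'.source
    exact ⟨k, hk⟩
  · intro y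
    refine (hfin (f' y)).subset ?_
    rintro z rfl
    rw [mem_preimage, mem_singleton_iff, ← hfg]
    rfl
  · rw [he]
    exact e.isCoveringMap
  · intro x
    rw [he, Set.ncard_eq_one]
    refine ⟨e.symm x, ?_⟩
    ext y
    rw [mem_preimage, mem_singleton_iff, mem_singleton_iff, e.eq_symm_apply]

end BranchedCovering

/-! ### Lifts through piecewise linear maps with finite fibres. -/

section PiecewiseLinear

variable {E F G : Type*} [NormedAddCommGroup E] [NormedSpace ℝ E]
  [NormedAddCommGroup F] [NormedSpace ℝ F]
  [NormedAddCommGroup G] [NormedSpace ℝ G]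

open Geometry.SimplicialComplex

lemma IsBary.exists_lift [DecidableEq F] {σ : Finset G} {A : G →ᵃ[ℝ] F}
    (hinj : InjOn A (convexHull ℝ (σ : Set G))) {w : F →₀ ℝ} {x : F} (hw : IsBary w x)
    (hs : w.support ⊆ σ.image A) :
    ∃ (u : G →₀ ℝ) (a : G), IsBary u a ∧ u.support ⊆ σ ∧ A a = x ∧ ∀ v ∈ σ, u v = w (A v) := by
  classical
  have hinj' : InjOn A σ := hinj.mono (subset_convexHull ℝ _)
  let u : G →₀ ℝ := ∑ v ∈ σ, Finsupp.single v (w (A v))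
  have hu : ∀ v, u v = if v ∈ σ then w (A v) else 0 := fun v => by
    simp [u, Finsupp.finsetSum_apply, Finsupp.single_apply]
  have hsupp : u.support ⊆ σ := fun v hv => by
    by_contra h
    rw [Finsupp.mem_support_iff, hu, if_neg h] at hv
    exact hv rfl
  have hb : IsBary u (weightedPoint u) := by
    refine ⟨fun v => ?_, ?_, rfl⟩
    · rw [hu]
      split_ifs
      exacts [hw.nonneg _, le_rfl]
    · rw [totalWeight_eq_sum hsupp, ← hw.total, totalWeight_eq_sum hs, Finset.sum_image hinj']
      exact Finset.sum_congr rfl fun v hv => by rw [hu, if_pos hv]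
  refine ⟨u, _, hb, hsupp, ?_, fun v hv => by rw [hu, if_pos hv]⟩
  rw [hb.map_affine A hsupp, ← hw.point, weightedPoint_eq_sum hs, Finset.sum_image hinj']
  exact Finset.sum_congr rfl fun v hv => by rw [hu, if_pos hv]

/-- An affine map which is injective on a simplex has an affine inverse there. -/
lemma exists_affine_inverse [FiniteDimensional ℝ F] [DecidableEq F] {σ : Finset G} (hσ : AffineIndependent ℝ ((↑) : σ → G))
    {A : G →ᵃ[ℝ] F} (hinj : InjOn A (convexHull ℝ (σ : Set G))) :
    AffineIndependent ℝ ((↑) : ↥(σ.image A) → F) ∧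
      ∃ h : F →ᵃ[ℝ] G, ∀ y ∈ convexHull ℝ (σ : Set G), h (A y) = y := by
  have hind : AffineIndependent ℝ ((↑) : ↥(σ.image A) → F) := by
    refine affineIndependent_of_isBary_unique fun w w' x hw hw' hs hs' => ?_
    obtain ⟨u, a, hu, hus, hua, huw⟩ := hw.exists_lift hinj hs
    obtain ⟨u', a', hu', hus', hua', huw'⟩ := hw'.exists_lift hinj hs'
    have haa : a = a' := hinj (hu.mem_convexHull hus) (hu'.mem_convexHull hus')
      (hua.trans hua'.symm)
    subst haa
    have := hu.unique_of_affineIndependent hσ hu' hus hus'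
    ext b
    by_cases hb : b ∈ σ.image A
    · obtain ⟨v, hv, rfl⟩ := Finset.mem_image.1 hb
      rw [← huw v hv, ← huw' v hv, this]
    · rw [Finsupp.notMem_support_iff.1 fun h => hb (hs h),
        Finsupp.notMem_support_iff.1 fun h => hb (hs' h)]
  refine ⟨hind, ?_⟩
  obtain ⟨c, -, hc, -⟩ := exists_affine_coord hind
  -- The inverse reads off the coordinates in the image simplex and uses them as weights on the
  -- vertices of σ.
  refine ⟨(Fintype.linearCombination ℝ (fun v : σ => (v : G))).toAffineMap.comp
    (AffineMap.pi fun v : σ => c (A v)), fun y hy => ?_⟩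
  have hAy : A y ∈ convexHull ℝ ((σ.image A : Finset F) : Set F) := by
    rw [Finset.coe_image, ← AffineMap.image_convexHull]
    exact ⟨y, hy, rfl⟩
  obtain ⟨w, hw, hs⟩ := exists_isBary_of_mem_convexHull hAy
  obtain ⟨u, a, hu, hus, hua, huw⟩ := hw.exists_lift hinj hs
  have hay : a = y := hinj (hu.mem_convexHull hus) hy hua
  have : (Fintype.linearCombination ℝ (fun v : σ => (v : G))) (fun v : σ => c (A v) (A y)) = a := by
    rw [Fintype.linearCombination_apply, ← hu.point, weightedPoint_eq_sum hus, ← Finset.sum_coe_sort σ]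
    exact Finset.sum_congr rfl fun v _ => by rw [hc w _ hw hs, huw v v.2]
  exact this.trans hay

/-- A map with finite fibres is injective on any set on which it is affine. -/
lemma injOn_of_finite_fiber {Y : Set G} {X : Set F} {f : Y → X} (hfin : ∀ x, (f ⁻¹' {x}).Finite)
    {s : Set G} (hs : Convex ℝ s) (hsY : s ⊆ Y) {A : G →ᵃ[ℝ] F}
    (hA : ∀ y : Y, (y : G) ∈ s → (f y : F) = A y) : InjOn A s := by
  intro a ha b hb hab
  by_contra hne
  -- If two points had the same image, the whole segment between them would lie in one fibre.
  have hinf : (AffineMap.lineMap a b '' Icc (0 : ℝ) 1 : Set G).Infinite :=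
    (Icc_infinite zero_lt_one).image (AffineMap.lineMap_injective ℝ hne).injOn
  refine hinf (((hfin (f ⟨a, hsY ha⟩)).image Subtype.val).subset ?_)
  rintro _ ⟨t, ht, rfl⟩
  have hm : AffineMap.lineMap a b t ∈ s := hs.lineMap_mem ha hb ht
  refine ⟨⟨_, hsY hm⟩, Subtype.ext ?_, rfl⟩
  rw [hA _ hm, hA _ ha, AffineMap.apply_lineMap, hab, AffineMap.lineMap_same_apply]

lemma convex_carrier_eq (T : Geometry.SimplicialComplex ℝ E) (s : Finset E) :
    Convex ℝ {x | x ∈ T.space ∧ T.carrier x = s} := by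
  rintro x ⟨hx, hxs⟩ y ⟨hy, hys⟩ a b ha hb hab
  rcases hb.eq_or_lt with rfl | hb
  · obtain rfl : a = 1 := by linarith
    simpa using ⟨hx, hxs⟩
  · obtain ⟨h1, h2⟩ := carrier_combo hx hy (hxs.trans hys.symm).subset ha hb hab
    exact ⟨h1, h2.trans hys⟩

lemma isPreconnected_carrier_eq {T : Geometry.SimplicialComplex ℝ E} {Y : Set E}
    (hT : T.space = Y) (s : Finset E) : IsPreconnected {y : Y | T.carrier y = s} := by
  rw [← Topology.IsInducing.subtypeVal.isPreconnected_image]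
  convert (convex_carrier_eq T s).isPreconnected using 1
  ext x
  constructor
  · rintro ⟨y, hy, rfl⟩
    exact ⟨hT.symm ▸ y.2, hy⟩
  · rintro ⟨hx, hxs⟩
    exact ⟨⟨x, hT ▸ hx⟩, hxs, rfl⟩

lemma mem_closure_carrier_eq {T : Geometry.SimplicialComplex ℝ E} {Y : Set E}
    (hT : T.space = Y) {s : Finset E} (hs : s ∈ T.faces) {y : Y}
    (hy : (y : E) ∈ convexHull ℝ (s : Set E)) : y ∈ closure {y : Y | T.carrier y = s} := by
  rw [closure_subtype]
  obtain ⟨hb, hbc⟩ := barycenter_mem hs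
  have hyT : (y : E) ∈ T.space := hT.symm ▸ y.2
  have hsub : openSegment ℝ (y : E) s.barycenter ⊆ Subtype.val '' {y : Y | T.carrier y = s} := by
    rintro _ ⟨a, b, ha, hb', hab, rfl⟩
    obtain ⟨h1, h2⟩ := carrier_combo hyT hb
      (((mem_convexHull_iff_carrier_subset hyT hs).1 hy).trans hbc.ge) ha.le hb' hab
    exact ⟨⟨_, hT ▸ h1⟩, h2.trans hbc, rfl⟩
  refine closure_mono hsub ?_
  exact segment_subset_closure_openSegment (left_mem_segment ℝ _ _)

/-- A continuous lift of an affine map through a piecewise linear map with finite fibres is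
piecewise linear. -/
lemma isPiecewiseLinear_of_lift [FiniteDimensional ℝ E] [FiniteDimensional ℝ F]
    {Y : Set E} {X : Set F} {Y' : Set G}
    {K : Geometry.SimplicialComplex ℝ E} (hK : IsTriangulation K Y) {f : Y → X} {A : E →ᵃ[ℝ] F}
    (hA : ∀ y, (f y : F) = A y) {f' : Y' → X} (hf' : IsPiecewiseLinear f')
    (hfin : ∀ x, (f' ⁻¹' {x}).Finite) {g : Y → Y'} (hg : Continuous g) (hfg : f' ∘ g = f) :
    IsPiecewiseLinear g := by
  classical
  obtain ⟨L, hL, hA'⟩ := hf'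
  choose! A' hA' using hA'
  have hsub : ∀ σ ∈ L.faces, convexHull ℝ (σ : Set G) ⊆ Y' := fun σ hσ =>
    hL.space_eq ▸ convexHull_subset_space hσ
  have hinj : ∀ σ ∈ L.faces, InjOn (A' σ) (convexHull ℝ (σ : Set G)) := fun σ hσ =>
    injOn_of_finite_fiber hfin (convex_convexHull ℝ _) (hsub σ hσ) (hA' σ hσ)
  have himg : ∀ σ, A' σ '' convexHull ℝ (σ : Set G) =
      convexHull ℝ ((σ.image (A' σ) : Finset F) : Set F) := fun σ => by
    rw [Finset.coe_image, AffineMap.image_convexHull]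
  choose! h hh using fun σ hσ => (exists_affine_inverse (L.indep hσ) (hinj σ hσ)).2
  -- The domain is subdivided until each open simplex maps into, or misses, every image of a simplex
  -- of `L`.
  obtain ⟨T, hT, hcomp⟩ := K.exists_subdivides_compatible hK.finite A
    (S := (fun σ => σ.image (A' σ)) '' L.faces) (hL.finite.image _) (by
      rintro _ ⟨σ, hσ, rfl⟩
      exact (exists_affine_inverse (L.indep hσ) (hinj σ hσ)).1)
  have hTY : T.space = Y := hT.space_eq.trans hK.space_eq
  have hgL : ∀ y, (g y : G) ∈ L.space := fun y => hL.space_eq.symm ▸ (g y).2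
  have hfA : ∀ y, (f' (g y) : F) = A y := fun y => by
    rw [← hA, ← hfg]; rfl
  refine ⟨T, ⟨hT.finite hK.finite, hTY⟩, fun s hs => ?_⟩
  obtain ⟨hb, hbc⟩ := barycenter_mem hs
  -- the vertices of `s` are mapped to the image of any simplex meeting the image of its interior
  have hvert : ∀ σ ∈ L.faces, ∀ y : Y, T.carrier y = s →
      A y ∈ convexHull ℝ ((σ.image (A' σ) : Finset F) : Set F) →
      ∀ v ∈ s, A v ∈ convexHull ℝ ((σ.image (A' σ) : Finset F) : Set F) := by
    intro σ hσ y hy hAy v hv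
    exact hcomp _ ⟨σ, hσ, rfl⟩ y (hTY.symm ▸ y.2) hAy v (hy.symm ▸ hv)
  have hlift : ∀ σ ∈ L.faces,
      (∀ v ∈ s, A v ∈ convexHull ℝ ((σ.image (A' σ) : Finset F) : Set F)) →
      ∀ y : Y, T.carrier y = s → ∃ z ∈ convexHull ℝ (σ : Set G), A' σ z = A y := by
    intro σ hσ hv y hy
    have hys : (y : E) ∈ convexHull ℝ (s : Set E) :=
      hy ▸ mem_convexHull_carrier (hTY.symm ▸ y.2)
    have : A y ∈ A '' convexHull ℝ (s : Set E) := ⟨y, hys, rfl⟩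
    rw [AffineMap.image_convexHull] at this
    have h2 := convexHull_min (by rintro _ ⟨v, hvs, rfl⟩; exact hv v hvs)
      (convex_convexHull ℝ ((σ.image (A' σ) : Finset F) : Set F)) this
    rw [← himg] at h2
    exact h2
  -- On an open simplex, `g` agrees at each point with one of finitely many affine candidates `h σ ∘
  -- A`. The sets of agreement are closed and coincide or are disjoint there, so connectedness
  -- selects one candidate.
  obtain ⟨σ, hσ, hsσ⟩ := (isPreconnected_carrier_eq hTY s).exists_subset_of_closed_cover
    ⟨⟨_, hTY ▸ hb⟩, hbc⟩
    (J := {σ ∈ L.faces | ∀ v ∈ s, A v ∈ convexHull ℝ ((σ.image (A' σ) : Finset F) : Set F)})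
    (hL.finite.subset (sep_subset _ _)) (C := fun σ => {y : Y | (g y : G) = h σ (A y)})
    (fun σ _ => isClosed_eq (continuous_subtype_val.comp hg)
      ((AffineMap.continuous_of_finiteDimensional ((h σ).comp A)).comp continuous_subtype_val))
    (fun y hy => by
      have hc := L.carrier_mem (hgL y)
      have hm := mem_convexHull_carrier (hgL y)
      have hAy : A' (L.carrier (g y)) (g y) = A y := (hA' _ hc (g y) hm).symm.trans (hfA y)
      refine ⟨L.carrier (g y), ⟨hc, hvert _ hc y hy ?_⟩, ?_⟩
      · rw [← himg]
        exact ⟨_, hm, hAy⟩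
      · change (g y : G) = h _ (A y)
        rw [← hAy, hh _ hc _ hm])
    (by
      rintro σ ⟨hσ, hσv⟩ τ ⟨hτ, hτv⟩ ⟨y₀, hy₀, hyσ, hyτ⟩ y ⟨hy, hyC⟩
      change (g y₀ : G) = h σ (A y₀) at hyσ
      change (g y₀ : G) = h τ (A y₀) at hyτ
      change (g y : G) = h σ (A y) at hyC
      change (g y : G) = h τ (A y)
      obtain ⟨z, hz, hzA⟩ := hlift σ hσ hσv y₀ hy₀
      rw [← hzA, hh σ hσ z hz] at hyσ
      obtain ⟨z', hz', hzA'⟩ := hlift τ hτ hτv y₀ hy₀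
      rw [← hzA', hh τ hτ z' hz'] at hyτ
      -- If two candidates agree with `g` at `y₀`, the carrier of `g y₀` is a face of both
      -- simplices. The open simplex lifts into this common face, where both inverses return the
      -- same point.
      have hρ := L.carrier_mem (hgL y₀)
      have hρσ := (mem_convexHull_iff_carrier_subset (hgL y₀) hσ).1 (hyσ ▸ hz)
      have hρτ := (mem_convexHull_iff_carrier_subset (hgL y₀) hτ).1 (hyτ ▸ hz')
      have hm := mem_convexHull_carrier (hgL y₀)
      have hAy : A' (L.carrier (g y₀)) (g y₀) = A y₀ := (hA' _ hρ (g y₀) hm).symm.trans (hfA y₀)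
      have hρv := hvert _ hρ y₀ hy₀ (by rw [← himg]; exact ⟨_, hm, hAy⟩)
      obtain ⟨u, hu, huA⟩ := hlift _ hρ hρv y hy
      have huσ := convexHull_mono (Finset.coe_subset.2 hρσ) hu
      have huτ := convexHull_mono (Finset.coe_subset.2 hρτ) hu
      have e0 := hA' _ hρ ⟨u, hsub _ hρ hu⟩ hu
      have e1 := hA' _ hσ ⟨u, hsub _ hρ hu⟩ huσ
      have e2 := hA' _ hτ ⟨u, hsub _ hρ hu⟩ huτ
      have e1' : A y = A' σ u := huA.symm.trans (e0.symm.trans e1)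
      have e2' : A y = A' τ u := huA.symm.trans (e0.symm.trans e2)
      rw [hyC, e1', hh σ hσ u huσ, ← e1', e2', hh τ hτ u huτ])
  refine ⟨(h σ).comp A, fun y hy => ?_⟩
  have hcl : IsClosed {y : Y | (g y : G) = h σ (A y)} := isClosed_eq (continuous_subtype_val.comp hg)
    ((AffineMap.continuous_of_finiteDimensional ((h σ).comp A)).comp continuous_subtype_val)
  exact hcl.closure_subset_iff.2 hsσ (mem_closure_carrier_eq hTY hs hy)

end PiecewiseLinear

/-! ### Local connectedness at the added points, and the conclusion. -/

namespace Geometry.SimplicialComplex.CoverSimplex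

variable {E : Type*} [NormedAddCommGroup E] [NormedSpace ℝ E]
  {K : SimplicialComplex ℝ E} {V : Set K.space} {D : Set (Finset E)}
  {Y₁ : Type*} [TopologicalSpace Y₁] {f₁ : Y₁ → ↥(Vᶜ)} {N : ℕ}
  [Fintype K.faces] [Fintype (CoverSimplex f₁)] {ι : CoverSimplex f₁ ≃ Fin N}

-- If `q` is the top simplex of `p`, the points of `Y₁` near `p` are exactly those of the sheet of
-- `q` over a small ball, and these form a connected set. The ball is small enough for the layer at
-- `q` to remain nonzero.
open Topology in
lemma exists_nhds_isPreconnected_preimage (hD : ∀ x : K.space, x ∈ V ↔ K.carrier x ∈ D)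
    (cov : IsCoveringMap f₁) (p : completion ι) {O : Set K.space} (hO : O ∈ 𝓝 (completionMap ι p)) :
    ∃ W ∈ 𝓝 p, W ⊆ completionMap ι ⁻¹' O ∧ IsPreconnected (completionIncl ι ⁻¹' W) := by
  obtain ⟨q, hq, -, hc⟩ := exists_top (coords_mem p)
  change K.carrier (completionMap ι p : E) = _ at hc
  have hl : K.layers (completionMap ι p : E) q.face ≠ 0 := by
    change K.layers (coverSum (coords ι p.1)) q.face ≠ 0
    rwa [layers_coverSum (coords_mem p), push_face (coords_mem p) hq]
  have hlo : {x : K.space | K.layers x q.face ≠ 0} ∈ 𝓝 (completionMap ι p) :=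
    (isOpen_ne.preimage ((continuous_apply q.face).comp continuous_layers)).mem_nhds hl
  obtain ⟨ε, hε, hεsub⟩ := Metric.mem_nhds_iff.1 (Filter.inter_mem hO hlo)
  refine ⟨{z | coords ι z.1 q ≠ 0} ∩ completionMap ι ⁻¹' Metric.ball (completionMap ι p) ε,
    IsOpen.mem_nhds ((isOpen_ne.preimage (continuous_coords q)).inter
      (Metric.isOpen_ball.preimage continuous_completionMap)) ⟨hq, Metric.mem_ball_self hε⟩,
    fun z hz => (hεsub hz.2).1, ?_⟩
  obtain ⟨y, hy⟩ := q.star_nonempty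
  convert isPreconnected_sheet_inter hD cov (completionMap ι p).2 y hε using 1
  rw [hc, ← star_eq hy]
  ext z
  have h1 : completionIncl ι z ∈ completionMap ι ⁻¹' Metric.ball (completionMap ι p) ε ↔
      dist (basePoint f₁ z) (completionMap ι p) < ε := by
    rw [mem_preimage, completionMap_completionIncl, Metric.mem_ball, Subtype.dist_eq]
    rfl
  have h2 : completionIncl ι z ∈ {z : completion ι | coords ι z.1 q ≠ 0} ↔ coverWeights z q ≠ 0 := by
    rw [Set.mem_ofPred_eq, coords_completionIncl]
  constructor
  · rintro ⟨hz1, hz2⟩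
    exact ⟨mem_star_of_coverWeights_ne (h2.1 hz1), h1.1 hz2⟩
  · rintro ⟨hz1, hz2⟩
    refine ⟨h2.2 ?_, h1.2 hz2⟩
    rw [coverWeights, if_pos hz1]
    have := (hεsub (h1.2 hz2)).2
    rwa [completionMap_completionIncl] at this

end Geometry.SimplicialComplex.CoverSimplex

open Geometry.SimplicialComplex Geometry.SimplicialComplex.CoverSimplex

theorem mainTheorem6 {m : ℕ} (n : ℕ) (X : Set (EuclideanSpace ℝ (Fin m)))
    (hX : IsPseudomanifold n X) (V : Set X) (hV : IsSubpolyhedronOfCodimGE n 2 V)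
    {Y₁ : Type*} [TopologicalSpace Y₁] (f₁ : Y₁ → ↥(Vᶜ)) (hf₁ : IsCoveringMap f₁)
    (hfin : ∀ x, (f₁ ⁻¹' {x}).Finite) :
    ∃ (N : ℕ) (Y : Set (EuclideanSpace ℝ (Fin N))) (f : Y → X) (i : Y₁ → Y),
      IsPseudomanifold n Y ∧
      IsBranchedCovering f (f ⁻¹' V) ∧
      (∀ k : ℕ, (∀ x, (f₁ ⁻¹' {x}).ncard = k) → IsFoldBranchedCovering k f (f ⁻¹' V)) ∧
      IsExtension f₁ f i ∧
      ∀ (M : ℕ) (Y' : Set (EuclideanSpace ℝ (Fin M))) (f' : Y' → X) (B' : Set Y') (i' : Y₁ → Y'),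
        IsBranchedCovering f' B' → IsExtension f₁ f' i' →
        ∃! g : Y → Y', (∃ C : Set Y, IsFoldBranchedCovering 1 g C) ∧ f' ∘ g = f ∧ g ∘ i = i' := by
  obtain ⟨K₀, hK₀, hpure₀, hnb₀⟩ := id hX
  obtain ⟨L, hL, hLdim⟩ := id hV
  obtain ⟨K, hK, D, hLD, hdown, hdim⟩ := exists_subdivides_subcomplex hK₀.finite hL.finite
  obtain rfl : K.space = X := hK.space_eq.trans hK₀.space_eq
  have hpure : K.IsPure n := hK.isPure n hpure₀
  have hnb : K.IsNonbranching n := hK.isNonbranching n hpure₀ hnb₀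
  have hD : ∀ x : K.space, x ∈ V ↔ K.carrier x ∈ D := fun x => by
    rw [← hLD x x.2, hL.space_eq, Subtype.val_injective.mem_set_image]
  have hdim' : ∀ s ∈ K.faces, s ∈ D → s.card < n := fun s hs hsD => by
    -- Truncated subtraction does no harm for `n = 0`: faces are nonempty, so a bound of zero is
    -- contradictory.
    have h1 := hdim (n - 1) (fun t ht => by have := hLdim t ht; omega) s hs hsD
    have h2 := (K.nonempty_of_mem_faces hs).card_pos
    omega
  have : Fintype K.faces := (hK.finite hK₀.finite).fintype
  have : Finite (CoverSimplex f₁) := CoverSimplex.finite hD hf₁ hdown hfin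
  have : Fintype (CoverSimplex f₁) := Fintype.ofFinite _
  let ι : CoverSimplex f₁ ≃ Fin (Fintype.card (CoverSimplex f₁)) := Fintype.equivFin _
  have hY : IsPseudomanifold n (completion ι) :=
    isPseudomanifold_completion hD hf₁ hdown hpure hnb hdim'
  have hB : IsSubpolyhedronOfCodimGE n 2 (completionMap ι ⁻¹' V) :=
    isSubpolyhedron_preimage hD hdown hdim'
  have hext : IsExtension f₁ (completionMap ι) (completionIncl ι) :=
    isExtension_completionMap hD hf₁ hdown
  have : CompactSpace (completion ι) := isCompact_iff_compactSpace.1 hY.isCompact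
  have hVd : Dense Vᶜ := hV.dense_compl two_ne_zero hX
  have hrange : IsClosed (range (completionMap ι)) :=
    (isCompact_range continuous_completionMap).isClosed
  have hbr : IsBranchedCovering (completionMap ι) (completionMap ι ⁻¹' V) :=
    { target := ⟨n, hX⟩
      source := ⟨n, hY, hB⟩
      piecewiseLinear := isPiecewiseLinear_completionMap
      finite_fiber := finite_fiber_completionMap
      mapsTo := mapsTo_compl_preimage _ V
      covering := hext.isCoveringMap hf₁ hV.isClosed hrange }
  refine ⟨_, completion ι, completionMap ι, completionIncl ι, hY, hbr,
    fun k hk => ⟨hbr, hext.ncard_fiber hrange hVd hk⟩, hext, ?_⟩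
  intro M Y' f' B' i' hf' hext'
  obtain ⟨n', hY', -⟩ := hf'.source
  have : CompactSpace Y' := isCompact_iff_compactSpace.1 hY'.isCompact
  have hdi := hext.isDenseInducing (hB.dense_compl two_ne_zero hY)
  obtain ⟨g, hg, hfg, hgi⟩ := exists_continuous_extension continuous_completionMap
    hf'.piecewiseLinear.continuous hf'.finite_fiber hdi hext'.isEmbedding.continuous
    (fun y => by rw [hext.comm, hext'.comm])
    (fun p O hO => exists_nhds_isPreconnected_preimage hD hf₁ p hO)
  have hpl : IsPiecewiseLinear g := isPiecewiseLinear_of_lift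
    (K := orderComplex label ι label_nonempty) ⟨orderComplex_finite label_nonempty, rfl⟩
    (A := (completionLinear ι).toAffineMap) (fun _ => rfl) hf'.piecewiseLinear hf'.finite_fiber hg hfg
  refine ⟨g, ⟨⟨_, hext.isFoldBranchedCovering hY hB finite_fiber_completionMap hext' hf' hVd hpl
    hfg hgi⟩, hfg, hgi⟩, ?_⟩
  rintro g' ⟨⟨C, hC⟩, -, hgi'⟩
  -- Continuity and density of `Y₁` already force uniqueness; neither the covering property nor
  -- compatibility over `X` is needed here.
  exact hdi.dense.equalizer hC.piecewiseLinear.continuous hg (hgi'.trans hgi.symm)
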